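/- **Setting.** For each $m\ge 1$ let $\boldsymbol X_{k,j}=(X_{k,1,j},\dots,X_{k,m,j})$, $1\le k\le n_j$, $j=1,2$, be mutually independent random vectors in $\mathbb R^m$, where for each $j$ the vectors $\boldsymbol X_{1,j},\dots,\boldsymbol X_{n_j,j}$ have the law of $\boldsymbol X_j=(X_{1,j},\dots,X_{m,j})$, and $\boldsymbol X_1,\boldsymbol X_2$ are independent; the laws, the sample sizes $n_j$ and the probability space may depend on $m$. Let $\mu_{i,j}=\mathbb E X_{i,j}$, $\sigma_{i,j}^2=\operatorname{Var}(X_{i,j})\in(0,\infty)$, $\mathcal H_0=\{i\le m:\mu_{i,1}=\mu_{i,2}\}$, $\mathcal H_1=\{i\le m:\mu_{i,1}\ne\mu_{i,2}\}$, $\bar X_{i,j}=n_j^{-1}\sum_{k}X_{k,i,j}$. Let $T_i$ be one of the two-sample Student statistics $$T_i=\frac{\bar X_{i,1}-\bar X_{i,2}}{\sqrt{\hat\sigma_{i,1}^2/n_1+\hat\sigma_{i,2}^2/n_2}},\qquad \hat\sigma^2_{i,j}=\frac1{n_j-1}\sum_{k=1}^{n_j}(X_{k,i,j}-\bar X_{i,j})^2,$$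 or, provided that $\sigma^2_{i,1}=\sigma^2_{i,2}$ for all $i\le m$, $$T_i=\sqrt{\frac{n_1n_2}{(n_1+n_2)\hat\sigma^2_{i,pool}}}\,(\bar X_{i,1}-\bar X_{i,2}),\qquad \hat\sigma^2_{i,pool}=\frac1{n_1+n_2-2}\sum_{j=1}^2\sum_{k=1}^{n_j}(X_{k,i,j}-\bar X_{i,j})^2$$ (the same choice for all $i$ and $m$). Let $p_i=2-2\Psi(|T_i|)$, where $\Psi$ is the distribution function of Student's $t$ distribution with $n_1+n_2-2$ degrees of freedom, and let $p_{(1)}\le\dots\le p_{(m)}$ be the ordered p-values. For fixed $0<\alpha<1$, the Benjamini–Hochberg (BH) method rejects $i$ if and only if $p_i\le p_{(\hat k)}$, where $\hat k$ is the largest $1\le k\le m$ with $p_{(k)}\le\alpha k/m$; it rejects nothing if there is no such $k$. Its power is $$\mathrm{power}_{BH}=\frac{|\{i\in\mathcal H_1: i\text{ is rejected}\}|}{|\mathcal H_1|}.$$ **Theorem.** Assume that there are positive constants $K_1,t_0,c_1,c_2,c,K$ and $\zeta>5$, not depending on $m$, such that for all sufficiently large $m$: * $\mathbb E\exp(t_0|X_{i,j}-\mu_{i,j}|/\sigma_{i,j})\le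 K_1$ for all $i\le m$, $j=1,2$; $c_1\le n_1/n_2\le c_2$; $c_1\le\sigma_{i,1}^2/\sigma_{i,2}^2\le c_2$ for all $i\le m$; and $\min(n_1,n_2)\ge c(\log m)^\zeta$; * for every $i\in\mathcal H_0$ there is $\mathcal M_i\subset\mathcal H_0$ with $|\mathcal M_i|\ge|\mathcal H_0|-K$ such that the family $\{(X_{l,1},X_{l,2}):l\in\mathcal M_i\}$ is independent of $(X_{i,1},X_{i,2})$. Let $\theta>0$ and $0<\beta<1$ be constants such that, for all sufficiently large $m$, $$\frac{|\mu_{i,1}-\mu_{i,2}|}{\sqrt{\sigma^2_{i,1}/n_1+\sigma^2_{i,2}/n_2}}=\theta\sqrt{\log m}\quad\text{for all } i\in\mathcal H_1,$$ and $|\mathcal H_1|/m^\beta\to1$ as $m\to\infty$. If $0<\theta<\sqrt{2(1-\beta)}$, then $\mathrm{power}_{BH}\to0$ in probability as $m\to\infty$. If $\theta>\sqrt{2(1-\beta)}$, then $\mathrm{power}_{BH}\to1$ in probability as $m\to\infty$. -/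

import Mathlib

open MeasureTheory ProbabilityTheory Filter Topology

noncomputable section

/-- Two independent i.i.d. samples of random vectors in `ℝ^m`, defined on the probability
space `(Ω, P)`. The populations (indexed by `j : Fin 2`) are given by their laws `pop j` on `ℝ^m`;
the sizes are `n 0`, `n 1`. Nothing is assumed on the dependence between the coordinates. -/
structure TwoSample (m : ℕ) {Ω : Type*} [MeasurableSpace Ω] (P : Measure Ω) where
  /-- sample sizes -/
  n : Fin 2 → ℕ
  /-- population laws -/
  pop : Fin 2 → Measure (Fin m → ℝ)
  isProbabilityMeasure_pop : ∀ j, IsProbabilityMeasure (pop j)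
  /-- means and variances of the coordinates exist -/
  memLp_two : ∀ j i, MemLp (fun x : Fin m → ℝ => x i) 2 (pop j)
  /-- `X j k ω i` is the `i`-th coordinate of the `k`-th observation of sample `j` -/
  X : ∀ j : Fin 2, Fin (n j) → Ω → (Fin m → ℝ)
  hasLaw : ∀ j k, HasLaw (X j k) (pop j) P
  /-- all observations, of both samples together, are mutually independent -/
  indep : iIndepFun (fun q : (Σ j : Fin 2, Fin (n j)) => X q.1 q.2) P

/-- Which of the two versions of the two-sample `t` statistic is used: the pooled one (for equal
variances) or the unpooled one (for variances that are not necessarily equal). -/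
inductive VarianceCase where
  | equal
  | unequal

namespace TwoSample

variable {m : ℕ} {Ω : Type*} [MeasurableSpace Ω] {P : Measure Ω} (D : TwoSample m P)

/-- Population mean of coordinate `i` in population `j`. -/
def mean (j : Fin 2) (i : Fin m) : ℝ := ∫ x, x i ∂(D.pop j)

/-- Population variance of coordinate `i` in population `j`. -/
def var (j : Fin 2) (i : Fin m) : ℝ := variance (fun x : Fin m → ℝ => x i) (D.pop j)

open Classical in
/-- The set of true null hypotheses. -/
def nulls : Finset (Fin m) := Finset.univ.filter fun i => D.mean 0 i = D.mean 1 i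

open Classical in
/-- The set of signals (false null hypotheses). -/
def signals : Finset (Fin m) := Finset.univ.filter fun i => D.mean 0 i ≠ D.mean 1 i

/-- Standardized size of the mean difference of coordinate `i`. -/
def signalSize (i : Fin m) : ℝ :=
  |D.mean 0 i - D.mean 1 i| / √(D.var 0 i / D.n 0 + D.var 1 i / D.n 1)

/-- Sample mean. -/
def sampleMean (j : Fin 2) (i : Fin m) (ω : Ω) : ℝ := (1 / (D.n j : ℝ)) * ∑ k, D.X j k ω i

/-- Sum of squared deviations from the sample mean. -/
def sumSqDev (j : Fin 2) (i : Fin m) (ω : Ω) : ℝ :=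
  ∑ k, (D.X j k ω i - D.sampleMean j i ω) ^ 2

/-- Sample variance. -/
def sampleVar (j : Fin 2) (i : Fin m) (ω : Ω) : ℝ :=
  (1 / ((D.n j : ℝ) - 1)) * D.sumSqDev j i ω

/-- Pooled sample variance. -/
def pooledVar (i : Fin m) (ω : Ω) : ℝ :=
  (1 / ((D.n 0 : ℝ) + D.n 1 - 2)) * (D.sumSqDev 0 i ω + D.sumSqDev 1 i ω)

/-- Two-sample Student `t` statistic of coordinate `i`. -/
def tStat : VarianceCase → Fin m → Ω → ℝ
  | .equal, i, ω =>
      √((D.n 0 * D.n 1 : ℝ) / ((D.n 0 + D.n 1 : ℝ) * D.pooledVar i ω)) *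
        (D.sampleMean 0 i ω - D.sampleMean 1 i ω)
  | .unequal, i, ω =>
      (D.sampleMean 0 i ω - D.sampleMean 1 i ω) /
        √(D.sampleVar 0 i ω / D.n 0 + D.sampleVar 1 i ω / D.n 1)

end TwoSample

/-- Density of Student's `t` distribution with `ν` degrees of freedom. -/
def studentTPDF (ν x : ℝ) : ℝ :=
  Real.Gamma ((ν + 1) / 2) / (√(ν * Real.pi) * Real.Gamma (ν / 2)) *
    (1 + x ^ 2 / ν) ^ (-((ν + 1) / 2))

/-- Distribution function of Student's `t` distribution with `ν` degrees of freedom. -/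
def studentTCDF (ν t : ℝ) : ℝ := ∫ x in Set.Iic t, studentTPDF ν x

/-- The `k`-th smallest (`k = 0, …, m - 1`) of the numbers `p 0, …, p (m - 1)`. -/
def orderStat {m : ℕ} (p : Fin m → ℝ) (k : Fin m) : ℝ := p (Tuple.sort p k)

/-- Rejection set of the Benjamini–Hochberg method at level `α` for the p-values `p`: with `k + 1`
the largest rank such that `p_(k+1) ≤ α (k+1) / m`, reject every `i` with `p i ≤ p_(k+1)`; reject
nothing if there is no such rank. (The `k : Fin m` below has rank `k + 1`.) -/
def bhRejections {m : ℕ} (α : ℝ) (p : Fin m → ℝ) : Set (Fin m) :=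
  {i | ∃ k : Fin m, IsGreatest {l : Fin m | orderStat p l ≤ α * ((l : ℝ) + 1) / m} k ∧
    p i ≤ orderStat p k}

namespace TwoSample

variable {m : ℕ} {Ω : Type*} [MeasurableSpace Ω] {P : Measure Ω} (D : TwoSample m P)

/-- The p-value `2 - 2 Ψ(|T_i|)`, with `Ψ` Student's `t` distribution function with
`n₁ + n₂ - 2` degrees of freedom. -/
def pValue (v : VarianceCase) (ω : Ω) (i : Fin m) : ℝ :=
  2 - 2 * studentTCDF ((D.n 0 : ℝ) + D.n 1 - 2) |D.tStat v i ω|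

open Classical in
/-- Power of the Benjamini–Hochberg method at level `α`: the proportion of rejected signals. -/
def powerBH (v : VarianceCase) (α : ℝ) (ω : Ω) : ℝ :=
  ((D.signals.filter fun i => i ∈ bhRejections α (D.pValue v ω)).card : ℝ) / D.signals.card

end TwoSample

variable {Ω : ℕ → Type*} [∀ m, MeasurableSpace (Ω m)] {P : ∀ m, Measure (Ω m)}

/-- Exponential moments, balanced sample sizes and variances, and growth of the sample sizes;
all constants are independent of the dimension `m` (which tends to infinity). -/
def MomentCondition (D : ∀ m, TwoSample m (P m)) : Prop :=
  ∃ K₁ t₀ c₁ c₂ ζ c : ℝ, 0 < K₁ ∧ 0 < t₀ ∧ 0 < c₁ ∧ 0 < c₂ ∧ 5 < ζ ∧ 0 < c ∧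
    ∀ᶠ m in atTop,
      (∀ j i, 0 < (D m).var j i ∧
        ∫⁻ x, ENNReal.ofReal
            (Real.exp (t₀ * |x i - (D m).mean j i| / √((D m).var j i))) ∂((D m).pop j)
          ≤ ENNReal.ofReal K₁) ∧
      (c₁ ≤ ((D m).n 0 : ℝ) / (D m).n 1 ∧ ((D m).n 0 : ℝ) / (D m).n 1 ≤ c₂) ∧
      (∀ i, c₁ ≤ (D m).var 0 i / (D m).var 1 i ∧ (D m).var 0 i / (D m).var 1 i ≤ c₂) ∧
      c * Real.log m ^ ζ ≤ (min ((D m).n 0) ((D m).n 1) : ℕ)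

/-- Every true null coordinate `i` is independent of the family of all but at most `K` of the true
null coordinates, where `K` is independent of `m`. The pair `(X₁, X₂)` of population vectors has
law `(pop 0).prod (pop 1)`, as the two samples are independent. -/
def WeakDependence (D : ∀ m, TwoSample m (P m)) : Prop :=
  ∃ K : ℝ, 0 < K ∧ ∀ᶠ m in atTop, ∀ i ∈ (D m).nulls, ∃ M ⊆ (D m).nulls,
    ((D m).nulls.card : ℝ) - K ≤ M.card ∧
      IndepFun (fun (x : (Fin m → ℝ) × (Fin m → ℝ)) (l : M) => (x.1 l, x.2 l))
        (fun x : (Fin m → ℝ) × (Fin m → ℝ) => (x.1 i, x.2 i))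
        (((D m).pop 0).prod ((D m).pop 1))

/-- Convergence in probability to a constant, for random variables `Y m` defined on probability
spaces that may depend on `m`. -/
def TendstoInProbability (P : ∀ m, Measure (Ω m)) (Y : ∀ m, Ω m → ℝ) (a : ℝ) : Prop :=
  ∀ ε : ℝ, 0 < ε → Tendsto (fun m => P m {ω | ε ≤ |Y m ω - a|}) atTop (𝓝 0)

end

/-! Write L = log m. The Student tail at √(2sL) is m^(-s+o(1)), so p-values of order m^(-s)
correspond to |T| near √(2sL). The statistic of a signal is, up to sign and relative error o(1) with
high probability, θ√L, hence its p-value is m^(-θ²/2+o(1)). BH accepts a cutoff u when u ≤ α #{p ≤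
u}/m. The m^β signals by themselves support cutoffs up to order m^(β-1), while the nulls with p ≤ u
number at most about mu and, because α < 1, never support a cutoff on their own. Signals are
therefore found or lost according as m^(-θ²/2) is far below or far above m^(β-1), that is, as θ²/2
exceeds 1-β or not.

Above the boundary take a cutoff x = m^(-s') with 1-β < s' < θ²/2. Markov's inequality shows that
nearly all signals have p ≤ x; these alone make x admissible, and everything below an admissible
cutoff is rejected (`mem_bhRejections_of_le`, `abs_powerBH_sub_one_lt`). The nulls play no role
here.

Below the boundary take u₀ = m^(-s') with θ²/2 < s' < 1-β. Most signals have p > u₀, so nonvanishing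
power would force a BH cutoff u ≥ u₀. But uniformly in u ≥ u₀ there are at most (1+small) mu nulls
with p ≤ u, the signals are o(mu₀) in number, and α < 1 gives a contradiction (`powerBH_lt`). The
uniform bound on the nulls comes from Chebyshev's inequality under weak dependence
(`prob_count_ge_le`) and a geometric grid of cutoffs (`exists_uniform_count_bound`).

The analytic core is that a null p-value satisfies P(p ≤ u) ≤ (1+o(1)) u down to u = m^(-s')
(`eventually_prob_tStat_ge_le`). It combines three facts: a one-sided Cramér moderate deviation
bound for weighted sums, proved by Lindeberg replacement with an exponentially weighted Taylor
remainder (`lindeberg_replacement`, `exists_prob_sum_ge_le`); exponential concentration of the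
variance estimators from below; and a comparison of the Gaussian and Student tails
(`exists_gaussTail_le_studentTail`). -/

noncomputable section

/-! ### Gaussian tail estimates -/

/-- Unnormalised upper tail of the standard Gaussian. -/
def gaussTail (x : ℝ) : ℝ := ∫ y in Set.Ioi x, Real.exp (-y ^ 2 / 2)

theorem integrable_exp_neg_sq_div_two : Integrable fun y : ℝ => Real.exp (-y ^ 2 / 2) := by
  have := integrable_exp_neg_mul_sq (b := 1 / 2) (by norm_num)
  refine this.congr (ae_of_all _ fun y => ?_)
  simp only; ring_nf

theorem gaussTail_pos (x : ℝ) : 0 < gaussTail x := by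
  unfold gaussTail
  rw [setIntegral_pos_iff_support_of_nonneg_ae]
  · have : Function.support (fun y : ℝ => Real.exp (-y ^ 2 / 2)) = Set.univ := by
      ext y; simp [Real.exp_ne_zero]
    rw [this]; simp
  · exact ae_of_all _ fun y => (Real.exp_pos _).le
  · exact integrable_exp_neg_sq_div_two.integrableOn

/-- On an interval of length 1/(1+x) to the right of x the exponent y²/2 grows by at most 3/2. -/
theorem le_gaussTail {x : ℝ} (hx : 0 ≤ x) :
    Real.exp (-3 / 2) * (Real.exp (-x ^ 2 / 2) / (1 + x)) ≤ gaussTail x := by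
  set w := 1 / (1 + x) with hw
  have hw0 : 0 < w := by positivity
  have hw1 : w ≤ 1 := by rw [hw, div_le_one (by positivity)]; linarith
  have hwx : w * x ≤ 1 := by
    rw [hw, div_mul_eq_mul_div, div_le_one (by positivity)]; linarith
  have h1 : ∫ y in Set.Ioc x (x + w), Real.exp (-x ^ 2 / 2 - 3 / 2) ≤
      ∫ y in Set.Ioc x (x + w), Real.exp (-y ^ 2 / 2) := by
    refine setIntegral_mono_on (by simp) integrable_exp_neg_sq_div_two.integrableOn
      measurableSet_Ioc fun y hy => Real.exp_le_exp.2 ?_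
    have h1 := hy.1
    have h2 := hy.2
    nlinarith
  have h2 : ∫ y in Set.Ioc x (x + w), Real.exp (-y ^ 2 / 2) ≤ gaussTail x :=
    setIntegral_mono_set integrable_exp_neg_sq_div_two.integrableOn
      (ae_of_all _ fun _ => (Real.exp_pos _).le) Set.Ioc_subset_Ioi_self.eventuallyLE
  refine le_trans (le_of_eq ?_) (h1.trans h2)
  simp only [integral_const, MeasurableSet.univ, measureReal_restrict_apply, Set.univ_inter,
    Real.volume_real_Ioc, smul_eq_mul]
  rw [max_eq_left (by linarith), show -x ^ 2 / 2 - 3 / 2 = -3/2 + -x ^ 2 / 2 by ring, Real.exp_add, hw]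
  ring

/-- The Gaussian tail varies on the scale 1/(1+x): the density on (x-d, x] is at most e times its
value at x, and `le_gaussTail` converts the added mass d·exp(1-x²/2) into a multiple of the tail
itself. Every later shift of a threshold is paid for here. -/
theorem gaussTail_sub_le {x d η : ℝ} (hx : 0 ≤ x) (hη : η ≤ 1) (hd : 0 ≤ d)
    (hdx : d * (1 + x) ≤ η) :
    gaussTail (x - d) ≤ (1 + Real.exp (5 / 2) * η) * gaussTail x := by
  have h1 : gaussTail (x - d) =
      (∫ y in Set.Ioc (x - d) x, Real.exp (-y ^ 2 / 2)) + gaussTail x := by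
    unfold gaussTail
    rw [← setIntegral_union (Set.Ioc_disjoint_Ioi le_rfl) measurableSet_Ioi
      integrable_exp_neg_sq_div_two.integrableOn integrable_exp_neg_sq_div_two.integrableOn,
      Set.Ioc_union_Ioi_eq_Ioi (by linarith)]
  have h2 : ∫ y in Set.Ioc (x - d) x, Real.exp (-y ^ 2 / 2) ≤
      ∫ y in Set.Ioc (x - d) x, Real.exp (-x ^ 2 / 2 + 1) := by
    refine setIntegral_mono_on integrable_exp_neg_sq_div_two.integrableOn (by simp)
      measurableSet_Ioc fun y hy => Real.exp_le_exp.2 ?_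
    have h1 := hy.1
    rcases le_total d x with h | h <;> nlinarith [sq_nonneg y, sq_nonneg d]
  have h3 := le_gaussTail hx
  have hg := gaussTail_pos x
  rw [h1]
  simp only [integral_const, MeasurableSet.univ, measureReal_restrict_apply, Set.univ_inter,
    Real.volume_real_Ioc, smul_eq_mul] at h2
  rw [show x - (x - d) = d by ring, max_eq_left hd] at h2
  have h4 : d * Real.exp (-x ^ 2 / 2 + 1) ≤ Real.exp (5 / 2) * η * gaussTail x := by
    have : d ≤ η / (1 + x) := by rw [le_div_iff₀ (by positivity)]; exact hdx
    have hη0 : 0 ≤ η := le_trans (by positivity) hdx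
    calc d * Real.exp (-x ^ 2 / 2 + 1) ≤ η / (1 + x) * Real.exp (-x ^ 2 / 2 + 1) := by gcongr
      _ = Real.exp (5 / 2) * η * (Real.exp (-3 / 2) * (Real.exp (-x ^ 2 / 2) / (1 + x))) := by
        rw [Real.exp_add, show (1 : ℝ) = 5 / 2 + -3 / 2 by norm_num, Real.exp_add]; ring
      _ ≤ _ := by gcongr
  linarith

theorem gaussianReal_Ici (x : ℝ) :
    (gaussianReal 0 1).real (Set.Ici x) = gaussTail x / √(2 * Real.pi) := by
  rw [measureReal_def, gaussianReal_apply_eq_integral _ one_ne_zero, ENNReal.toReal_ofReal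
    (setIntegral_nonneg measurableSet_Ici fun y _ => gaussianPDFReal_nonneg _ _ _),
    integral_Ici_eq_integral_Ioi]
  unfold gaussTail gaussianPDFReal
  rw [integral_const_mul]
  simp only [NNReal.coe_one, mul_one, sub_zero]
  ring

/-! ### Student's t distribution: normalisation, tails, comparison with the Gaussian -/

/-- Log-convexity of Γ at the midpoint of x and x+1. Taken at x = ν/2 and x = (ν-1)/2, it sandwiches
the square of the Student constant between (1-1/ν)/(2π) and 1/(2π). -/
theorem Gamma_add_half_sq_le {x : ℝ} (hx : 0 < x) :
    Real.Gamma (x + 1 / 2) ^ 2 ≤ x * Real.Gamma x ^ 2 := by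
  have h := Real.Gamma_mul_add_mul_le_rpow_Gamma_mul_rpow_Gamma hx (by linarith : 0 < x + 1)
    (by norm_num : (0 : ℝ) < 1 / 2) (by norm_num : (0 : ℝ) < 1 / 2) (by norm_num)
  rw [show 1 / 2 * x + 1 / 2 * (x + 1) = x + 1 / 2 by ring, ← Real.sqrt_eq_rpow,
    ← Real.sqrt_eq_rpow, ← Real.sqrt_mul (Real.Gamma_pos_of_pos hx).le,
    Real.Gamma_add_one hx.ne'] at h
  have h0 := Real.Gamma_pos_of_pos hx
  calc _ ≤ (√(Real.Gamma x * (x * Real.Gamma x))) ^ 2 := by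
        gcongr
    _ = _ := by rw [Real.sq_sqrt (by positivity)]; ring

/-- Normalising constant of the density of Student's `t` distribution. -/
def studentConst (ν : ℝ) : ℝ :=
  Real.Gamma ((ν + 1) / 2) / (√(ν * Real.pi) * Real.Gamma (ν / 2))

theorem studentConst_pos {ν : ℝ} (hν : 0 < ν) : 0 < studentConst ν := by
  have h1 := Real.Gamma_pos_of_pos (show 0 < (ν + 1) / 2 by positivity)
  have h2 := Real.Gamma_pos_of_pos (show 0 < ν / 2 by positivity)
  unfold studentConst
  have := Real.pi_pos
  positivity

theorem studentConst_sq_le {ν : ℝ} (hν : 0 < ν) : studentConst ν ^ 2 ≤ 1 / (2 * Real.pi) := by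
  have h := Gamma_add_half_sq_le (half_pos hν)
  rw [show ν / 2 + 1 / 2 = (ν + 1) / 2 by ring] at h
  have h2 := Real.Gamma_pos_of_pos (show 0 < ν / 2 by positivity)
  have := Real.pi_pos
  unfold studentConst
  rw [div_pow, mul_pow, Real.sq_sqrt (by positivity), div_le_div_iff₀ (by positivity) (by positivity)]
  nlinarith

theorem le_studentConst_sq {ν : ℝ} (hν : 1 < ν) :
    (ν - 1) / ν * (1 / (2 * Real.pi)) ≤ studentConst ν ^ 2 := by
  have h := Gamma_add_half_sq_le (show 0 < (ν - 1) / 2 by linarith)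
  rw [show (ν - 1) / 2 + 1 / 2 = ν / 2 by ring] at h
  have h2 := Real.Gamma_pos_of_pos (show 0 < ν / 2 by linarith)
  have h4 := Real.Gamma_pos_of_pos (show 0 < (ν - 1) / 2 by linarith)
  have h3 : Real.Gamma ((ν + 1) / 2) = (ν - 1) / 2 * Real.Gamma ((ν - 1) / 2) := by
    rw [← Real.Gamma_add_one (by linarith : (ν - 1) / 2 ≠ 0)]; congr 1; ring
  have := Real.pi_pos
  unfold studentConst
  rw [h3, div_pow, mul_pow (√_), Real.sq_sqrt (by positivity), div_mul_div_comm,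
    div_le_div_iff₀ (by positivity) (by positivity)]
  have h5 : (ν - 1) * Real.Gamma (ν / 2) ^ 2 ≤
      (ν - 1) * ((ν - 1) / 2 * Real.Gamma ((ν - 1) / 2) ^ 2) := by
    gcongr
  have h6 := mul_le_mul_of_nonneg_right h5 (show 0 ≤ ν * Real.pi by positivity)
  linarith

/-- The Student kernel is a Gamma mixture of Gaussian kernels: Euler's integral represents the
power, Tonelli exchanges the integrals, and the inner integral is Gaussian. -/
theorem lintegral_one_add_sq_div_rpow {ν a : ℝ} (hν : 0 < ν) (ha : 1 / 2 < a) :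
    ∫⁻ x : ℝ, ENNReal.ofReal ((1 + x ^ 2 / ν) ^ (-a)) =
      ENNReal.ofReal (√(ν * Real.pi) * Real.Gamma (a - 1 / 2) / Real.Gamma a) := by
  have hΓ := Real.Gamma_pos_of_pos (show 0 < a by linarith)
  have key : ∀ x : ℝ, ENNReal.ofReal ((1 + x ^ 2 / ν) ^ (-a)) =
      ∫⁻ s in Set.Ioi (0 : ℝ), ENNReal.ofReal
        (s ^ (a - 1) * Real.exp (-((1 + x ^ 2 / ν) * s)) / Real.Gamma a) := by
    intro x
    have hr : 0 < 1 + x ^ 2 / ν := by positivity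
    have h := Real.integral_rpow_mul_exp_neg_mul_Ioi (show 0 < a by linarith) hr
    have hi : IntegrableOn (fun s : ℝ => s ^ (a - 1) * Real.exp (-((1 + x ^ 2 / ν) * s)))
        (Set.Ioi 0) := by
      -- A nonintegrable function has Bochner integral 0, whereas `h` gives a positive value.
      by_contra hcon
      have := integral_undef hcon
      rw [h] at this
      have : 0 < (1 / (1 + x ^ 2 / ν)) ^ a * Real.Gamma a := by positivity
      linarith
    rw [← ofReal_integral_eq_lintegral_ofReal (hi.div_const _), integral_div, h]
    · congr 1
      rw [Real.rpow_neg hr.le, one_div, Real.inv_rpow hr.le]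
      field_simp
    · filter_upwards [ae_restrict_mem measurableSet_Ioi] with s hs
      have : 0 < s := hs
      simp only [Pi.zero_apply]; positivity
  simp_rw [key]
  rw [lintegral_lintegral_swap (by fun_prop)]
  have inner : ∀ s ∈ Set.Ioi (0 : ℝ), ∫⁻ x : ℝ, ENNReal.ofReal
      (s ^ (a - 1) * Real.exp (-((1 + x ^ 2 / ν) * s)) / Real.Gamma a) =
      ENNReal.ofReal (√(ν * Real.pi) / Real.Gamma a * (Real.exp (-s) * s ^ ((a - 1 / 2) - 1))) := by
    intro s hs
    have hs : 0 < s := hs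
    have hb : 0 < s / ν := by positivity
    have e : ∀ x : ℝ, s ^ (a - 1) * Real.exp (-((1 + x ^ 2 / ν) * s)) / Real.Gamma a =
        (s ^ (a - 1) * Real.exp (-s) / Real.Gamma a) * Real.exp (-(s / ν) * x ^ 2) := by
      intro x
      rw [show -((1 + x ^ 2 / ν) * s) = -s + -(s / ν) * x ^ 2 by ring, Real.exp_add]; ring
    simp_rw [e]
    rw [← ofReal_integral_eq_lintegral_ofReal ((integrable_exp_neg_mul_sq hb).const_mul _)
      (ae_of_all _ fun x => by simp only [Pi.zero_apply]; positivity), integral_const_mul, integral_gaussian]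
    congr 1
    rw [show Real.pi / (s / ν) = (ν * Real.pi) / s by field_simp, Real.sqrt_div (by positivity),
      show a - 1 / 2 - 1 = (a - 1) - 1 / 2 by ring, Real.rpow_sub hs (a - 1), ← Real.sqrt_eq_rpow]
    field_simp
  rw [setLIntegral_congr_fun measurableSet_Ioi inner, ← ofReal_integral_eq_lintegral_ofReal]
  · rw [integral_const_mul, ← Real.Gamma_eq_integral (by linarith)]
    congr 1; ring
  · exact (Real.GammaIntegral_convergent (by linarith)).const_mul _
  · filter_upwards [ae_restrict_mem measurableSet_Ioi] with s hs
    have : 0 < s := hs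
    simp only [Pi.zero_apply]; positivity

theorem studentTPDF_eq (ν x : ℝ) :
    studentTPDF ν x = studentConst ν * (1 + x ^ 2 / ν) ^ (-((ν + 1) / 2)) := rfl

theorem studentTPDF_pos {ν : ℝ} (hν : 0 < ν) (x : ℝ) : 0 < studentTPDF ν x := by
  rw [studentTPDF_eq]
  have := studentConst_pos hν
  positivity

theorem measurable_studentTPDF (ν : ℝ) : Measurable (studentTPDF ν) := by
  unfold studentTPDF; fun_prop

theorem lintegral_studentTPDF {ν : ℝ} (hν : 0 < ν) :
    ∫⁻ x, ENNReal.ofReal (studentTPDF ν x) = 1 := by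
  have hc := studentConst_pos hν
  have h1 := Real.Gamma_pos_of_pos (show 0 < (ν + 1) / 2 by positivity)
  have h2 := Real.Gamma_pos_of_pos (show 0 < ν / 2 by positivity)
  have := Real.pi_pos
  simp_rw [studentTPDF_eq, ENNReal.ofReal_mul hc.le]
  rw [lintegral_const_mul _ (by fun_prop), lintegral_one_add_sq_div_rpow hν (by linarith),
    ← ENNReal.ofReal_mul hc.le, show (ν + 1) / 2 - 1 / 2 = ν / 2 by ring, studentConst,
    ← ENNReal.ofReal_one]
  congr 1
  field_simp

theorem integrable_studentTPDF {ν : ℝ} (hν : 0 < ν) : Integrable (studentTPDF ν) := by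
  refine ⟨(measurable_studentTPDF ν).aestronglyMeasurable, ?_⟩
  rw [hasFiniteIntegral_iff_ofReal (ae_of_all _ fun x => (studentTPDF_pos hν x).le),
    lintegral_studentTPDF hν]
  exact ENNReal.one_lt_top

theorem integral_studentTPDF {ν : ℝ} (hν : 0 < ν) : ∫ x, studentTPDF ν x = 1 := by
  rw [integral_eq_lintegral_of_nonneg_ae (ae_of_all _ fun x => (studentTPDF_pos hν x).le)
    (measurable_studentTPDF ν).aestronglyMeasurable, lintegral_studentTPDF hν, ENNReal.toReal_one]

/-- Two-sided tail of Student's `t` distribution. -/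
def studentTail (ν t : ℝ) : ℝ := 2 - 2 * studentTCDF ν t

theorem studentTail_eq {ν : ℝ} (hν : 0 < ν) (t : ℝ) :
    studentTail ν t = 2 * ∫ x in Set.Ioi t, studentTPDF ν x := by
  have := integral_add_compl (measurableSet_Iic (a := t)) (integrable_studentTPDF hν)
  rw [integral_studentTPDF hν, Set.compl_Iic] at this
  unfold studentTail studentTCDF
  linarith

theorem studentTail_zero {ν : ℝ} (hν : 0 < ν) : studentTail ν 0 = 1 := by
  have h1 := integral_add_compl (measurableSet_Iic (a := (0 : ℝ))) (integrable_studentTPDF hν)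
  have h2 := integral_comp_neg_Iic (0 : ℝ) (studentTPDF ν)
  rw [neg_zero] at h2
  have h3 : ∀ x, studentTPDF ν (-x) = studentTPDF ν x := fun x => by simp [studentTPDF]
  simp_rw [h3] at h2
  rw [integral_studentTPDF hν, Set.compl_Iic, ← h2] at h1
  unfold studentTail studentTCDF
  linarith

theorem studentTail_strictAnti {ν : ℝ} (hν : 0 < ν) : StrictAnti (studentTail ν) := by
  intro s t hst
  rw [studentTail_eq hν, studentTail_eq hν]
  have hi := integrable_studentTPDF hν
  have : ∫ x in Set.Ioi s, studentTPDF ν x =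
      (∫ x in Set.Ioc s t, studentTPDF ν x) + ∫ x in Set.Ioi t, studentTPDF ν x := by
    rw [← setIntegral_union (Set.Ioc_disjoint_Ioi le_rfl) measurableSet_Ioi
      hi.integrableOn hi.integrableOn, Set.Ioc_union_Ioi_eq_Ioi hst.le]
  have h0 : 0 < ∫ x in Set.Ioc s t, studentTPDF ν x := by
    rw [setIntegral_pos_iff_support_of_nonneg_ae
      (ae_of_all _ fun y => (studentTPDF_pos hν y).le) hi.integrableOn]
    have : Function.support (studentTPDF ν) = Set.univ := by
      ext y; simp [(studentTPDF_pos hν y).ne']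
    rw [this]; simpa using hst
  linarith

theorem continuous_studentTail {ν : ℝ} (hν : 0 < ν) : Continuous (studentTail ν) := by
  have hi := integrable_studentTPDF hν
  have : studentTail ν = fun t => 2 - 2 * (studentTCDF ν 0 + ∫ x in (0 : ℝ)..t, studentTPDF ν x) := by
    ext t
    unfold studentTail studentTCDF
    rw [← intervalIntegral.integral_Iic_sub_Iic hi.integrableOn hi.integrableOn]
    ring
  rw [this]
  have := intervalIntegral.continuous_primitive (fun a b => hi.intervalIntegrable) 0
    (f := studentTPDF ν) (μ := volume)
  fun_prop

/-- The Mills ratio argument: inserting the factor x/t ≥ 1 makes the density explicitly integrable.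
The exponent then comes from log(1+y) ≥ y - y²/2 with y = t²/ν, the prefactor from `studentConst` ≤
1/2 and ν/(ν-1) ≤ 2. -/
theorem studentTail_le {ν t : ℝ} (hν : 2 ≤ ν) (ht : 0 < t) :
    studentTail ν t ≤ 2 / t * Real.exp (-t ^ 2 / 2 + t ^ 2 / (2 * ν) + t ^ 4 / (4 * ν)) := by
  have hν0 : 0 < ν := by linarith
  set F : ℝ → ℝ := fun x => -(ν / (ν - 1)) * (1 + x ^ 2 / ν) ^ (-((ν - 1) / 2)) with hF
  have hderiv : ∀ x, HasDerivAt F (x * (1 + x ^ 2 / ν) ^ (-((ν + 1) / 2))) x := by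
    intro x
    have hb : 0 < 1 + x ^ 2 / ν := by positivity
    have h1 : HasDerivAt (fun x : ℝ => 1 + x ^ 2 / ν) (2 * x / ν) x := by
      simpa using ((hasDerivAt_pow 2 x).div_const ν).const_add 1
    have h2 := (h1.rpow_const (p := -((ν - 1) / 2)) (Or.inl hb.ne')).const_mul (-(ν / (ν - 1)))
    refine h2.congr_deriv ?_
    rw [show -((ν - 1) / 2) - 1 = -((ν + 1) / 2) by ring]
    have : ν - 1 ≠ 0 := by linarith
    field_simp
  have hlim : Tendsto F atTop (𝓝 0) := by
    have h1 : Tendsto (fun x : ℝ => 1 + x ^ 2 / ν) atTop atTop :=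
      tendsto_atTop_add_const_left _ _ ((tendsto_pow_atTop two_ne_zero).atTop_div_const hν0)
    have h2 := (tendsto_rpow_neg_atTop (show 0 < (ν - 1) / 2 by linarith)).comp h1
    simpa [hF, Function.comp_def] using h2.const_mul (-(ν / (ν - 1)))
  have hint := integrableOn_Ioi_deriv_of_nonneg' (a := t) (fun x _ => hderiv x)
    (fun x hx => by
      have : 0 < x := ht.trans hx
      positivity) hlim
  have hval := integral_Ioi_of_hasDerivAt_of_nonneg' (a := t) (fun x _ => hderiv x)
    (fun x hx => by
      have : 0 < x := ht.trans hx
      positivity) hlim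
  have hc := studentConst_pos hν0
  have hc1 : studentConst ν ≤ 1 / 2 := by
    have h1 := studentConst_sq_le hν0
    have h2 : 1 / (2 * Real.pi) ≤ (1 / 2) ^ 2 := by
      have := Real.pi_gt_three
      rw [div_le_iff₀ (by positivity)]; linarith
    exact abs_le_of_sq_le_sq' (h1.trans h2) (by norm_num) |>.2
  have hmain : ∫ x in Set.Ioi t, studentTPDF ν x ≤
      ∫ x in Set.Ioi t, studentConst ν / t * (x * (1 + x ^ 2 / ν) ^ (-((ν + 1) / 2))) := by
    refine setIntegral_mono_on (integrable_studentTPDF hν0).integrableOn (hint.const_mul _)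
      measurableSet_Ioi fun x hx => ?_
    have hx : t < x := hx
    rw [studentTPDF_eq]
    have : 1 ≤ x / t := by rw [le_div_iff₀ ht]; linarith
    have h0 : 0 ≤ studentConst ν * (1 + x ^ 2 / ν) ^ (-((ν + 1) / 2)) := by positivity
    calc _ = studentConst ν * (1 + x ^ 2 / ν) ^ (-((ν + 1) / 2)) * 1 := by ring
      _ ≤ studentConst ν * (1 + x ^ 2 / ν) ^ (-((ν + 1) / 2)) * (x / t) := by gcongr
      _ = _ := by ring
  rw [integral_const_mul, hval, hF] at hmain
  have hexp : (1 + t ^ 2 / ν) ^ (-((ν - 1) / 2)) ≤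
      Real.exp (-t ^ 2 / 2 + t ^ 2 / (2 * ν) + t ^ 4 / (4 * ν)) := by
    have hy : 0 ≤ t ^ 2 / ν := by positivity
    rw [Real.rpow_def_of_pos (by positivity)]
    refine Real.exp_le_exp.2 ?_
    have hl := Real.le_log_one_add_of_nonneg hy
    set y := t ^ 2 / ν with hyd
    have hl2 : y - y ^ 2 / 2 ≤ Real.log (1 + y) := by
      refine le_trans ?_ hl
      rw [le_div_iff₀ (by positivity)]
      nlinarith [pow_nonneg hy 3]
    have h1 : (ν - 1) / 2 * (y - y ^ 2 / 2) ≤ (ν - 1) / 2 * Real.log (1 + y) := by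
      gcongr; linarith
    have e1 : t ^ 2 = ν * y := by rw [hyd]; field_simp
    have e2 : t ^ 4 / (4 * ν) = ν * y ^ 2 / 4 := by
      rw [show t ^ 4 = (t ^ 2) ^ 2 by ring, e1]; field_simp
    have e3 : t ^ 2 / (2 * ν) = y / 2 := by rw [e1]; field_simp
    rw [e2, e3, e1]
    nlinarith [sq_nonneg y]
  have hν1 : ν / (ν - 1) ≤ 2 := by
    rw [div_le_iff₀ (by linarith)]; linarith
  rw [studentTail_eq hν0]
  set E := Real.exp (-t ^ 2 / 2 + t ^ 2 / (2 * ν) + t ^ 4 / (4 * ν))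
  have hp : 0 ≤ (1 + t ^ 2 / ν) ^ (-((ν - 1) / 2)) := by positivity
  have hν2 : 0 ≤ ν / (ν - 1) := div_nonneg hν0.le (by linarith)
  calc _ ≤ 2 * (studentConst ν / t * (0 - -(ν / (ν - 1)) * (1 + t ^ 2 / ν) ^ (-((ν - 1) / 2)))) := by
        gcongr
    _ = 2 * (studentConst ν / t * ((ν / (ν - 1)) * (1 + t ^ 2 / ν) ^ (-((ν - 1) / 2)))) := by ring
    _ ≤ 2 * (1 / 2 / t * (2 * E)) := by gcongr
    _ = _ := by ring

/-- Since 1+y ≤ e^y, the Student kernel dominates the Gaussian kernel of variance ν/(ν+1). Undoing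
the scaling by κ = √((ν+1)/ν) moves the threshold from t to κt, a shift of at most t/(2ν). The
condition (1+t)² ≤ δν makes this small against 1/(1+t), and the normalising constants agree up to
1+O(1/ν). -/
theorem exists_gaussTail_le_studentTail {ε : ℝ} (hε : 0 < ε) :
    ∃ δ > 0, ∀ ν t : ℝ, 2 ≤ ν → 0 ≤ t → (1 + t) ^ 2 ≤ δ * ν →
      2 * (gaussTail t / √(2 * Real.pi)) ≤ (1 + ε) * studentTail ν t := by
  -- a common small parameter for the three multiplicative errors
  obtain ⟨η, hη0, hη1, hη⟩ : ∃ η > 0, η ≤ 1 / 2 ∧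
      (1 + Real.exp (5 / 2) * η) * (1 + η) * (1 / (1 - η)) ≤ 1 + ε := by
    have h : Tendsto (fun η : ℝ => (1 + Real.exp (5 / 2) * η) * (1 + η) * (1 / (1 - η))) (𝓝[>] 0)
        (𝓝 ((1 + Real.exp (5 / 2) * 0) * (1 + 0) * (1 / (1 - 0)))) := by
      refine tendsto_nhdsWithin_of_tendsto_nhds (ContinuousAt.tendsto ?_)
      have : (1 : ℝ) - 0 ≠ 0 := by norm_num
      fun_prop (disch := assumption)
    have h1 := h.eventually (Iio_mem_nhds (show _ < 1 + ε by norm_num [hε]))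
    have h2 : ∀ᶠ η : ℝ in 𝓝[>] 0, η ∈ Set.Ioc (0 : ℝ) (1 / 2) :=
      Ioc_mem_nhdsGT (by norm_num)
    obtain ⟨η, h3, h4⟩ := (h1.and h2).exists
    exact ⟨η, h4.1, h4.2, le_of_lt h3⟩
  refine ⟨η / 2, by positivity, fun ν t hν ht hδ => ?_⟩
  have hν0 : 0 < ν := by linarith
  have hνi : 1 / ν ≤ η := by
    rw [div_le_iff₀ hν0]; nlinarith
  set κ := √((ν + 1) / ν) with hκ
  have hκsq : κ ^ 2 = 1 + 1 / ν := by rw [hκ, Real.sq_sqrt (by positivity)]; field_simp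
  have hκ0 : 0 < κ := by positivity
  have hν' : 0 < 1 / ν := by positivity
  have hκ1 : 1 ≤ κ := by nlinarith
  have hκ2 : κ - 1 ≤ 1 / (2 * ν) := by
    have : 1 / (2 * ν) = 1 / ν / 2 := by ring
    rw [this]; nlinarith
  have hκη : κ ≤ 1 + η := by
    have : 1 / (2 * ν) = 1 / ν / 2 := by ring
    linarith
  -- pointwise comparison of the densities
  have hpt : ∀ x : ℝ, Real.exp (-(κ * x) ^ 2 / 2) ≤ (1 + x ^ 2 / ν) ^ (-((ν + 1) / 2)) := by
    intro x
    have hy : 0 < 1 + x ^ 2 / ν := by positivity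
    rw [Real.rpow_def_of_pos hy]
    refine Real.exp_le_exp.2 ?_
    have hl := Real.log_le_sub_one_of_pos hy
    rw [mul_pow, hκsq]
    have h1 : Real.log (1 + x ^ 2 / ν) * ((ν + 1) / 2) ≤ (x ^ 2 / ν) * ((ν + 1) / 2) := by
      gcongr; linarith
    have h2 : (x ^ 2 / ν) * ((ν + 1) / 2) = (1 + 1 / ν) * x ^ 2 / 2 := by field_simp
    linarith
  have hint : Integrable fun x : ℝ => Real.exp (-(κ * x) ^ 2 / 2) :=
    integrable_exp_neg_sq_div_two.comp_mul_left' hκ0.ne'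
  have hcv : ∫ x in Set.Ioi t, Real.exp (-(κ * x) ^ 2 / 2) = κ⁻¹ * gaussTail (κ * t) := by
    have := integral_comp_mul_left_Ioi (fun y : ℝ => Real.exp (-y ^ 2 / 2)) t hκ0
    simpa [gaussTail] using this
  have hc := studentConst_pos hν0
  have hlow : studentConst ν * (κ⁻¹ * gaussTail (κ * t)) ≤ ∫ x in Set.Ioi t, studentTPDF ν x := by
    rw [← hcv, ← integral_const_mul]
    refine setIntegral_mono (hint.const_mul _).integrableOn
      (integrable_studentTPDF hν0).integrableOn fun x => ?_
    simp only [studentTPDF_eq]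
    gcongr
    exact hpt x
  have hclow : (1 - η) * (1 / √(2 * Real.pi)) ≤ studentConst ν := by
    have h1 := le_studentConst_sq (show 1 < ν by linarith)
    refine abs_le_of_sq_le_sq' (le_trans ?_ h1) hc.le |>.2
    have hpi := Real.pi_pos
    rw [mul_pow, div_pow, Real.sq_sqrt (by positivity), one_pow]
    gcongr
    have : (ν - 1) / ν = 1 - 1 / ν := by field_simp
    rw [this]
    nlinarith
  have hshift : gaussTail t ≤ (1 + Real.exp (5 / 2) * η) * gaussTail (κ * t) := by
    have := gaussTail_sub_le (x := κ * t) (d := κ * t - t) (η := η) (by positivity) (by linarith)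
      (by nlinarith) ?_
    · simpa using this
    · have h1 : κ * t - t ≤ 1 / (2 * ν) * t := by nlinarith
      have h2 : 1 + κ * t ≤ 2 * (1 + t) := by nlinarith
      calc (κ * t - t) * (1 + κ * t) ≤ (1 / (2 * ν) * t) * (2 * (1 + t)) := by
            gcongr
        _ = t * (1 + t) / ν := by field_simp
        _ ≤ (1 + t) ^ 2 / ν := by gcongr; nlinarith
        _ ≤ η := by rw [div_le_iff₀ hν0]; nlinarith
  rw [studentTail_eq hν0]
  have hG := gaussTail_pos (κ * t)
  have hη1' : 0 < 1 - η := by linarith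
  have hs : 0 < √(2 * Real.pi) := by have := Real.pi_pos; positivity
  set G := gaussTail (κ * t)
  have hfin : gaussTail t / √(2 * Real.pi) ≤ (1 + ε) * (studentConst ν * (κ⁻¹ * G)) := by
    calc gaussTail t / √(2 * Real.pi) ≤ (1 + Real.exp (5 / 2) * η) * G / √(2 * Real.pi) := by gcongr
      _ = (1 + Real.exp (5 / 2) * η) * κ * (1 / (1 - η)) *
          (((1 - η) * (1 / √(2 * Real.pi))) * (κ⁻¹ * G)) := by field_simp
      _ ≤ (1 + Real.exp (5 / 2) * η) * (1 + η) * (1 / (1 - η)) * (studentConst ν * (κ⁻¹ * G)) := by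
          gcongr
      _ ≤ _ := by gcongr
  have h0 : 0 ≤ 1 + ε := by linarith
  nlinarith [mul_le_mul_of_nonneg_left hlow h0]

/-! ### Standardised laws with exponential moments -/

/-- A law on `ℝ` with mean `0`, variance `1` and `∫ exp (t |x|) ≤ K`. -/
structure StdLaw (t K : ℝ) (μ : Measure ℝ) : Prop where
  prob : IsProbabilityMeasure μ
  mean : ∫ x, x ∂μ = 0
  sq : ∫ x, x ^ 2 ∂μ = 1
  integrable_exp : Integrable (fun x => Real.exp (t * |x|)) μ
  exp_le : ∫ x, Real.exp (t * |x|) ∂μ ≤ K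

theorem pow_le_factorial_mul_exp {t x : ℝ} (ht : 0 < t) (k : ℕ) :
    |x| ^ k ≤ k.factorial / t ^ k * Real.exp (t * |x|) := by
  have h := Real.pow_div_factorial_le_exp (t * |x|) (by positivity) k
  rw [div_le_iff₀ (by positivity), mul_pow] at h
  rw [div_mul_eq_mul_div, le_div_iff₀ (by positivity)]
  linarith

theorem exp_le_taylor_two (y : ℝ) :
    Real.exp y ≤ 1 + y + y ^ 2 / 2 + |y| ^ 3 * Real.exp |y| := by
  have h := Complex.norm_exp_sub_sum_le_norm_mul_exp (y : ℂ) 3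
  have e : Complex.exp y - ∑ m ∈ Finset.range 3, (y : ℂ) ^ m / m.factorial =
      ((Real.exp y - (1 + y + y ^ 2 / 2) : ℝ) : ℂ) := by
    simp [Finset.sum_range_succ, Nat.factorial]
  rw [e, Complex.norm_real, Complex.norm_real, Real.norm_eq_abs, Real.norm_eq_abs] at h
  linarith [le_abs_self (Real.exp y - (1 + y + y ^ 2 / 2))]

namespace StdLaw

variable {t K : ℝ} {μ : Measure ℝ}

theorem one_le (h : StdLaw t K μ) (ht : 0 ≤ t) : 1 ≤ K := by
  have := h.prob
  refine le_trans ?_ h.exp_le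
  calc (1 : ℝ) = ∫ _, (1 : ℝ) ∂μ := by simp
    _ ≤ _ := integral_mono (by simp) h.integrable_exp fun x => Real.one_le_exp (by positivity)

theorem mono {K' : ℝ} (h : StdLaw t K μ) (hK : K ≤ K') : StdLaw t K' μ :=
  ⟨h.prob, h.mean, h.sq, h.integrable_exp, h.exp_le.trans hK⟩

theorem integrable_of_le (h : StdLaw t K μ) {f : ℝ → ℝ} (hf : Measurable f) {c : ℝ}
    (hle : ∀ x, |f x| ≤ c * Real.exp (t * |x|)) : Integrable f μ :=
  (h.integrable_exp.const_mul c).mono' hf.aestronglyMeasurable (ae_of_all _ hle)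

theorem integrable_pow (h : StdLaw t K μ) (ht : 0 < t) (k : ℕ) :
    Integrable (fun x => x ^ k) μ :=
  h.integrable_of_le (by fun_prop) (c := k.factorial / t ^ k) fun x => by
    rw [abs_pow]; exact pow_le_factorial_mul_exp ht k

theorem integral_pow_le (h : StdLaw t K μ) (ht : 0 < t) (k : ℕ) :
    ∫ x, |x| ^ k ∂μ ≤ k.factorial / t ^ k * K := by
  calc _ ≤ ∫ x, k.factorial / t ^ k * Real.exp (t * |x|) ∂μ :=
        integral_mono ((h.integrable_pow ht k).abs.congr (ae_of_all _ fun x => abs_pow x k))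
          (h.integrable_exp.const_mul _) fun x => pow_le_factorial_mul_exp ht k
    _ ≤ _ := by
        rw [integral_const_mul]
        gcongr
        exact h.exp_le

/-- The tilt uses at most half of the exponential moment; the other half absorbs the cube, with 48 =
3!·2³. -/
theorem cube_mul_exp_le {l x : ℝ} (ht : 0 < t) (hl : l ≤ t / 2) :
    |x| ^ 3 * Real.exp (l * |x|) ≤ 48 / t ^ 3 * Real.exp (t * |x|) := by
  have h1 := pow_le_factorial_mul_exp (x := x) (half_pos ht) 3
  have h2 : Real.exp (l * |x|) ≤ Real.exp (t / 2 * |x|) := by gcongr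
  calc _ ≤ ((3 : ℕ).factorial / (t / 2) ^ 3 * Real.exp (t / 2 * |x|)) * Real.exp (t / 2 * |x|) := by
        gcongr
    _ = 48 / t ^ 3 * (Real.exp (t / 2 * |x|) * Real.exp (t / 2 * |x|)) := by
        norm_num [Nat.factorial]; field_simp; norm_num
    _ = _ := by rw [← Real.exp_add]; ring_nf

theorem integrable_cube_mul_exp (h : StdLaw t K μ) (ht : 0 < t) {l : ℝ} (hl : l ≤ t / 2) :
    Integrable (fun x => |x| ^ 3 * Real.exp (l * |x|)) μ :=
  h.integrable_of_le (by fun_prop) (c := 48 / t ^ 3) fun x => by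
    rw [abs_of_nonneg (by positivity)]; exact cube_mul_exp_le ht hl

theorem integral_cube_mul_exp_le (h : StdLaw t K μ) (ht : 0 < t) {l : ℝ} (hl : l ≤ t / 2) :
    ∫ x, |x| ^ 3 * Real.exp (l * |x|) ∂μ ≤ 48 / t ^ 3 * K := by
  calc _ ≤ ∫ x, 48 / t ^ 3 * Real.exp (t * |x|) ∂μ :=
        integral_mono (h.integrable_cube_mul_exp ht hl)
          (h.integrable_exp.const_mul _) fun x => cube_mul_exp_le ht hl
    _ ≤ _ := by
        rw [integral_const_mul]
        gcongr
        exact h.exp_le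

theorem integrable_exp_mul (h : StdLaw t K μ) {l : ℝ} (hl : |l| ≤ t) :
    Integrable (fun x => Real.exp (l * x)) μ :=
  h.integrable_of_le (by fun_prop) (c := 1) fun x => by
    rw [abs_of_pos (Real.exp_pos _), one_mul]
    refine Real.exp_le_exp.2 ((le_abs_self _).trans ?_)
    rw [abs_mul]; gcongr

theorem integrable_quadratic (h : StdLaw t K μ) (ht : 0 < t) (c₀ c₁ c₂ : ℝ) :
    Integrable (fun x => c₀ + c₁ * x + c₂ * x ^ 2) μ := by
  have := h.prob
  have i1 : Integrable (fun x => x) μ := by simpa using h.integrable_pow ht 1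
  exact ((integrable_const _).add (i1.const_mul _)).add ((h.integrable_pow ht 2).const_mul _)

theorem integral_quadratic (h : StdLaw t K μ) (ht : 0 < t) (c₀ c₁ c₂ : ℝ) :
    ∫ x, (c₀ + c₁ * x + c₂ * x ^ 2) ∂μ = c₀ + c₂ := by
  have := h.prob
  have i1 : Integrable (fun x => x) μ := by simpa using h.integrable_pow ht 1
  have i01 : Integrable (fun x => c₀ + c₁ * x) μ := (integrable_const _).add (i1.const_mul _)
  rw [integral_add i01 ((h.integrable_pow ht 2).const_mul _),
    integral_add (integrable_const _) (i1.const_mul _), integral_const_mul, integral_const_mul,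
    h.mean, h.sq]
  simp

/-- Mean 0 and variance 1 fix the Taylor expansion up to second order, and 1+u ≤ e^u puts the bound
in a form that multiplies well over independent summands. -/
theorem integral_exp_mul_le (h : StdLaw t K μ) (ht : 0 < t) {l : ℝ} (hl : |l| ≤ t / 2) :
    ∫ x, Real.exp (l * x) ∂μ ≤ Real.exp (l ^ 2 / 2 + 48 / t ^ 3 * K * |l| ^ 3) := by
  have := h.prob
  have i2 := h.integrable_quadratic ht 1 l (l ^ 2 / 2)
  have i3 := h.integrable_cube_mul_exp ht hl
  calc _ ≤ ∫ x, (1 + l * x + l ^ 2 / 2 * x ^ 2 + |l| ^ 3 * (|x| ^ 3 * Real.exp (|l| * |x|))) ∂μ := by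
        refine integral_mono (h.integrable_exp_mul (by linarith)) ?_ fun x => ?_
        · exact i2.add (i3.const_mul _)
        · refine (exp_le_taylor_two (l * x)).trans (le_of_eq ?_)
          rw [abs_mul]; ring
    _ = 1 + l ^ 2 / 2 + |l| ^ 3 * ∫ x, |x| ^ 3 * Real.exp (|l| * |x|) ∂μ := by
        rw [integral_add i2 (i3.const_mul _), h.integral_quadratic ht, integral_const_mul]
    _ ≤ 1 + l ^ 2 / 2 + |l| ^ 3 * (48 / t ^ 3 * K) := by
        gcongr
        exact h.integral_cube_mul_exp_le ht hl
    _ ≤ _ := by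
        refine le_trans (le_of_eq ?_) (Real.add_one_le_exp _)
        ring

end StdLaw


theorem integral_exp_mul_gaussianReal (v : NNReal) (l : ℝ) :
    ∫ x, Real.exp (l * x) ∂(gaussianReal 0 v) = Real.exp (l ^ 2 * v / 2) := by
  have := congrFun (mgf_id_gaussianReal (μ := 0) (v := v)) l
  simp only [mgf, id] at this
  rw [this]; ring_nf

/-- Places the Gaussian in the same class as the summands, so that one constant controls both sides
of a replacement. -/
theorem stdLaw_gaussianReal (t : ℝ) :
    StdLaw t (2 * Real.exp (t ^ 2 / 2)) (gaussianReal 0 1) := by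
  have hle : ∀ x : ℝ, Real.exp (t * |x|) ≤ Real.exp (t * x) + Real.exp (-t * x) := by
    intro x
    rcases abs_cases x with ⟨h, -⟩ | ⟨h, -⟩ <;> rw [h]
    · linarith [Real.exp_pos (-t * x)]
    · rw [show t * -x = -t * x by ring]
      linarith [Real.exp_pos (t * x)]
  have hi : Integrable (fun x => Real.exp (t * x) + Real.exp (-t * x)) (gaussianReal 0 1) :=
    (integrable_exp_mul_gaussianReal t).add (integrable_exp_mul_gaussianReal (-t))
  have hi' : Integrable (fun x : ℝ => Real.exp (t * |x|)) (gaussianReal 0 1) :=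
    hi.mono' (by fun_prop) (ae_of_all _ fun x => by
      rw [Real.norm_eq_abs, abs_of_pos (Real.exp_pos _)]; exact hle x)
  refine ⟨inferInstance, integral_id_gaussianReal, ?_, hi', ?_⟩
  · have := variance_fun_id_gaussianReal (μ := 0) (v := 1)
    rw [variance_of_integral_eq_zero (by fun_prop) integral_id_gaussianReal] at this
    simpa using this
  · refine (integral_mono hi' hi hle).trans (le_of_eq ?_)
    rw [integral_add (integrable_exp_mul_gaussianReal t) (integrable_exp_mul_gaussianReal (-t)),
      integral_exp_mul_gaussianReal, integral_exp_mul_gaussianReal]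
    simp; ring

/-! ### Lindeberg replacement and the moderate deviation bound -/

/-- A bounded function whose second order Taylor remainder is exponentially small to the left. -/
structure TaylorBound (A l : ℝ) (g g₁ g₂ : ℝ → ℝ) : Prop where
  measurable : Measurable g
  abs_le : ∀ x, |g x| ≤ 1
  remainder : ∀ s y, |g (s + y) - (g s + g₁ s * y + g₂ s * (y ^ 2 / 2))| ≤
    A * (|y| ^ 3 * Real.exp (l * (s + |y|)))

namespace TaylorBound

variable {A l : ℝ} {g g₁ g₂ : ℝ → ℝ}

theorem integrable (hg : TaylorBound A l g g₁ g₂) {α : Type*} [MeasurableSpace α] {μ : Measure α}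
    [IsFiniteMeasure μ] {f : α → ℝ} (hf : Measurable f) : Integrable (fun x => g (f x)) μ :=
  Integrable.of_bound (hg.measurable.comp hf).aestronglyMeasurable 1
    (ae_of_all _ fun x => hg.abs_le (f x))

/-- The second-order Taylor polynomial has the same integral under all standardised laws, so two
such laws can differ only through the cubic remainder. -/
theorem abs_integral_sub_le (hg : TaylorBound A l g g₁ g₂) (hA : 0 ≤ A) {t K : ℝ}
    {μ : Measure ℝ} (h : StdLaw t K μ) (ht : 0 < t) {a : ℝ} (hl : l * |a| ≤ t / 2) (s : ℝ) :
    |(∫ x, g (s + a * x) ∂μ) - (g s + g₂ s * (a ^ 2 / 2))| ≤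
      A * Real.exp (l * s) * (|a| ^ 3 * (48 / t ^ 3 * K)) := by
  have := h.prob
  have i3 := h.integrable_cube_mul_exp ht hl
  have ig : Integrable (fun x => g (s + a * x)) μ := hg.integrable (by fun_prop)
  have ip := h.integrable_quadratic ht (g s) (g₁ s * a) (g₂ s * (a ^ 2 / 2))
  rw [← h.integral_quadratic ht (g s) (g₁ s * a) (g₂ s * (a ^ 2 / 2)), ← integral_sub ig ip]
  calc _ ≤ ∫ x, |g (s + a * x) - (g s + g₁ s * a * x + g₂ s * (a ^ 2 / 2) * x ^ 2)| ∂μ :=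
        abs_integral_le_integral_abs
    _ ≤ ∫ x, A * Real.exp (l * s) * |a| ^ 3 * (|x| ^ 3 * Real.exp (l * |a| * |x|)) ∂μ := by
        refine integral_mono (ig.sub ip).abs (i3.const_mul _) fun x => ?_
        have := hg.remainder s (a * x)
        refine le_trans (le_of_eq ?_) (this.trans (le_of_eq ?_))
        · ring_nf
        · rw [abs_mul, mul_add, Real.exp_add]; ring_nf
    _ ≤ _ := by
        rw [integral_const_mul, mul_assoc (A * _)]
        gcongr
        exact h.integral_cube_mul_exp_le ht hl

end TaylorBound

theorem integral_gaussianReal_sq (a : ℝ) {f : ℝ → ℝ} (hf : Measurable f) :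
    ∫ x, f x ∂(gaussianReal 0 (a ^ 2).toNNReal) = ∫ x, f (a * x) ∂(gaussianReal 0 1) := by
  have h := gaussianReal_map_const_mul (μ := 0) (v := 1) a
  rw [mul_zero, mul_one] at h
  have e : (a ^ 2).toNNReal = NNReal.mk (a ^ 2) (sq_nonneg a) :=
    Real.toNNReal_of_nonneg (sq_nonneg a)
  rw [e, ← h, integral_map (by fun_prop) hf.aestronglyMeasurable]

/-- The summands are exchanged for Gaussians one at a time. The remainder carries the weight
exp(l·position), so the summands not being exchanged enter through their exponential moments at l;
for a test function living beyond x this supplies the Gaussian decay that an unweighted Lindeberg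
bound loses. The estimate is uniform in the starting point s, which lets the induction hypothesis be
used at s + a_b x and then integrated in x. The newest summand is exchanged last, when the others
are already Gaussian. -/
theorem lindeberg_replacement {A l t K : ℝ} {g g₁ g₂ : ℝ → ℝ} (hg : TaylorBound A l g g₁ g₂)
    (hA : 0 ≤ A) (hl0 : 0 ≤ l) (ht : 0 < t) (hG : StdLaw t K (gaussianReal 0 1))
    {Ω ι : Type*} [MeasurableSpace Ω] {P : Measure Ω} [IsProbabilityMeasure P]
    {Z : ι → Ω → ℝ} (hZ : ∀ q, Measurable (Z q)) (hind : iIndepFun Z P)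
    (hlaw : ∀ q, StdLaw t K (P.map (Z q))) (a : ι → ℝ) (ha : ∀ q, l * |a q| ≤ t / 2)
    (F : Finset ι) (s : ℝ) :
    |(∫ ω, g (s + ∑ q ∈ F, a q * Z q ω) ∂P) -
        ∫ x, g (s + x) ∂(gaussianReal 0 (∑ q ∈ F, (a q ^ 2).toNNReal))| ≤
      A * Real.exp (l * s) * (2 * (48 / t ^ 3 * K) * (∑ q ∈ F, |a q| ^ 3) *
        Real.exp (l ^ 2 * (∑ q ∈ F, a q ^ 2) / 2 +
          48 / t ^ 3 * K * (l ^ 3 * ∑ q ∈ F, |a q| ^ 3))) := by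
  classical
  have hK : 0 ≤ K := zero_le_one.trans (hG.one_le ht.le)
  set C := 48 / t ^ 3 * K with hC
  have hC0 : 0 ≤ C := by positivity
  induction F using Finset.induction_on generalizing s with
  | empty => simp
  | insert b F hb ih =>
    simp only [Finset.sum_insert hb]
    set σ : ℝ := ∑ q ∈ F, |a q| ^ 3 with hσ
    set V : ℝ := ∑ q ∈ F, a q ^ 2 with hV
    set W : NNReal := ∑ q ∈ F, (a q ^ 2).toNNReal with hW
    have hWV : (W : ℝ) = V := by
      rw [hW, hV, NNReal.coe_sum]
      exact Finset.sum_congr rfl fun q _ => Real.coe_toNNReal _ (sq_nonneg _)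
    have hσ0 : 0 ≤ σ := Finset.sum_nonneg fun q _ => by positivity
    set μ := P.map (Z b) with hμ
    set S : Ω → ℝ := fun ω => ∑ q ∈ F, a q * Z q ω with hS
    have hSm : Measurable S := by fun_prop
    have := (hlaw b).prob
    have hPS : IsProbabilityMeasure (P.map S) := Measure.isProbabilityMeasure_map hSm.aemeasurable
    -- disintegration of the law of the sum
    have hindep : IndepFun (Z b) S P := by
      have h1 : iIndepFun (fun q ω => a q * Z q ω) P :=
        hind.comp (fun q x => a q * x) (fun q => by fun_prop)
      have h2 : IndepFun (fun ω => (fun (i : ({b} : Finset ι)) => Z i ω))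
        (fun ω => (fun (i : F) => Z i ω)) P :=
        hind.indepFun_finset {b} F (by simpa using hb) hZ
      have hφ : Measurable (fun f : ({b} : Finset ι) → ℝ => f ⟨b, by simp⟩) :=
        measurable_pi_apply _
      have hψ : Measurable (fun f : F → ℝ => ∑ q : F, a q * f q) := by fun_prop
      have h3 := h2.comp hφ hψ
      have e : S = (fun f : F → ℝ => ∑ q : F, a q * f q) ∘ fun ω (i : F) => Z i ω := by
        ext ω
        simp only [hS, Function.comp]
        exact (Finset.sum_coe_sort F (fun q => a q * Z q ω)).symm
      rw [e]
      exact h3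
    have hprod := (indepFun_iff_map_prod_eq_prod_map_map (hZ b).aemeasurable hSm.aemeasurable).1
      hindep
    have e1 : ∫ ω, g (s + (a b * Z b ω + S ω)) ∂P =
        ∫ x, ∫ ω, g (s + a b * x + S ω) ∂P ∂μ := by
      have : ∫ ω, g (s + (a b * Z b ω + S ω)) ∂P =
          ∫ p : ℝ × ℝ, g (s + (a b * p.1 + p.2)) ∂(P.map fun ω => (Z b ω, S ω)) := by
        rw [integral_map (by fun_prop)]
        exact (hg.measurable.comp (by fun_prop)).aestronglyMeasurable
      rw [this, hprod, integral_prod _ (hg.integrable (by fun_prop))]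
      refine integral_congr_ae (ae_of_all _ fun x => ?_)
      simp only
      rw [integral_map hSm.aemeasurable (f := fun y => g (s + (a b * x + y)))
        (hg.measurable.comp (by fun_prop)).aestronglyMeasurable]
      simp only [add_assoc]
    have e2 : ∫ x, g (s + x) ∂(gaussianReal 0 ((a b ^ 2).toNNReal + W)) =
        ∫ y, ∫ x, g (s + y + a b * x) ∂(gaussianReal 0 1) ∂(gaussianReal 0 W) := by
      have := gaussianReal_conv_gaussianReal (m₁ := 0) (m₂ := 0) (v₁ := W)
        (v₂ := (a b ^ 2).toNNReal)
      rw [add_zero, add_comm W] at this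
      rw [← this, integral_conv (hg.integrable (by fun_prop))]
      refine integral_congr_ae (ae_of_all _ fun y => ?_)
      simp only
      rw [integral_gaussianReal_sq (a b) (f := fun x => g (s + (y + x)))
        (hg.measurable.comp (by fun_prop))]
      simp only [add_assoc]
    have e3 : ∫ x, ∫ y, g (s + a b * x + y) ∂(gaussianReal 0 W) ∂μ =
        ∫ y, ∫ x, g (s + y + a b * x) ∂μ ∂(gaussianReal 0 W) := by
      rw [integral_integral_swap (hg.integrable (by fun_prop))]
      simp only [add_right_comm]
    have i1 : Integrable (fun x => ∫ ω, g (s + a b * x + S ω) ∂P) μ :=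
      (hg.integrable (f := fun p : ℝ × Ω => s + a b * p.1 + S p.2) (μ := μ.prod P)
        (by fun_prop)).integral_prod_left
    have i2 : Integrable (fun x => ∫ y, g (s + a b * x + y) ∂(gaussianReal 0 W)) μ :=
      (hg.integrable (f := fun p : ℝ × ℝ => s + a b * p.1 + p.2) (μ := μ.prod (gaussianReal 0 W))
        (by fun_prop)).integral_prod_left
    have i3 : Integrable (fun y => ∫ x, g (s + y + a b * x) ∂μ) (gaussianReal 0 W) :=
      (hg.integrable (f := fun p : ℝ × ℝ => s + p.1 + a b * p.2) (μ := (gaussianReal 0 W).prod μ)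
        (by fun_prop)).integral_prod_left
    have i4 : Integrable (fun y => ∫ x, g (s + y + a b * x) ∂(gaussianReal 0 1))
        (gaussianReal 0 W) :=
      (hg.integrable (f := fun p : ℝ × ℝ => s + p.1 + a b * p.2)
        (μ := (gaussianReal 0 W).prod (gaussianReal 0 1)) (by fun_prop)).integral_prod_left
    have hlab : |l * a b| ≤ t / 2 := by rw [abs_mul, abs_of_nonneg hl0]; exact ha b
    -- replacing the other summands
    have b1 : |(∫ x, ∫ ω, g (s + a b * x + S ω) ∂P ∂μ) -
        ∫ x, ∫ y, g (s + a b * x + y) ∂(gaussianReal 0 W) ∂μ| ≤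
        A * Real.exp (l * s) * (2 * C * σ * Real.exp (l ^ 2 * V / 2 + C * (l ^ 3 * σ))) *
          Real.exp ((l * a b) ^ 2 / 2 + C * |l * a b| ^ 3) := by
      rw [← integral_sub i1 i2]
      calc _ ≤ ∫ x, |(∫ ω, g (s + a b * x + S ω) ∂P) -
            ∫ y, g (s + a b * x + y) ∂(gaussianReal 0 W)| ∂μ := abs_integral_le_integral_abs
        _ ≤ ∫ x, A * Real.exp (l * s) * (2 * C * σ * Real.exp (l ^ 2 * V / 2 + C * (l ^ 3 * σ))) *
            Real.exp (l * a b * x) ∂μ := by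
            refine integral_mono (i1.sub i2).abs
              (((hlaw b).integrable_exp_mul (by linarith)).const_mul _) fun x => ?_
            refine (ih (s + a b * x)).trans (le_of_eq ?_)
            rw [mul_add l, Real.exp_add (l * s)]; ring_nf
        _ ≤ _ := by
            rw [integral_const_mul]
            gcongr
            exact (hlaw b).integral_exp_mul_le ht hlab
    -- replacing the new summand
    have b2 : |(∫ y, ∫ x, g (s + y + a b * x) ∂μ ∂(gaussianReal 0 W)) -
        ∫ y, ∫ x, g (s + y + a b * x) ∂(gaussianReal 0 1) ∂(gaussianReal 0 W)| ≤
        A * Real.exp (l * s) * (2 * (|a b| ^ 3 * C)) * Real.exp (l ^ 2 * V / 2) := by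
      rw [← integral_sub i3 i4]
      calc _ ≤ ∫ y, |(∫ x, g (s + y + a b * x) ∂μ) -
            ∫ x, g (s + y + a b * x) ∂(gaussianReal 0 1)| ∂(gaussianReal 0 W) :=
            abs_integral_le_integral_abs
        _ ≤ ∫ y, A * Real.exp (l * s) * (2 * (|a b| ^ 3 * C)) * Real.exp (l * y)
              ∂(gaussianReal 0 W) := by
            refine integral_mono (i3.sub i4).abs
              ((integrable_exp_mul_gaussianReal l).const_mul _) fun y => ?_
            have h1 := hg.abs_integral_sub_le hA (hlaw b) ht (ha b) (s + y)
            have h2 := hg.abs_integral_sub_le hA hG ht (ha b) (s + y)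
            rw [mul_add l, Real.exp_add] at h1 h2
            simp only
            rw [abs_le] at h1 h2 ⊢
            constructor <;> linarith [h1.1, h1.2, h2.1, h2.2]
        _ = _ := by
            rw [integral_const_mul, integral_exp_mul_gaussianReal, hWV]
    rw [e1, e2]
    rw [e3] at b1
    refine (abs_sub_le _ _ _).trans ((add_le_add b1 b2).trans ?_)
    have hexp : Real.exp (l ^ 2 * V / 2 + C * (l ^ 3 * σ)) *
        Real.exp ((l * a b) ^ 2 / 2 + C * |l * a b| ^ 3) =
        Real.exp (l ^ 2 * (a b ^ 2 + V) / 2 + C * (l ^ 3 * (|a b| ^ 3 + σ))) := by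
      rw [← Real.exp_add, abs_mul, abs_of_nonneg hl0]; ring_nf
    have hexp2 : Real.exp (l ^ 2 * V / 2) ≤
        Real.exp (l ^ 2 * (a b ^ 2 + V) / 2 + C * (l ^ 3 * (|a b| ^ 3 + σ))) := by
      refine Real.exp_le_exp.2 ?_
      have : 0 ≤ C * (l ^ 3 * (|a b| ^ 3 + σ)) := by positivity
      nlinarith [sq_nonneg (l * a b)]
    calc _ = A * Real.exp (l * s) * (2 * C * σ * (Real.exp (l ^ 2 * V / 2 + C * (l ^ 3 * σ)) *
          Real.exp ((l * a b) ^ 2 / 2 + C * |l * a b| ^ 3))) +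
          A * Real.exp (l * s) * (2 * (|a b| ^ 3 * C)) * Real.exp (l ^ 2 * V / 2) := by ring
      _ ≤ A * Real.exp (l * s) * (2 * C * σ *
          Real.exp (l ^ 2 * (a b ^ 2 + V) / 2 + C * (l ^ 3 * (|a b| ^ 3 + σ)))) +
          A * Real.exp (l * s) * (2 * (|a b| ^ 3 * C)) *
          Real.exp (l ^ 2 * (a b ^ 2 + V) / 2 + C * (l ^ 3 * (|a b| ^ 3 + σ))) := by
          rw [hexp]; gcongr
      _ = _ := by ring

/-- The derivative is continuous on the compact interval [0, 1], and off it the function is locally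
constant. -/
theorem exists_abs_iteratedDeriv_smoothTransition_le :
    ∃ B : ℝ, 0 ≤ B ∧ ∀ x, |iteratedDeriv 3 Real.smoothTransition x| ≤ B := by
  have hc : Continuous (iteratedDeriv 3 Real.smoothTransition) :=
    (Real.smoothTransition.contDiff (n := 3)).continuous_iteratedDeriv 3 le_rfl
  obtain ⟨B, hB⟩ := (isCompact_Icc (a := (0 : ℝ)) (b := 1)).exists_bound_of_continuousOn
    hc.continuousOn
  refine ⟨max B 0, le_max_right _ _, fun x => ?_⟩
  by_cases hx : x ∈ Set.Icc (0 : ℝ) 1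
  · exact (hB x hx).trans (le_max_left _ _)
  · have : ∃ c : ℝ, Real.smoothTransition =ᶠ[𝓝 x] fun _ => c := by
      simp only [Set.mem_Icc, not_and_or, not_le] at hx
      rcases hx with hx | hx
      · exact ⟨0, by
          filter_upwards [Iio_mem_nhds hx] with y hy
          exact Real.smoothTransition.zero_of_nonpos (le_of_lt hy)⟩
      · exact ⟨1, by
          filter_upwards [Ioi_mem_nhds hx] with y hy
          exact Real.smoothTransition.one_of_one_le (le_of_lt hy)⟩
    obtain ⟨c, hc⟩ := this
    rw [hc.iteratedDeriv_eq 3]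
    simp [iteratedDeriv_const]

theorem abs_sub_taylor_two_le {f : ℝ → ℝ} (hf : ContDiff ℝ 3 f) {B : ℝ}
    (hB : ∀ x, |iteratedDeriv 3 f x| ≤ B) (s y : ℝ) :
    |f (s + y) - (f s + iteratedDeriv 1 f s * y + iteratedDeriv 2 f s * (y ^ 2 / 2))| ≤
      B * |y| ^ 3 := by
  rcases eq_or_ne y 0 with rfl | hy
  · simp
  have hne : s ≠ s + y := by simpa [eq_comm] using hy
  obtain ⟨z, -, hz⟩ := taylor_mean_remainder_lagrange_iteratedDeriv (n := 2) hne
    (hf.contDiffOn (s := Set.uIcc s (s + y)))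
  have hu : UniqueDiffOn ℝ (Set.uIcc s (s + y)) := uniqueDiffOn_uIcc hne
  have hd : ∀ k : ℕ, k ≤ 3 → iteratedDerivWithin k f (Set.uIcc s (s + y)) s = iteratedDeriv k f s :=
    fun k hk => iteratedDerivWithin_eq_iteratedDeriv hu
      ((hf.of_le (by exact_mod_cast hk)).contDiffAt) Set.left_mem_uIcc
  rw [taylor_within_apply] at hz
  simp only [Finset.sum_range_succ, Finset.range_zero, Finset.sum_empty, hd 0 (by norm_num),
    hd 1 (by norm_num), hd 2 (by norm_num), iteratedDeriv_zero] at hz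
  have e : f (s + y) - (f s + iteratedDeriv 1 f s * y + iteratedDeriv 2 f s * (y ^ 2 / 2)) =
      iteratedDeriv 3 f z * y ^ 3 / 6 := by
    norm_num [Nat.factorial] at hz
    rw [← hz, iteratedDeriv_one]; ring
  rw [e, abs_div, abs_mul, abs_pow]
  have h1 := hB z
  have h2 : |iteratedDeriv 3 f z| * |y| ^ 3 ≤ B * |y| ^ 3 := by gcongr
  have h3 : 0 ≤ |iteratedDeriv 3 f z| * |y| ^ 3 := by positivity
  rw [abs_of_pos (by norm_num : (0 : ℝ) < 6)]
  linarith

/-- A smooth step from `0` (left of `x`) to `1` (right of `x + 1 / c`). -/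
def smoothStep (c x s : ℝ) : ℝ := Real.smoothTransition (c * (s - x))

/-- If s and s+y both lie left of x, the step and its Taylor polynomial vanish. Otherwise s+|y| ≥ x,
so exp(l(s+|y|-x)) ≥ 1 can be inserted into the ordinary cubic bound. -/
theorem exists_taylorBound_smoothStep :
    ∃ B : ℝ, 0 ≤ B ∧ ∀ c x l : ℝ, 0 < c → 0 ≤ l → ∃ g₁ g₂ : ℝ → ℝ,
      TaylorBound (B * c ^ 3 * Real.exp (-l * x)) l (smoothStep c x) g₁ g₂ := by
  obtain ⟨B, hB0, hB⟩ := exists_abs_iteratedDeriv_smoothTransition_le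
  refine ⟨B, hB0, fun c x l hc hl =>
    ⟨fun s => c * iteratedDeriv 1 Real.smoothTransition (c * (s - x)),
      fun s => c ^ 2 * iteratedDeriv 2 Real.smoothTransition (c * (s - x)), ?_, ?_, ?_⟩⟩
  · exact Real.smoothTransition.continuous.measurable.comp (by fun_prop)
  · intro s
    rw [abs_le]
    exact ⟨by linarith [Real.smoothTransition.nonneg (c * (s - x)), smoothStep.eq_1 c x s],
      Real.smoothTransition.le_one _⟩
  · intro s y
    unfold smoothStep
    by_cases h : s < x ∧ s + y < x
    · have hs : c * (s - x) < 0 := mul_neg_of_pos_of_neg hc (by linarith)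
      have hsy : c * (s + y - x) < 0 := mul_neg_of_pos_of_neg hc (by linarith)
      have he : Real.smoothTransition =ᶠ[𝓝 (c * (s - x))] fun _ => 0 := by
        filter_upwards [Iio_mem_nhds hs] with y hy
        exact Real.smoothTransition.zero_of_nonpos (le_of_lt hy)
      rw [he.iteratedDeriv_eq 1, he.iteratedDeriv_eq 2,
        Real.smoothTransition.zero_of_nonpos hs.le, Real.smoothTransition.zero_of_nonpos hsy.le]
      simp only [iteratedDeriv_const]
      simp
      positivity
    · have h0 : 0 ≤ s + |y| - x := by
        rw [not_and_or, not_lt, not_lt] at h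
        rcases h with h | h
        · linarith [abs_nonneg y]
        · linarith [le_abs_self y]
      have ht := abs_sub_taylor_two_le (Real.smoothTransition.contDiff (n := 3)) hB
        (c * (s - x)) (c * y)
      have h1 : 1 ≤ Real.exp (l * (s + |y| - x)) := Real.one_le_exp (by positivity)
      calc _ ≤ B * |c * y| ^ 3 := by
            refine le_trans (le_of_eq ?_) ht
            rw [show c * (s + y - x) = c * (s - x) + c * y by ring]
            ring_nf
        _ ≤ B * |c * y| ^ 3 * Real.exp (l * (s + |y| - x)) :=
            le_mul_of_one_le_right (by positivity) h1
        _ = _ := by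
            rw [abs_mul, abs_of_pos hc,
              show l * (s + |y| - x) = -l * x + l * (s + |y|) by ring, Real.exp_add]
            ring

/-- Upper half of a Cramér type moderate deviation theorem for weighted sums. -/
theorem exists_prob_sum_ge_le.{u, w} {t K ε : ℝ} (ht : 0 < t) (hε : 0 < ε) :
    ∃ δ > 0, ∀ {Ω : Type u} {ι : Type w} [MeasurableSpace Ω] [Fintype ι] {P : Measure Ω}
      [IsProbabilityMeasure P] {Z : ι → Ω → ℝ}, (∀ q, Measurable (Z q)) → iIndepFun Z P →
      (∀ q, StdLaw t K (P.map (Z q))) → ∀ (a : ι → ℝ) (b x : ℝ), (∀ q, |a q| ≤ b) →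
      ∑ q, a q ^ 2 = 1 → 0 ≤ x → (1 + x) ^ 4 * b ≤ δ →
      P.real {ω | x ≤ ∑ q, a q * Z q ω} ≤ (1 + ε) * (gaussTail x / √(2 * Real.pi)) := by
  obtain ⟨B, hB0, hB⟩ := exists_taylorBound_smoothStep
  set K' := max K (2 * Real.exp (t ^ 2 / 2)) with hK'
  have hK'0 : 0 < K' := lt_max_of_lt_right (by positivity)
  have hG : StdLaw t K' (gaussianReal 0 1) := (stdLaw_gaussianReal t).mono (le_max_right _ _)
  set C := 48 / t ^ 3 * K' with hC
  have hC0 : 0 < C := by positivity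
  obtain ⟨η, hη0, hη1, hη⟩ : ∃ η > 0, η ≤ 1 ∧ Real.exp (5 / 2) * η ≤ ε / 2 := by
    refine ⟨min 1 (ε / 2 / Real.exp (5 / 2)), by positivity, min_le_left _ _, ?_⟩
    rw [mul_comm, ← le_div_iff₀ (by positivity)]
    exact min_le_right _ _
  have hpi : 0 < √(2 * Real.pi) := by have := Real.pi_pos; positivity
  set D := 2 * B * C * Real.exp 2 / η ^ 3 * Real.exp (3 / 2) * √(2 * Real.pi) with hD
  have hD0 : 0 ≤ D := by positivity
  -- The three bounds keep, in order, the tilts x|a_q| below t/2, the cubic correction in the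
  -- exponent below 1, and the relative replacement error below ε/2.
  refine ⟨min (t / 2) (min (1 / C) (ε / 2 / (D + 1))), by positivity, ?_⟩
  intro Ω ι _ _ P _ Z hZ hind hlaw a b x hab ha hx hδ
  have hδ1 := hδ.trans (min_le_left _ _)
  have hδ2 := hδ.trans ((min_le_right _ _).trans (min_le_left _ _))
  have hδ3 := hδ.trans ((min_le_right _ _).trans (min_le_right _ _))
  have hb : 0 ≤ b := by
    rcases isEmpty_or_nonempty ι with h | ⟨⟨q⟩⟩
    · simp at ha
    · exact (abs_nonneg _).trans (hab q)
  have hxb : x * b ≤ (1 + x) ^ 4 * b := by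
    gcongr
    nlinarith [pow_nonneg hx 2, pow_nonneg hx 3, pow_nonneg hx 4]
  have hx3b : x ^ 3 * b ≤ (1 + x) ^ 4 * b := by
    gcongr
    nlinarith [pow_nonneg hx 2, pow_nonneg hx 3, pow_nonneg hx 4]
  -- The step has width η/(1+x), so that smoothing costs only a factor 1+O(η) in the Gaussian tail.
  set c := (1 + x) / η with hc
  have hc0 : 0 < c := by positivity
  set x₀ := x - η / (1 + x) with hx₀
  -- The tilt is l = x, the minimiser of l²/2 - lx.
  obtain ⟨g₁, g₂, hg⟩ := hB c x₀ x hc0 hx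
  have hlin := lindeberg_replacement hg (by positivity) hx ht hG hZ hind
    (fun q => (hlaw q).mono (le_max_left _ _)) a
    (fun q => le_trans (by gcongr; exact hab q) (hxb.trans hδ1)) Finset.univ 0
  have hsum1 : ∑ q, (a q ^ 2).toNNReal = 1 := by
    rw [← Real.toNNReal_sum_of_nonneg (fun q _ => sq_nonneg _), ha, Real.toNNReal_one]
  set σ := ∑ q, |a q| ^ 3 with hσ
  have hσb : σ ≤ b := by
    calc σ ≤ ∑ q, b * a q ^ 2 := by
          refine Finset.sum_le_sum fun q _ => ?_
          rw [← sq_abs (a q), pow_succ']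
          gcongr
          exact hab q
      _ = b := by rw [← Finset.mul_sum, ha, mul_one]
  have hσ0 : 0 ≤ σ := Finset.sum_nonneg fun q _ => by positivity
  rw [hsum1, ha] at hlin
  simp only [zero_add, mul_zero, Real.exp_zero, mul_one] at hlin
  have hup : P.real {ω | x ≤ ∑ q, a q * Z q ω} ≤ ∫ ω, smoothStep c x₀ (∑ q, a q * Z q ω) ∂P := by
    have hm : MeasurableSet {ω | x ≤ ∑ q, a q * Z q ω} :=
      measurableSet_le measurable_const (by fun_prop)
    rw [← integral_indicator_one hm]
    refine integral_mono ((integrable_const 1).indicator hm) (hg.integrable (by fun_prop))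
      fun ω => ?_
    by_cases hω : x ≤ ∑ q, a q * Z q ω
    swap
    · rw [Set.indicator_of_notMem (by exact hω)]
      exact Real.smoothTransition.nonneg _
    rw [Set.indicator_of_mem (by exact hω)]
    refine (Real.smoothTransition.one_of_one_le ?_).ge
    calc (1 : ℝ) = c * (x - x₀) := by rw [hc, hx₀]; field_simp; ring
      _ ≤ _ := by gcongr
  have hgauss : ∫ y, smoothStep c x₀ y ∂(gaussianReal 0 1) ≤
      (1 + ε / 2) * (gaussTail x / √(2 * Real.pi)) := by
    have h1 : ∫ y, smoothStep c x₀ y ∂(gaussianReal 0 1) ≤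
        (gaussianReal 0 1).real (Set.Ici x₀) := by
      rw [← integral_indicator_one measurableSet_Ici]
      refine integral_mono (hg.integrable measurable_id)
        ((integrable_const 1).indicator measurableSet_Ici) fun y => ?_
      by_cases hy : y ∈ Set.Ici x₀
      · rw [Set.indicator_of_mem hy]; exact Real.smoothTransition.le_one _
      · rw [Set.indicator_of_notMem hy]
        refine (Real.smoothTransition.zero_of_nonpos ?_).le
        simp only [Set.mem_Ici, not_le] at hy
        exact (mul_neg_of_pos_of_neg hc0 (by linarith)).le
    rw [gaussianReal_Ici] at h1
    refine h1.trans ?_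
    rw [mul_div_assoc']
    gcongr
    refine (gaussTail_sub_le hx hη1 (by positivity) ?_).trans ?_
    · rw [div_mul_cancel₀ _ (by positivity)]
    · have := gaussTail_pos x
      gcongr
  -- The exponents add up to -x²/2 + O(1). Three factors 1+x come from c³ and a fourth from
  -- comparing exp(-x²/2) with the Gaussian tail, whence the condition on (1+x)⁴ b.
  have herr : B * c ^ 3 * Real.exp (-x * x₀) * (2 * C * σ * Real.exp (x ^ 2 / 2 + C * (x ^ 3 * σ)))
      ≤ ε / 2 * (gaussTail x / √(2 * Real.pi)) := by
    have h1 : Real.exp (-x * x₀) * Real.exp (x ^ 2 / 2 + C * (x ^ 3 * σ)) ≤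
        Real.exp 2 * Real.exp (-x ^ 2 / 2) := by
      rw [← Real.exp_add, ← Real.exp_add]
      refine Real.exp_le_exp.2 ?_
      have e1 : x * (η / (1 + x)) ≤ 1 := by
        rw [mul_div_assoc', div_le_one (by positivity)]
        nlinarith
      have e2 : C * (x ^ 3 * σ) ≤ 1 := by
        calc C * (x ^ 3 * σ) ≤ C * (x ^ 3 * b) := by gcongr
          _ ≤ C * (1 / C) := by gcongr; exact hx3b.trans hδ2
          _ = 1 := by field_simp
      rw [hx₀]
      nlinarith
    have h2 := le_gaussTail hx
    have hg0 := gaussTail_pos x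
    have h3 : Real.exp (-x ^ 2 / 2) ≤ Real.exp (3 / 2) * (1 + x) * gaussTail x := by
      have : Real.exp (-x ^ 2 / 2) = Real.exp (3 / 2) * (1 + x) *
          (Real.exp (-3 / 2) * (Real.exp (-x ^ 2 / 2) / (1 + x))) := by
        rw [show (-3 / 2 : ℝ) = -(3 / 2) by ring, Real.exp_neg]
        field_simp
      rw [this]; gcongr
    calc _ = 2 * B * C * c ^ 3 * σ *
          (Real.exp (-x * x₀) * Real.exp (x ^ 2 / 2 + C * (x ^ 3 * σ))) := by ring
      _ ≤ 2 * B * C * c ^ 3 * b * (Real.exp 2 * (Real.exp (3 / 2) * (1 + x) * gaussTail x)) := by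
          refine mul_le_mul ?_ (h1.trans ?_) (by positivity) (by positivity) <;> gcongr
      _ = D * ((1 + x) ^ 4 * b) * (gaussTail x / √(2 * Real.pi)) := by
          rw [hD, hc]; field_simp
      _ ≤ (D + 1) * (ε / 2 / (D + 1)) * (gaussTail x / √(2 * Real.pi)) := by
          gcongr
          linarith
      _ = _ := by field_simp
  have := (abs_le.1 hlin).2
  linarith

/-! ### Exponential and second moment inequalities -/

/-- Invert 1+y+y²/2 ≤ e^y using (1+y+y²/2)(1-y+y²/2) = 1+y⁴/4 ≥ 1. -/
theorem exp_neg_le_quadratic {y : ℝ} (hy : 0 ≤ y) : Real.exp (-y) ≤ 1 - y + y ^ 2 / 2 := by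
  have h := Real.quadratic_le_exp_of_nonneg hy
  rw [Real.exp_neg, inv_le_comm₀ (Real.exp_pos _) (by nlinarith [sq_nonneg (y - 1)])]
  refine le_trans ?_ h
  rw [inv_le_iff_one_le_mul₀ (by nlinarith [sq_nonneg (y - 1)])]
  nlinarith [pow_nonneg hy 4]

/-- Chernoff's bound with a negative parameter: for nonnegative variables the lower tail needs only
second moments, here the fourth moments of the observations, so no exponential moment of the squares
is required. -/
theorem sq_mean_lower_tail {t K : ℝ} (ht : 0 < t) {Ω ι : Type*} [MeasurableSpace Ω] [Fintype ι]
    {P : Measure Ω} [IsProbabilityMeasure P] {Z : ι → Ω → ℝ} (hZ : ∀ q, Measurable (Z q))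
    (hind : iIndepFun Z P) (hlaw : ∀ q, StdLaw t K (P.map (Z q))) {ε : ℝ} (hε : 0 ≤ ε) (hK : 0 < K) :
    P.real {ω | ∑ q, Z q ω ^ 2 ≤ Fintype.card ι * (1 - ε)} ≤
      Real.exp (-(Fintype.card ι * ε ^ 2 * t ^ 4 / (48 * K))) := by
  set M := 24 / t ^ 4 * K with hM
  have hM0 : 0 < M := by positivity
  -- Minimiser of -lε + l²M/2.
  set l := ε / M with hl
  have hl0 : 0 ≤ l := by positivity
  have hmgf : ∀ q, mgf (fun ω => Z q ω ^ 2) P (-l) ≤ Real.exp (-l + l ^ 2 * M / 2) := by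
    intro q
    have := (hlaw q).prob
    have e : mgf (fun ω => Z q ω ^ 2) P (-l) = ∫ x, Real.exp (-l * x ^ 2) ∂(P.map (Z q)) := by
      rw [integral_map (hZ q).aemeasurable (by fun_prop)]; rfl
    have i2 := (hlaw q).integrable_quadratic ht 1 0 (-l)
    have i4 := ((hlaw q).integrable_pow ht 4).const_mul (l ^ 2 / 2)
    rw [e]
    calc _ ≤ ∫ x, (1 + 0 * x + (-l) * x ^ 2 + l ^ 2 / 2 * x ^ 4) ∂(P.map (Z q)) := by
          refine integral_mono_of_nonneg (ae_of_all _ fun x => (Real.exp_pos _).le)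
            (i2.add i4) (ae_of_all _ fun x => ?_)
          have := exp_neg_le_quadratic (y := l * x ^ 2) (by positivity)
          simp only
          rw [neg_mul]
          refine this.trans (le_of_eq ?_)
          ring
      _ = 1 + -l + l ^ 2 / 2 * ∫ x, x ^ 4 ∂(P.map (Z q)) := by
          rw [integral_add i2 i4, (hlaw q).integral_quadratic ht, integral_const_mul]
      _ ≤ 1 + -l + l ^ 2 / 2 * M := by
          have := (hlaw q).integral_pow_le ht 4
          have e : ∀ x : ℝ, |x| ^ 4 = x ^ 4 := fun x => by
            rw [← abs_pow, abs_of_nonneg (by positivity)]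
          simp_rw [e] at this
          norm_num [Nat.factorial] at this
          gcongr
      _ ≤ _ := by
          refine le_trans (le_of_eq ?_) (Real.add_one_le_exp _)
          ring
  have hind2 : iIndepFun (fun q ω => Z q ω ^ 2) P :=
    hind.comp (fun _ x => x ^ 2) (fun _ => by fun_prop)
  have hsum : mgf (∑ q, fun ω => Z q ω ^ 2) P (-l) ≤
      Real.exp (-l + l ^ 2 * M / 2) ^ Fintype.card ι := by
    rw [hind2.mgf_sum (fun q => by fun_prop)]
    calc _ ≤ ∏ _q : ι, Real.exp (-l + l ^ 2 * M / 2) :=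
          Finset.prod_le_prod (fun q _ => mgf_nonneg) fun q _ => hmgf q
      _ = _ := by simp
  have hint : Integrable (fun ω => Real.exp (-l * (∑ q, fun ω => Z q ω ^ 2) ω)) P := by
    refine Integrable.of_bound (C := 1) (by simp only [Finset.sum_apply]; fun_prop)
      (ae_of_all _ fun ω => ?_)
    rw [Real.norm_eq_abs, abs_of_pos (Real.exp_pos _), Finset.sum_apply]
    refine Real.exp_le_one_iff.2 ?_
    have : 0 ≤ ∑ q, Z q ω ^ 2 := Finset.sum_nonneg fun q _ => sq_nonneg _
    nlinarith
  have h := measure_le_le_exp_mul_mgf (Fintype.card ι * (1 - ε)) (neg_nonpos.2 hl0) hint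
  simp only [Finset.sum_apply, neg_neg] at h
  refine h.trans ?_
  calc _ ≤ Real.exp (l * (Fintype.card ι * (1 - ε))) *
        Real.exp (-l + l ^ 2 * M / 2) ^ Fintype.card ι := by gcongr
    _ = _ := by
        rw [← Real.exp_nat_mul, ← Real.exp_add, hl, hM]
        congr 1
        field_simp
        ring

/-- Chernoff's bound with parameter equal to the deviation r. By `hrK` the cubic correction is at
most r²/4, so the exponent per summand is -r² + 3r²/4. -/
theorem abs_sum_tail {t K : ℝ} (ht : 0 < t) {Ω ι : Type*} [MeasurableSpace Ω] [Fintype ι]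
    {P : Measure Ω} [IsProbabilityMeasure P] {Z : ι → Ω → ℝ} (hZ : ∀ q, Measurable (Z q))
    (hind : iIndepFun Z P) (hlaw : ∀ q, StdLaw t K (P.map (Z q))) {r : ℝ} (hr : 0 ≤ r)
    (hrt : r ≤ t / 2) (hrK : 48 / t ^ 3 * K * r ≤ 1 / 4) :
    P.real {ω | Fintype.card ι * r ≤ |∑ q, Z q ω|} ≤
      2 * Real.exp (-(Fintype.card ι * r ^ 2 / 4)) := by
  have one : ∀ s : ℝ, |s| = 1 → P.real {ω | Fintype.card ι * r ≤ ∑ q, s * Z q ω} ≤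
      Real.exp (-(Fintype.card ι * r ^ 2 / 4)) := by
    intro s hs
    have hsr : |s * r| ≤ t / 2 := by rwa [abs_mul, hs, one_mul, abs_of_nonneg hr]
    have hmgf : ∀ q, mgf (fun ω => s * Z q ω) P r ≤ Real.exp (r ^ 2 * (3 / 4)) := by
      intro q
      have e : mgf (fun ω => s * Z q ω) P r = ∫ x, Real.exp (s * r * x) ∂(P.map (Z q)) := by
        rw [integral_map (hZ q).aemeasurable (by fun_prop)]
        simp only [mgf]
        congr 1; ext ω; ring_nf
      rw [e]
      refine ((hlaw q).integral_exp_mul_le ht hsr).trans (Real.exp_le_exp.2 ?_)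
      have hs2 : s ^ 2 = 1 := by rw [← sq_abs, hs]; norm_num
      rw [mul_pow, hs2, abs_mul, hs, abs_of_nonneg hr]
      nlinarith [sq_nonneg r]
    have hind2 : iIndepFun (fun q ω => s * Z q ω) P :=
      hind.comp (fun _ x => s * x) (fun _ => by fun_prop)
    have hsum : mgf (∑ q, fun ω => s * Z q ω) P r ≤
        Real.exp (r ^ 2 * (3 / 4)) ^ Fintype.card ι := by
      rw [hind2.mgf_sum (fun q => by fun_prop)]
      calc _ ≤ ∏ _q : ι, Real.exp (r ^ 2 * (3 / 4)) :=
            Finset.prod_le_prod (fun q _ => mgf_nonneg) fun q _ => hmgf q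
        _ = _ := by simp
    have hint1 : ∀ q, Integrable (fun ω => Real.exp (r * (s * Z q ω))) P := by
      intro q
      have := ((hlaw q).integrable_exp_mul (l := s * r) (by linarith)).comp_measurable (hZ q)
      refine this.congr (ae_of_all _ fun ω => ?_)
      simp only [Function.comp]; ring_nf
    have hint : Integrable (fun ω => Real.exp (r * (∑ q, fun ω => s * Z q ω) ω)) P :=
      hind2.integrable_exp_mul_sum (fun q => by fun_prop) (fun q _ => hint1 q)
    have h := measure_ge_le_exp_mul_mgf (Fintype.card ι * r) hr hint
    simp only [Finset.sum_apply] at h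
    refine h.trans ?_
    calc _ ≤ Real.exp (-r * (Fintype.card ι * r)) *
          Real.exp (r ^ 2 * (3 / 4)) ^ Fintype.card ι := by gcongr
      _ = _ := by
          rw [← Real.exp_nat_mul, ← Real.exp_add]
          congr 1
          ring
  have h1 := one 1 (by simp)
  have h2 := one (-1) (by simp)
  have hsub : {ω | Fintype.card ι * r ≤ |∑ q, Z q ω|} ⊆
      {ω | Fintype.card ι * r ≤ ∑ q, 1 * Z q ω} ∪ {ω | Fintype.card ι * r ≤ ∑ q, -1 * Z q ω} := by
    intro ω hω
    simp only [Set.mem_ofPred_eq, Set.mem_union, ← Finset.mul_sum] at hω ⊢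
    rcases abs_cases (∑ q, Z q ω) with ⟨h, -⟩ | ⟨h, -⟩ <;> rw [h] at hω
    · left; linarith
    · right; linarith
  calc _ ≤ _ := (measureReal_mono hsub).trans (measureReal_union_le _ _)
    _ ≤ _ := by linarith

theorem chebyshev_weighted_sum {Ω ι : Type*} [MeasurableSpace Ω] [Fintype ι]
    {P : Measure Ω} [IsProbabilityMeasure P] {W : ι → Ω → ℝ} (hW : ∀ q, MemLp (W q) 2 P)
    (hind : iIndepFun W P) {μ M : ℝ} (hμ : ∀ q, ∫ ω, W q ω ∂P = μ)
    (hM : ∀ q, variance (W q) P ≤ M) (a : ι → ℝ) {r : ℝ} (hr : 0 < r) :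
    P.real {ω | r ≤ |∑ q, a q * W q ω - μ * ∑ q, a q|} ≤ M * (∑ q, a q ^ 2) / r ^ 2 := by
  have hm : ∀ q, MemLp (fun ω => a q * W q ω) 2 P := fun q => (hW q).const_mul _
  have hmean : ∫ ω, (∑ q, fun ω => a q * W q ω) ω ∂P = μ * ∑ q, a q := by
    simp only [Finset.sum_apply]
    rw [integral_finsetSum _ fun q _ => (hm q).integrable one_le_two]
    simp_rw [integral_const_mul, hμ, Finset.mul_sum, mul_comm]
  have hind2 : iIndepFun (fun q ω => a q * W q ω) P :=
    hind.comp (fun q x => a q * x) (fun _ => by fun_prop)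
  have hvar : variance (∑ q, fun ω => a q * W q ω) P ≤ M * ∑ q, a q ^ 2 := by
    rw [IndepFun.variance_sum (fun q _ => hm q) (fun i _ j _ hij => hind2.indepFun hij),
      Finset.mul_sum]
    refine Finset.sum_le_sum fun q _ => ?_
    rw [variance_const_mul, mul_comm]
    gcongr
    exact hM q
  have h := meas_ge_le_variance_div_sq (memLp_finsetSum' Finset.univ fun q _ => hm q) hr
  rw [hmean] at h
  simp only [Finset.sum_apply] at h
  rw [measureReal_def]
  refine ENNReal.toReal_le_of_le_ofReal ?_ (h.trans (ENNReal.ofReal_le_ofReal (by gcongr)))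
  have : 0 ≤ M * ∑ q, a q ^ 2 := (variance_nonneg _ _).trans hvar
  positivity

namespace StdLaw

variable {t K : ℝ} {Ω : Type*} [MeasurableSpace Ω] {P : Measure Ω} {Z : Ω → ℝ}

theorem memLp_comp_pow (h : StdLaw t K (P.map Z)) (hZ : Measurable Z) (ht : 0 < t) (k : ℕ) :
    MemLp (fun ω => Z ω ^ k) 2 P := by
  rw [memLp_two_iff_integrable_sq (by fun_prop)]
  have := (h.integrable_pow ht (k * 2)).comp_measurable hZ
  refine this.congr (ae_of_all _ fun ω => ?_)
  simp [Function.comp, pow_mul]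

theorem integral_comp (h : StdLaw t K (P.map Z)) (hZ : Measurable Z) : ∫ ω, Z ω ∂P = 0 := by
  rw [← h.mean, integral_map hZ.aemeasurable (by fun_prop)]

theorem integral_comp_sq (h : StdLaw t K (P.map Z)) (hZ : Measurable Z) :
    ∫ ω, Z ω ^ 2 ∂P = 1 := by
  rw [← h.sq, integral_map hZ.aemeasurable (by fun_prop)]

theorem variance_comp (h : StdLaw t K (P.map Z)) (hZ : Measurable Z) : variance Z P = 1 := by
  rw [variance_of_integral_eq_zero hZ.aemeasurable (h.integral_comp hZ), h.integral_comp_sq hZ]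

theorem variance_comp_sq_le [IsProbabilityMeasure P] (h : StdLaw t K (P.map Z)) (hZ : Measurable Z)
    (ht : 0 < t) : variance (fun ω => Z ω ^ 2) P ≤ 24 / t ^ 4 * K := by
  refine (variance_le_expectation_sq (by fun_prop)).trans ?_
  have := h.integral_pow_le ht 4
  rw [integral_map hZ.aemeasurable (by fun_prop)] at this
  norm_num [Nat.factorial] at this
  refine le_trans (le_of_eq ?_) this
  congr 1; ext ω
  simp only [Pi.pow_apply]
  rw [← abs_pow, abs_of_nonneg (by positivity)]; ring

end StdLaw

/-! ### The t statistic as a normalised sum over a relative variance -/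

namespace TwoSample

variable {m : ℕ} {Ω : Type*} [MeasurableSpace Ω] {P : Measure Ω} (D : TwoSample m P)

/-- Standard deviation of the difference of the sample means. -/
def diffSD (i : Fin m) : ℝ := √(D.var 0 i / D.n 0 + D.var 1 i / D.n 1)

/-- Standardised observations. -/
def stdObs (i : Fin m) (q : Σ j : Fin 2, Fin (D.n j)) (ω : Ω) : ℝ :=
  (D.X q.1 q.2 ω i - D.mean q.1 i) / √(D.var q.1 i)

/-- Weights of the standardised observations in the standardised difference of means. -/
def weight (i : Fin m) (q : Σ j : Fin 2, Fin (D.n j)) : ℝ :=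
  (if q.1 = 0 then 1 else -1) * (√(D.var q.1 i) / (D.n q.1 * D.diffSD i))

/-- Centred difference of the sample means divided by its standard deviation. -/
def stdDiff (i : Fin m) (ω : Ω) : ℝ := ∑ q, D.weight i q * D.stdObs i q ω

/-- Empirical variance relative to the population variance. -/
def relVar (j : Fin 2) (i : Fin m) (ω : Ω) : ℝ := D.sumSqDev j i ω / (D.n j * D.var j i)

/-- Measurable observations, positive variances, a uniform exponential moment of the standardised
coordinates and sample sizes at least `N`. -/
structure Regular (t K N : ℝ) : Prop where
  measurable : ∀ j k, Measurable (D.X j k)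
  var_pos : ∀ j i, 0 < D.var j i
  exp_le : ∀ j i, ∫⁻ x, ENNReal.ofReal
    (Real.exp (t * |x i - D.mean j i| / √(D.var j i))) ∂(D.pop j) ≤ ENNReal.ofReal K
  le_size : ∀ j, N ≤ D.n j

namespace Regular

variable {D} {t K N : ℝ}

theorem size_pos (h : D.Regular t K N) (hN : 1 ≤ N) (j : Fin 2) : 0 < (D.n j : ℝ) := by
  linarith [h.le_size j]

theorem diffSD_sq (h : D.Regular t K N) (i : Fin m) :
    D.diffSD i ^ 2 = D.var 0 i / D.n 0 + D.var 1 i / D.n 1 := by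
  have h0 := h.var_pos 0 i
  have h1 := h.var_pos 1 i
  exact Real.sq_sqrt (by positivity)

theorem diffSD_pos (h : D.Regular t K N) (hN : 1 ≤ N) (i : Fin m) : 0 < D.diffSD i := by
  have h0 := h.var_pos 0 i
  have h1 := h.var_pos 1 i
  have h2 := h.size_pos hN 0
  have h3 := h.size_pos hN 1
  exact Real.sqrt_pos.2 (by positivity)

theorem measurable_apply (h : D.Regular t K N) (j : Fin 2) (k : Fin (D.n j)) (i : Fin m) :
    Measurable fun ω => D.X j k ω i := (measurable_pi_apply i).comp (h.measurable j k)

theorem measurable_stdObs (h : D.Regular t K N) (i : Fin m) (q) : Measurable (D.stdObs i q) :=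
  ((h.measurable_apply q.1 q.2 i).sub_const _).div_const _

theorem measurable_tStat (h : D.Regular t K N) (v : VarianceCase) (i : Fin m) :
    Measurable (D.tStat v i) := by
  have hx := h.measurable_apply
  have h1 : ∀ j, Measurable (D.sampleMean j i) := fun j => by
    unfold sampleMean; exact (Finset.measurable_sum _ fun k _ => hx j k i).const_mul _
  have h2 : ∀ j, Measurable (D.sumSqDev j i) := fun j => by
    unfold sumSqDev
    exact Finset.measurable_sum _ fun k _ => ((hx j k i).sub (h1 j)).pow_const 2
  cases v
  · unfold tStat pooledVar
    have := h1 0; have := h1 1; have := h2 0; have := h2 1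
    fun_prop
  · unfold tStat sampleVar
    have := h1 0; have := h1 1; have := h2 0; have := h2 1
    fun_prop

theorem iIndepFun_stdObs (D : TwoSample m P) (i : Fin m) : iIndepFun (D.stdObs i) P :=
  D.indep.comp (fun q x => (x i - D.mean q.1 i) / √(D.var q.1 i)) (fun q => by fun_prop)

theorem stdLaw_stdObs (h : D.Regular t K N) (hK : 0 < K) (i : Fin m) (q) :
    StdLaw t K (P.map (D.stdObs i q)) := by
  have := D.isProbabilityMeasure_pop q.1
  set f : (Fin m → ℝ) → ℝ := fun x => (x i - D.mean q.1 i) / √(D.var q.1 i) with hf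
  have hfm : Measurable f := by fun_prop
  have hv := h.var_pos q.1 i
  have hmap : P.map (D.stdObs i q) = (D.pop q.1).map f := by
    rw [← (D.hasLaw q.1 q.2).map_eq, Measure.map_map hfm (h.measurable q.1 q.2)]
    rfl
  have hL2 := D.memLp_two q.1 i
  have e : ∀ x, Real.exp (t * |x i - D.mean q.1 i| / √(D.var q.1 i)) =
      Real.exp (t * |f x|) := by
    intro x
    rw [hf, abs_div, abs_of_nonneg (Real.sqrt_nonneg _), mul_div_assoc]
  have hle := h.exp_le q.1 i
  simp_rw [e] at hle
  have hint : Integrable (fun x => Real.exp (t * |f x|)) (D.pop q.1) := by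
    refine ⟨by fun_prop, ?_⟩
    rw [hasFiniteIntegral_iff_ofReal (ae_of_all _ fun x => (Real.exp_pos _).le)]
    exact hle.trans_lt ENNReal.ofReal_lt_top
  rw [hmap]
  refine ⟨Measure.isProbabilityMeasure_map hfm.aemeasurable, ?_, ?_, ?_, ?_⟩
  · rw [integral_map hfm.aemeasurable (by fun_prop), hf, integral_div,
      integral_sub (hL2.integrable one_le_two) (integrable_const _)]
    simp [TwoSample.mean]
  · rw [integral_map hfm.aemeasurable (by fun_prop), hf]
    simp_rw [div_pow]
    rw [integral_div, Real.sq_sqrt hv.le]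
    have : D.var q.1 i = ∫ x, (x i - D.mean q.1 i) ^ 2 ∂(D.pop q.1) :=
      variance_eq_integral (measurable_pi_apply i).aemeasurable
    rw [← this, div_self hv.ne']
  · rw [integrable_map_measure (by fun_prop) hfm.aemeasurable]
    exact hint
  · rw [integral_map hfm.aemeasurable (by fun_prop), integral_eq_lintegral_of_nonneg_ae
      (ae_of_all _ fun x => (Real.exp_pos _).le) (by fun_prop)]
    exact ENNReal.toReal_le_of_le_ofReal hK.le hle

theorem weight_sq (h : D.Regular t K N) (i : Fin m) (q) :
    D.weight i q ^ 2 = D.var q.1 i / (D.n q.1 ^ 2 * D.diffSD i ^ 2) := by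
  unfold weight
  have : (if q.1 = 0 then (1 : ℝ) else -1) ^ 2 = 1 := by split_ifs <;> norm_num
  rw [mul_pow, this, one_mul, div_pow, mul_pow, Real.sq_sqrt (h.var_pos _ _).le]

theorem sum_weight_sq (h : D.Regular t K N) (hN : 1 ≤ N) (i : Fin m) :
    ∑ q, D.weight i q ^ 2 = 1 := by
  have h0 := h.size_pos hN 0
  have h1 := h.size_pos hN 1
  have hs := h.diffSD_pos hN i
  simp_rw [h.weight_sq i]
  rw [Fintype.sum_sigma]
  simp only [Finset.sum_const, Finset.card_univ, Fintype.card_fin, Fin.sum_univ_two, nsmul_eq_mul]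
  have e : D.var 0 i / D.n 0 + D.var 1 i / D.n 1 = D.diffSD i ^ 2 := (h.diffSD_sq i).symm
  calc _ = (D.var 0 i / D.n 0 + D.var 1 i / D.n 1) / D.diffSD i ^ 2 := by field_simp
    _ = 1 := by rw [e, div_self (by positivity)]

theorem abs_weight_le (h : D.Regular t K N) (hN : 1 ≤ N) (i : Fin m) (q) :
    |D.weight i q| ≤ 1 / √N := by
  have hs := h.diffSD_pos hN i
  have hn := h.size_pos hN
  have hN0 : 0 < N := by linarith
  refine abs_le_of_sq_le_sq ?_ (by positivity)
  rw [h.weight_sq, div_pow, Real.sq_sqrt (by linarith), one_pow]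
  have h1 : D.var q.1 i / D.n q.1 ≤ D.diffSD i ^ 2 := by
    rw [h.diffSD_sq]
    have p0 := div_pos (h.var_pos 0 i) (hn 0)
    have p1 := div_pos (h.var_pos 1 i) (hn 1)
    rcases q with ⟨j, k⟩
    fin_cases j <;> simp <;> linarith
  have hq := hn q.1
  calc _ = (D.var q.1 i / D.n q.1) / D.diffSD i ^ 2 / D.n q.1 := by field_simp
    _ ≤ 1 / D.n q.1 := by
        gcongr
        rwa [div_le_one (by positivity)]
    _ ≤ 1 / N := by
        gcongr
        exact h.le_size q.1

theorem stdDiff_eq (h : D.Regular t K N) (hN : 1 ≤ N) (i : Fin m) (ω : Ω) :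
    D.stdDiff i ω = ((D.sampleMean 0 i ω - D.sampleMean 1 i ω) - (D.mean 0 i - D.mean 1 i)) /
      D.diffSD i := by
  have hs := h.diffSD_pos hN i
  have hn0 := h.size_pos hN 0
  have hn1 := h.size_pos hN 1
  have e : ∀ q, D.weight i q * D.stdObs i q ω =
      (if q.1 = 0 then 1 else -1) * ((D.X q.1 q.2 ω i - D.mean q.1 i) / (D.n q.1 * D.diffSD i)) := by
    intro q
    have hv := Real.sqrt_pos.2 (h.var_pos q.1 i)
    have hn := h.size_pos hN q.1
    unfold weight stdObs
    field_simp
  unfold stdDiff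
  simp_rw [e]
  rw [Fintype.sum_sigma]
  simp only [Fin.sum_univ_two, if_true, one_ne_zero, if_false, ← Finset.mul_sum,
    ← Finset.sum_div, Finset.sum_sub_distrib, Finset.sum_const, Finset.card_univ,
    Fintype.card_fin, nsmul_eq_mul]
  unfold sampleMean
  field_simp
  ring

theorem relVar_eq (h : D.Regular t K N) (hN : 1 ≤ N) (j : Fin 2) (i : Fin m) (ω : Ω) :
    D.relVar j i ω = (∑ k, D.stdObs i ⟨j, k⟩ ω ^ 2) / D.n j -
      ((∑ k, D.stdObs i ⟨j, k⟩ ω) / D.n j) ^ 2 := by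
  have hv := h.var_pos j i
  have hn := h.size_pos hN j
  have hs := Real.sq_sqrt hv.le
  have e1 : ∑ k, D.stdObs i ⟨j, k⟩ ω = ((∑ k, D.X j k ω i) - D.n j * D.mean j i) / √(D.var j i) := by
    simp only [stdObs, ← Finset.sum_div, Finset.sum_sub_distrib, Finset.sum_const,
      Finset.card_univ, Fintype.card_fin, nsmul_eq_mul]
  have e2 : ∑ k, D.stdObs i ⟨j, k⟩ ω ^ 2 = ((∑ k, D.X j k ω i ^ 2) -
      2 * D.mean j i * (∑ k, D.X j k ω i) + D.n j * D.mean j i ^ 2) / D.var j i := by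
    simp only [stdObs, div_pow, hs, ← Finset.sum_div]
    congr 1
    simp only [sub_sq, Finset.sum_add_distrib, Finset.sum_sub_distrib, Finset.sum_const,
      Finset.card_univ, Fintype.card_fin, nsmul_eq_mul, Finset.mul_sum]
    congr 2
    exact Finset.sum_congr rfl fun k _ => by ring
  have e3 : D.sumSqDev j i ω = (∑ k, D.X j k ω i ^ 2) - (∑ k, D.X j k ω i) ^ 2 / D.n j := by
    unfold sumSqDev sampleMean
    set A := ∑ k, D.X j k ω i with hA
    simp only [sub_sq, Finset.sum_add_distrib, Finset.sum_sub_distrib, Finset.sum_const,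
      Finset.card_univ, Fintype.card_fin, nsmul_eq_mul]
    have : ∑ k, 2 * D.X j k ω i * (1 / (D.n j : ℝ) * A) = 2 * A ^ 2 / D.n j := by
      rw [← Finset.sum_mul, ← Finset.mul_sum, ← hA]; ring
    rw [this]
    field_simp
    ring
  unfold relVar
  rw [e1, e2, e3, div_div, div_pow, div_pow, hs]
  field_simp
  ring

/-- The `t` statistic is the standardised difference of means, shifted by the standardised effect
and divided by the square root of the relative error of the variance estimator. -/
theorem exists_tStat_eq (h : D.Regular t K N) (hN : 2 ≤ N) (v : VarianceCase) (i : Fin m)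
    (hv : v = VarianceCase.equal → D.var 0 i = D.var 1 i) (ω : Ω) :
    ∃ R : ℝ, D.tStat v i ω =
        (D.stdDiff i ω + (D.mean 0 i - D.mean 1 i) / D.diffSD i) / √R ∧
      (∀ r, 0 ≤ r → (∀ j, r ≤ D.relVar j i ω) → r ≤ R) ∧
      ∀ u ρ, 0 ≤ u → 0 ≤ ρ → (∀ j, D.relVar j i ω ≤ u) → (∀ j, (D.n j : ℝ) ≤ ρ * (D.n j - 1)) →
        R ≤ ρ * u := by
  have hs := h.diffSD_pos (by linarith) i
  have hv0 := h.var_pos 0 i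
  have hv1 := h.var_pos 1 i
  have hn0 := h.size_pos (by linarith) 0
  have hn1 := h.size_pos (by linarith) 1
  have hn0' : 2 ≤ (D.n 0 : ℝ) := hN.trans (h.le_size 0)
  have hn1' : 2 ≤ (D.n 1 : ℝ) := hN.trans (h.le_size 1)
  have hsd := h.diffSD_sq i
  have hnum : D.stdDiff i ω + (D.mean 0 i - D.mean 1 i) / D.diffSD i =
      (D.sampleMean 0 i ω - D.sampleMean 1 i ω) / D.diffSD i := by
    rw [h.stdDiff_eq (by linarith)]; ring
  have hU : ∀ j, D.sumSqDev j i ω = D.n j * D.var j i * D.relVar j i ω := by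
    intro j
    have := h.var_pos j i
    have := h.size_pos (by linarith) j
    unfold relVar
    field_simp
  rw [hnum]
  set σ := D.diffSD i
  cases v with
  | unequal =>
    -- A convex combination of the two relative variances with weights (var/n)/σ², each inflated by
    -- n/(n-1) ≥ 1. Lower bounds pass to R without loss; upper bounds lose the factor ρ.
    set R : ℝ := (D.n 0 / (D.n 0 - 1) * D.relVar 0 i ω * (D.var 0 i / D.n 0) +
      D.n 1 / (D.n 1 - 1) * D.relVar 1 i ω * (D.var 1 i / D.n 1)) / σ ^ 2 with hR
    have hR' : D.sampleVar 0 i ω / D.n 0 + D.sampleVar 1 i ω / D.n 1 = σ ^ 2 * R := by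
      have : (D.n 0 : ℝ) - 1 ≠ 0 := by linarith
      have : (D.n 1 : ℝ) - 1 ≠ 0 := by linarith
      rw [hR]
      unfold sampleVar
      rw [hU, hU]
      field_simp
    refine ⟨R, ?_, fun r hr hle => ?_, fun u ρ hu hρ hle hle2 => ?_⟩
    · simp only [tStat]
      rw [hR', Real.sqrt_mul (sq_nonneg _), Real.sqrt_sq hs.le, div_div]
    · rw [hR, le_div_iff₀ (by positivity), hsd, mul_add]
      have hone : ∀ x : ℝ, 2 ≤ x → 1 ≤ x / (x - 1) := fun x hx => by
        rw [le_div_iff₀ (by linarith)]; linarith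
      have g0 : r ≤ D.n 0 / (D.n 0 - 1) * D.relVar 0 i ω := by
        nlinarith [hone _ hn0', hle 0]
      have g1 : r ≤ D.n 1 / (D.n 1 - 1) * D.relVar 1 i ω := by
        nlinarith [hone _ hn1', hle 1]
      gcongr
    · rw [hR, div_le_iff₀ (by positivity), hsd, mul_add]
      have g : ∀ j, (D.n j : ℝ) / (D.n j - 1) ≤ ρ := fun j => by
        have : 2 ≤ (D.n j : ℝ) := hN.trans (h.le_size j)
        rw [div_le_iff₀ (by linarith)]; exact hle2 j
      have g' : ∀ j, 0 ≤ (D.n j : ℝ) / (D.n j - 1) := fun j => by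
        have : 2 ≤ (D.n j : ℝ) := hN.trans (h.le_size j)
        exact div_nonneg (by linarith) (by linarith)
      have g2 : ∀ j, (D.n j : ℝ) / (D.n j - 1) * D.relVar j i ω ≤ ρ * u := fun j =>
        (mul_le_mul_of_nonneg_left (hle j) (g' j)).trans
          (mul_le_mul_of_nonneg_right (g j) hu)
      exact add_le_add
        (mul_le_mul_of_nonneg_right (g2 0) (div_pos hv0 hn0).le)
        (mul_le_mul_of_nonneg_right (g2 1) (div_pos hv1 hn1).le)
  | equal =>
    have hve := hv rfl
    set R : ℝ := (D.n 0 * D.relVar 0 i ω + D.n 1 * D.relVar 1 i ω) / (D.n 0 + D.n 1 - 2) with hR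
    have hden : 0 < (D.n 0 : ℝ) + D.n 1 - 2 := by linarith
    have hR' : (D.n 0 * D.n 1 : ℝ) / ((D.n 0 + D.n 1 : ℝ) * D.pooledVar i ω) = (σ ^ 2 * R)⁻¹ := by
      have e1 : D.pooledVar i ω = D.var 0 i * R := by
        rw [hR]
        unfold pooledVar
        rw [hU, hU, ← hve]
        field_simp
      rw [e1, hsd, ← hve]
      -- When R = 0 both sides are 0 by the convention for division by zero.
      rcases eq_or_ne R 0 with h0 | h0
      · simp [h0]
      · field_simp
        ring
    refine ⟨R, ?_, fun r hr hle => ?_, fun u ρ hu hρ hle hle2 => ?_⟩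
    · simp only [tStat]
      rw [hR', Real.sqrt_inv, Real.sqrt_mul (sq_nonneg _), Real.sqrt_sq hs.le, div_div,
        div_eq_inv_mul]
    · rw [hR, le_div_iff₀ hden]
      nlinarith [hle 0, hle 1]
    · rw [hR, div_le_iff₀ hden]
      have := hle2 0
      have := hle2 1
      calc _ ≤ D.n 0 * u + D.n 1 * u := by gcongr; exacts [hle 0, hle 1]
        _ ≤ ρ * (D.n 0 - 1) * u + ρ * (D.n 1 - 1) * u := by gcongr
        _ = _ := by ring

end Regular

end TwoSample

namespace TwoSample.Regular

variable {m : ℕ} {Ω : Type*} [MeasurableSpace Ω] {P : Measure Ω} {D : TwoSample m P} {t K N : ℝ}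

theorem iIndepFun_stdObs_sample (D : TwoSample m P) (i : Fin m) (j : Fin 2) :
    iIndepFun (fun k : Fin (D.n j) => D.stdObs i ⟨j, k⟩) P :=
  (iIndepFun_stdObs D i).precomp (g := fun k : Fin (D.n j) => (⟨j, k⟩ : Σ j, Fin (D.n j)))
    (fun a b hab => by simpa using hab)

/-- The relative variance is the mean of squares minus the square of the mean; half of ε is allotted
to each. -/
theorem relVar_lower_tail [IsProbabilityMeasure P] (h : D.Regular t K N) (hN : 1 ≤ N) (ht : 0 < t)
    (hK : 0 < K) {ε : ℝ} (hε : 0 ≤ ε) (hε1 : √(ε / 2) ≤ t / 2)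
    (hε2 : 48 / t ^ 3 * K * √(ε / 2) ≤ 1 / 4) (j : Fin 2) (i : Fin m) :
    P.real {ω | D.relVar j i ω < 1 - ε} ≤
      Real.exp (-(N * ε ^ 2 * t ^ 4 / (192 * K))) + 2 * Real.exp (-(N * ε / 8)) := by
  have hn := h.size_pos hN j
  have hind := iIndepFun_stdObs_sample D i j
  have hm := fun k : Fin (D.n j) => h.measurable_stdObs i ⟨j, k⟩
  have hl := fun k : Fin (D.n j) => h.stdLaw_stdObs hK i ⟨j, k⟩
  have h1 := sq_mean_lower_tail ht hm hind hl (show 0 ≤ ε / 2 by positivity) hK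
  have h2 := abs_sum_tail ht hm hind hl (Real.sqrt_nonneg (ε / 2)) hε1 hε2
  rw [Fintype.card_fin] at h1 h2
  rw [Real.sq_sqrt (by positivity)] at h2
  have hsub : {ω | D.relVar j i ω < 1 - ε} ⊆
      {ω | ∑ k, D.stdObs i ⟨j, k⟩ ω ^ 2 ≤ D.n j * (1 - ε / 2)} ∪
      {ω | D.n j * √(ε / 2) ≤ |∑ k, D.stdObs i ⟨j, k⟩ ω|} := by
    intro ω hω
    simp only [Set.mem_ofPred_eq, Set.mem_union] at hω ⊢
    by_contra hcon
    rw [not_or, not_le, not_le] at hcon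
    rw [h.relVar_eq hN] at hω
    have g1 : 1 - ε / 2 < (∑ k, D.stdObs i ⟨j, k⟩ ω ^ 2) / D.n j := by
      rw [lt_div_iff₀ hn]; linarith [hcon.1]
    have g2 : ((∑ k, D.stdObs i ⟨j, k⟩ ω) / D.n j) ^ 2 ≤ ε / 2 := by
      rw [← Real.sq_sqrt (show 0 ≤ ε / 2 by positivity)]
      refine sq_le_sq.2 ?_
      rw [abs_div, abs_of_pos hn, abs_of_nonneg (Real.sqrt_nonneg _), div_le_iff₀ hn]
      linarith [hcon.2]
    linarith
  have hNn := h.le_size j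
  calc _ ≤ _ := (measureReal_mono hsub).trans (measureReal_union_le _ _)
    _ ≤ Real.exp (-(D.n j * (ε / 2) ^ 2 * t ^ 4 / (48 * K))) +
        2 * Real.exp (-(D.n j * (ε / 2) / 4)) := add_le_add h1 h2
    _ ≤ _ := by
      gcongr ?_ + 2 * ?_
      · refine Real.exp_le_exp.2 (neg_le_neg ?_)
        calc _ ≤ D.n j * ε ^ 2 * t ^ 4 / (192 * K) := by gcongr
          _ = _ := by field_simp; ring
      · refine Real.exp_le_exp.2 (neg_le_neg ?_)
        calc _ ≤ D.n j * ε / 8 := by gcongr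
          _ = _ := by ring

end TwoSample.Regular

/-! ### Moderate deviations of the t statistics of true nulls -/

theorem one_add_sqrt_bounds {L : ℝ} (hL : 1 ≤ L) :
    2 * L ≤ (1 + √(2 * L)) ^ 2 ∧ (1 + √(2 * L)) ^ 2 ≤ 9 * L := by
  have h := Real.sq_sqrt (show 0 ≤ 2 * L by linarith)
  have h0 := Real.sqrt_nonneg (2 * L)
  constructor
  · nlinarith
  · nlinarith [sq_nonneg (√(2 * L) - 2)]

/-- The numerical conditions on the sample size in the tail bound for true nulls. -/
theorem eventually_sample_size_large {t K c η δ₁ δ₂ : ℝ} (ht : 0 < t) (hK : 0 < K) (hc : 0 < c)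
    (hη : 0 < η) (hδ₁ : 0 < δ₁) (hδ₂ : 0 < δ₂) :
    ∀ᶠ L : ℝ in atTop, 1 ≤ L ∧ 2 ≤ c * L ^ 5 ∧
      (1 + √(2 * L)) ^ 4 * (1 / √(c * L ^ 5)) ≤ δ₁ ∧
      (1 + √(2 * L)) ^ 2 ≤ δ₂ * (c * L ^ 5) ∧
      √(η / (1 + √(2 * L)) ^ 2 / 2) ≤ t / 2 ∧
      48 / t ^ 3 * K * √(η / (1 + √(2 * L)) ^ 2 / 2) ≤ 1 / 4 ∧
      L ≤ c * L ^ 5 * (η / (1 + √(2 * L)) ^ 2) ^ 2 * t ^ 4 / (192 * K) ∧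
      L ≤ c * L ^ 5 * (η / (1 + √(2 * L)) ^ 2) / 8 := by
  -- Both smallness conditions on √(η/(1+√(2L))²/2) amount to its being at most r.
  set r := min (t / 2) (t ^ 3 / (192 * K)) with hr
  have hr0 : 0 < r := by positivity
  filter_upwards [eventually_ge_atTop (1 : ℝ), eventually_ge_atTop (2 / c),
    eventually_ge_atTop (81 ^ 2 / (δ₁ ^ 2 * c)), eventually_ge_atTop (9 / (δ₂ * c)),
    eventually_ge_atTop (η / r ^ 2), eventually_ge_atTop (81 * (192 * K) / (c * η ^ 2 * t ^ 4)),
    eventually_ge_atTop (72 / (c * η))] with L h1 h2 h3 h4 h5 h6 h7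
  obtain ⟨b1, b2⟩ := one_add_sqrt_bounds h1
  set y := (1 + √(2 * L)) ^ 2 with hy
  have hy4 : (1 + √(2 * L)) ^ 4 = y ^ 2 := by rw [hy]; ring
  have hL0 : 0 < L := by linarith
  have hy0 : 0 < y := by linarith
  have hp : ∀ k, 1 ≤ L ^ k := fun k => one_le_pow₀ h1
  rw [div_le_iff₀ (by positivity)] at h2 h3 h4 h5 h6 h7
  have hsq : √(η / y / 2) ≤ r := by
    rw [Real.sqrt_le_left hr0.le, div_div, div_le_iff₀ (by positivity)]
    have : r ^ 2 * (2 * L) ≤ r ^ 2 * y := by gcongr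
    nlinarith [sq_nonneg r]
  refine ⟨h1, ?_, ?_, ?_, hsq.trans (min_le_left _ _), ?_, ?_, ?_⟩
  · nlinarith [hp 4, mul_nonneg hc.le hL0.le]
  -- The most demanding condition: (1+√(2L))⁴ is of order L² and must be small against the square
  -- root of the sample size, so a power of L above 4 is needed.
  · rw [hy4, mul_one_div, div_le_iff₀ (by positivity)]
    refine abs_le_of_sq_le_sq' ?_ (by positivity) |>.2
    rw [mul_pow, Real.sq_sqrt (by positivity)]
    calc (y ^ 2) ^ 2 ≤ ((9 * L) ^ 2) ^ 2 := by gcongr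
      _ = 81 ^ 2 * L ^ 4 := by ring
      _ ≤ (L * (δ₁ ^ 2 * c)) * L ^ 4 := by gcongr
      _ = _ := by ring
  · calc y ≤ 9 * L := b2
      _ ≤ (L * (δ₂ * c)) * L := by gcongr
      _ = δ₂ * (c * L ^ 2) := by ring
      _ ≤ _ := by gcongr; linarith
  · calc _ ≤ 48 / t ^ 3 * K * (t ^ 3 / (192 * K)) := by
          gcongr
          exact hsq.trans (min_le_right _ _)
      _ = _ := by field_simp; norm_num
  · rw [le_div_iff₀ (by positivity)]
    calc L * (192 * K) = 81 * (192 * K) * L ^ 3 / (81 * L ^ 2) := by field_simp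
      _ ≤ L * (c * η ^ 2 * t ^ 4) * L ^ 3 / (81 * L ^ 2) := by gcongr
      _ ≤ L * (c * η ^ 2 * t ^ 4) * L ^ 4 / (81 * L ^ 2) := by gcongr; linarith
      _ = c * L ^ 5 * (η / (9 * L)) ^ 2 * t ^ 4 := by field_simp; ring
      _ ≤ _ := by gcongr
  · rw [le_div_iff₀ (by positivity)]
    calc L * 8 = 72 * L ^ 2 / (9 * L) := by field_simp; ring
      _ ≤ L * (c * η) * L ^ 2 / (9 * L) := by gcongr
      _ ≤ L * (c * η) * L ^ 4 / (9 * L) := by gcongr; linarith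
      _ = c * L ^ 5 * (η / (9 * L)) := by field_simp
      _ ≤ _ := by gcongr

/-- With equal means T = S/√R, where S is a normalised sum. Outside an event of probability 6e^(-L),
three for each sample, R ≥ 1-e with (1+x)²e ≤ η, so T ≥ x forces a deviation of S beyond x(1-e),
which costs only 1+O(η) in the tail. The range x ≤ √(2L) reaches p-values of order about 1/m.
Uniformity over dimensions and probability spaces allows L = log m later. -/
theorem eventually_prob_tStat_ge_le.{u} {t K c ε : ℝ} (ht : 0 < t) (hK : 0 < K) (hc : 0 < c)
    (hε : 0 < ε) :
    ∀ᶠ L : ℝ in atTop, ∀ {m : ℕ} {Ω : Type u} [MeasurableSpace Ω] {P : Measure Ω}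
      [IsProbabilityMeasure P] (D : TwoSample m P), D.Regular t K (c * L ^ 5) →
      ∀ (v : VarianceCase) (i : Fin m), (v = VarianceCase.equal → D.var 0 i = D.var 1 i) →
      D.mean 0 i = D.mean 1 i → ∀ x, 0 ≤ x → x ≤ √(2 * L) →
      P.real {ω | x ≤ |D.tStat v i ω|} ≤
        (1 + ε) * studentTail ((D.n 0 : ℝ) + D.n 1 - 2) x + 6 * Real.exp (-L) := by
  -- One factor 1+ε₁ each for the moderate deviation bound, the shift of the threshold and the
  -- passage to the Student tail; for ε₁ ≤ 1 the cube is at most 1+7ε₁.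
  obtain ⟨ε₁, hε₁, hε₁'⟩ : ∃ ε₁ > 0, (1 + ε₁) ^ 3 ≤ 1 + ε := by
    refine ⟨min 1 (ε / 7), by positivity, ?_⟩
    have h1 : min 1 (ε / 7) ≤ 1 := min_le_left _ _
    have h2 : min 1 (ε / 7) ≤ ε / 7 := min_le_right _ _
    have h3 : 0 < min 1 (ε / 7) := by positivity
    nlinarith [mul_nonneg h3.le (sub_nonneg.2 h1), mul_nonneg h3.le h3.le,
      mul_nonneg (mul_nonneg h3.le h3.le) (sub_nonneg.2 h1)]
  obtain ⟨δ₁, hδ₁, hMD⟩ := exists_prob_sum_ge_le.{u, 0} (K := K) ht hε₁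
  obtain ⟨δ₂, hδ₂, hST⟩ := exists_gaussTail_le_studentTail hε₁
  obtain ⟨η, hη0, hη1, hη⟩ : ∃ η > 0, η ≤ 1 ∧ Real.exp (5 / 2) * η ≤ ε₁ := by
    refine ⟨min 1 (ε₁ / Real.exp (5 / 2)), by positivity, min_le_left _ _, ?_⟩
    rw [mul_comm, ← le_div_iff₀ (by positivity)]
    exact min_le_right _ _
  filter_upwards [eventually_sample_size_large ht hK hc hη0 hδ₁ hδ₂] with L hL
  obtain ⟨hL1, hN2, hMDc, hSTc, hs1, hs2, he1, he2⟩ := hL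
  intro m Ω _ P _ D h v i hv hmean x hx hxL
  set N := c * L ^ 5 with hN
  set y := 1 + √(2 * L) with hy
  have hy1 : 1 ≤ y := by rw [hy]; linarith [Real.sqrt_nonneg (2 * L)]
  set e := η / y ^ 2 with he
  have he0 : 0 < e := by positivity
  have he_le : e ≤ 1 := by
    rw [he, div_le_one (by positivity)]; nlinarith
  -- deviations of the variance estimators
  have hU : ∀ j, P.real {ω | D.relVar j i ω < 1 - e} ≤ 3 * Real.exp (-L) := by
    intro j
    refine (h.relVar_lower_tail (by linarith) ht hK he0.le hs1 hs2 j i).trans ?_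
    have h1 : Real.exp (-(N * e ^ 2 * t ^ 4 / (192 * K))) ≤ Real.exp (-L) :=
      Real.exp_le_exp.2 (neg_le_neg he1)
    have h2 : Real.exp (-(N * e / 8)) ≤ Real.exp (-L) := Real.exp_le_exp.2 (neg_le_neg he2)
    linarith
  -- the standardised difference
  set x' := x - x * e with hx'
  have hx'0 : 0 ≤ x' := by rw [hx']; nlinarith
  have hx'x : x' ≤ x := by rw [hx']; nlinarith
  have hS : ∀ s : ℝ, s ^ 2 = 1 → P.real {ω | x' ≤ s * D.stdDiff i ω} ≤
      (1 + ε₁) * (gaussTail x' / √(2 * Real.pi)) := by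
    intro s hs
    have hsabs : |s| = 1 := by
      rw [← Real.sqrt_sq_eq_abs, hs, Real.sqrt_one]
    have := hMD (fun q => h.measurable_stdObs i q) (TwoSample.Regular.iIndepFun_stdObs D i)
      (fun q => h.stdLaw_stdObs hK i q) (fun q => s * D.weight i q) (1 / √N) x'
      (fun q => by rw [abs_mul, hsabs, one_mul]; exact h.abs_weight_le (by linarith) i q)
      (by simp_rw [mul_pow, hs, one_mul]; exact h.sum_weight_sq (by linarith) i) hx'0
      (le_trans (by gcongr; linarith) hMDc)
    simpa only [TwoSample.stdDiff, Finset.mul_sum, mul_assoc] using this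
  have hsub : {ω | x ≤ |D.tStat v i ω|} ⊆
      ({ω | D.relVar 0 i ω < 1 - e} ∪ {ω | D.relVar 1 i ω < 1 - e}) ∪
      ({ω | x' ≤ 1 * D.stdDiff i ω} ∪ {ω | x' ≤ -1 * D.stdDiff i ω}) := by
    intro ω hω
    simp only [Set.mem_ofPred_eq, Set.mem_union] at hω ⊢
    by_contra hcon
    simp only [not_or, not_lt, not_le] at hcon
    obtain ⟨⟨g0, g1⟩, g2, g3⟩ := hcon
    obtain ⟨R, hT, hR, -⟩ := h.exists_tStat_eq hN2 v i hv ω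
    have hRe : 1 - e ≤ R := hR _ (by linarith) (fun j => by fin_cases j; exacts [g0, g1])
    rw [hmean, sub_self, zero_div, add_zero] at hT
    have hSabs : |D.stdDiff i ω| < x' := abs_lt.2 ⟨by linarith, by linarith⟩
    have hx0 : 0 < x' := (abs_nonneg _).trans_lt hSabs
    have he1' : 0 < 1 - e := by
      have : x' = x * (1 - e) := by rw [hx']; ring
      rw [this] at hx0
      exact pos_of_mul_pos_right hx0 hx
    have hR0 : 0 < R := by linarith
    -- Since 0 < 1-e ≤ 1, (1-e)² ≤ 1-e ≤ R.
    have hsq : 1 - e ≤ √R := by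
      refine (Real.le_sqrt' he1').2 (le_trans ?_ hRe)
      nlinarith
    rw [hT, abs_div, abs_of_nonneg (Real.sqrt_nonneg R), le_div_iff₀ (Real.sqrt_pos.2 hR0)] at hω
    have : x * (1 - e) ≤ x * √R := by gcongr
    have : x' = x * (1 - e) := by rw [hx']; ring
    linarith
  have hshift : gaussTail x' ≤ (1 + ε₁) * gaussTail x := by
    refine (gaussTail_sub_le hx hη1 (by positivity) ?_).trans ?_
    · have h1 : x ≤ y := by rw [hy]; linarith
      have h2 : 1 + x ≤ y := by rw [hy]; linarith
      calc x * e * (1 + x) ≤ y * e * y := by gcongr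
        _ = η := by rw [he]; field_simp
    · have := gaussTail_pos x
      gcongr
  have hn0 := h.le_size 0
  have hn1 := h.le_size 1
  have hstud := hST ((D.n 0 : ℝ) + D.n 1 - 2) x (by linarith) hx (by
    calc (1 + x) ^ 2 ≤ y ^ 2 := by gcongr; linarith
      _ ≤ δ₂ * N := hSTc
      _ ≤ _ := by gcongr; linarith)
  have hq0 : 0 ≤ studentTail ((D.n 0 : ℝ) + D.n 1 - 2) x := by
    have := gaussTail_pos x
    have hpos : 0 ≤ 2 * (gaussTail x / √(2 * Real.pi)) := by positivity
    exact (mul_nonneg_iff_of_pos_left (by linarith)).1 (hpos.trans hstud)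
  have hfin : 2 * ((1 + ε₁) * (gaussTail x' / √(2 * Real.pi))) ≤
      (1 + ε) * studentTail ((D.n 0 : ℝ) + D.n 1 - 2) x := by
    calc _ ≤ 2 * ((1 + ε₁) * ((1 + ε₁) * gaussTail x / √(2 * Real.pi))) := by gcongr
      _ = (1 + ε₁) ^ 2 * (2 * (gaussTail x / √(2 * Real.pi))) := by ring
      _ ≤ (1 + ε₁) ^ 2 * ((1 + ε₁) * studentTail ((D.n 0 : ℝ) + D.n 1 - 2) x) := by gcongr
      _ = (1 + ε₁) ^ 3 * studentTail ((D.n 0 : ℝ) + D.n 1 - 2) x := by ring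
      _ ≤ _ := by gcongr
  calc _ ≤ _ := (measureReal_mono hsub).trans (measureReal_union_le _ _)
    _ ≤ (P.real {ω | D.relVar 0 i ω < 1 - e} + P.real {ω | D.relVar 1 i ω < 1 - e}) +
        (P.real {ω | x' ≤ 1 * D.stdDiff i ω} + P.real {ω | x' ≤ -1 * D.stdDiff i ω}) :=
      add_le_add (measureReal_union_le _ _) (measureReal_union_le _ _)
    _ ≤ _ := by linarith [hU 0, hU 1, hS 1 (by norm_num), hS (-1) (by norm_num)]

/-! ### Location of the t statistics of signals -/

namespace TwoSample.Regular

variable {m : ℕ} {Ω : Type*} [MeasurableSpace Ω] {P : Measure Ω} {D : TwoSample m P} {t K N : ℝ}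

theorem stdDiff_tail [IsProbabilityMeasure P] (h : D.Regular t K N) (hN : 1 ≤ N) (ht : 0 < t)
    (hK : 0 < K) (i : Fin m) {r : ℝ} (hr : 0 < r) :
    P.real {ω | r ≤ |D.stdDiff i ω|} ≤ 1 / r ^ 2 := by
  have hl := h.stdLaw_stdObs hK i
  have hm := h.measurable_stdObs i
  have := chebyshev_weighted_sum (W := D.stdObs i) (μ := 0) (M := 1)
    (fun q => by simpa using (hl q).memLp_comp_pow (hm q) ht 1) (iIndepFun_stdObs D i)
    (fun q => (hl q).integral_comp (hm q)) (fun q => ((hl q).variance_comp (hm q)).le)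
    (D.weight i) hr
  simpa [h.sum_weight_sq hN i, stdDiff] using this

/-- Dropping the squared mean only enlarges the relative variance, and Chebyshev applies to the mean
of squares. A polynomial rate suffices, since for signals the probabilities need only tend to 0. -/
theorem relVar_upper_tail [IsProbabilityMeasure P] (h : D.Regular t K N) (hN : 1 ≤ N) (ht : 0 < t)
    (hK : 0 < K) (j : Fin 2) (i : Fin m) {ε : ℝ} (hε : 0 < ε) :
    P.real {ω | 1 + ε < D.relVar j i ω} ≤ 24 / t ^ 4 * K / (N * ε ^ 2) := by
  have hn := h.size_pos hN j
  have hl := fun k : Fin (D.n j) => h.stdLaw_stdObs hK i ⟨j, k⟩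
  have hm := fun k : Fin (D.n j) => h.measurable_stdObs i ⟨j, k⟩
  have hind : iIndepFun (fun (k : Fin (D.n j)) ω => D.stdObs i ⟨j, k⟩ ω ^ 2) P :=
    (iIndepFun_stdObs_sample D i j).comp (fun _ x => x ^ 2) (fun _ => by fun_prop)
  have hc := chebyshev_weighted_sum (μ := 1) (M := 24 / t ^ 4 * K)
    (fun k => (hl k).memLp_comp_pow (hm k) ht 2) hind
    (fun k => (hl k).integral_comp_sq (hm k)) (fun k => (hl k).variance_comp_sq_le (hm k) ht)
    (fun _ => 1 / (D.n j : ℝ)) hε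
  have hsub : {ω | 1 + ε < D.relVar j i ω} ⊆
      {ω | ε ≤ |∑ k, 1 / (D.n j : ℝ) * D.stdObs i ⟨j, k⟩ ω ^ 2 -
        1 * ∑ _k : Fin (D.n j), 1 / (D.n j : ℝ)|} := by
    intro ω hω
    simp only [Set.mem_ofPred_eq] at hω ⊢
    rw [h.relVar_eq hN] at hω
    rw [← Finset.mul_sum]
    simp only [Finset.sum_const, Finset.card_univ, Fintype.card_fin, nsmul_eq_mul]
    rw [mul_one_div_cancel hn.ne', mul_one, one_div_mul_eq_div]
    refine le_trans ?_ (le_abs_self _)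
    have := sq_nonneg ((∑ k, D.stdObs i ⟨j, k⟩ ω) / D.n j)
    linarith
  refine (measureReal_mono hsub).trans (hc.trans ?_)
  simp only [Finset.sum_const, Finset.card_univ, Fintype.card_fin, nsmul_eq_mul]
  have hNn := h.le_size j
  have hN0 : 0 < N := by linarith
  calc _ = 24 / t ^ 4 * K / (D.n j * ε ^ 2) := by field_simp
    _ ≤ _ := by gcongr

theorem abs_standardized_mean_sub (D : TwoSample m P) (i : Fin m) :
    |(D.mean 0 i - D.mean 1 i) / D.diffSD i| = D.signalSize i := by
  rw [abs_div]
  unfold signalSize diffSD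
  rw [abs_of_nonneg (Real.sqrt_nonneg _)]

end TwoSample.Regular

theorem eventually_relVar_lower_tail.{u} {t K c η : ℝ} (ht : 0 < t) (hK : 0 < K) (hc : 0 < c)
    (hη : 0 < η) :
    ∀ᶠ L : ℝ in atTop, ∀ {m : ℕ} {Ω : Type u} [MeasurableSpace Ω] {P : Measure Ω}
      [IsProbabilityMeasure P] (D : TwoSample m P), D.Regular t K (c * L ^ 5) →
      ∀ (j : Fin 2) (i : Fin m), P.real {ω | D.relVar j i ω < 1 - η} ≤ 3 * Real.exp (-L) := by
  filter_upwards [eventually_sample_size_large ht hK hc hη one_pos one_pos] with L hL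
  obtain ⟨hL1, hN2, -, -, hs1, hs2, he1, he2⟩ := hL
  intro m Ω _ P _ D h j i
  have hy := (one_add_sqrt_bounds hL1).1
  set e := η / (1 + √(2 * L)) ^ 2 with he
  have he0 : 0 < e := by positivity
  have hsub : {ω | D.relVar j i ω < 1 - η} ⊆ {ω | D.relVar j i ω < 1 - e} := by
    intro ω hω
    simp only [Set.mem_ofPred_eq] at hω ⊢
    have : e ≤ η := div_le_self hη.le (by linarith)
    linarith
  refine (measureReal_mono hsub).trans
    ((h.relVar_lower_tail (by linarith) ht hK he0.le hs1 hs2 j i).trans ?_)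
  have h1 := Real.exp_le_exp.2 (neg_le_neg he1)
  have h2 := Real.exp_le_exp.2 (neg_le_neg he2)
  linarith

theorem tendsto_exp_neg_atTop_mul (a : ℝ) :
    Tendsto (fun L : ℝ => a * Real.exp (-L)) atTop (𝓝 0) := by
  simpa using Real.tendsto_exp_neg_atTop_nhds_zero.const_mul a

theorem eventually_signal_upper.{u} {t K c θ τ ρ : ℝ} (ht : 0 < t) (hK : 0 < K) (hc : 0 < c)
    (hθ : 0 < θ) (hτ : θ < τ) (hρ : 0 < ρ) :
    ∀ᶠ L : ℝ in atTop, ∀ {m : ℕ} {Ω : Type u} [MeasurableSpace Ω] {P : Measure Ω}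
      [IsProbabilityMeasure P] (D : TwoSample m P), D.Regular t K (c * L ^ 5) →
      ∀ (v : VarianceCase) (i : Fin m), (v = VarianceCase.equal → D.var 0 i = D.var 1 i) →
      D.signalSize i = θ * √L →
      P.real {ω | τ * √L ≤ |D.tStat v i ω|} ≤ ρ := by
  have hτ0 : 0 < τ := hθ.trans hτ
  -- Chosen so that rτ is the midpoint of θ and τ: if √R ≥ r, then |T| ≥ τ√L needs a deviation of S
  -- of at least (τ-θ)√L/2.
  set r := (τ + θ) / (2 * τ) with hr
  have hr0 : 0 < r := by positivity
  have hr1 : r < 1 := by rw [hr, div_lt_one (by positivity)]; linarith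
  have hrτ : r * τ = (τ + θ) / 2 := by rw [hr]; field_simp
  have hη : 0 < 1 - r ^ 2 := by nlinarith
  have hlim : Tendsto (fun L : ℝ => 6 * Real.exp (-L) + 4 / (τ - θ) ^ 2 * L⁻¹) atTop (𝓝 0) := by
    simpa using (tendsto_exp_neg_atTop_mul 6).add
      (tendsto_inv_atTop_zero.const_mul (4 / (τ - θ) ^ 2))
  filter_upwards [eventually_relVar_lower_tail.{u} ht hK hc hη, eventually_gt_atTop (0 : ℝ),
    hlim.eventually (Iio_mem_nhds hρ),
    eventually_sample_size_large ht hK hc hη one_pos one_pos] with L hU hL0 hLρ hL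
  obtain ⟨hL1, hN2, -⟩ := hL
  intro m Ω _ P _ D h v i hv hsig
  have hsL : 0 < √L := Real.sqrt_pos.2 hL0
  have hdel := TwoSample.Regular.abs_standardized_mean_sub D i
  rw [hsig] at hdel
  have hsub : {ω | τ * √L ≤ |D.tStat v i ω|} ⊆
      ({ω | D.relVar 0 i ω < 1 - (1 - r ^ 2)} ∪ {ω | D.relVar 1 i ω < 1 - (1 - r ^ 2)}) ∪
      {ω | (τ - θ) / 2 * √L ≤ |D.stdDiff i ω|} := by
    intro ω hω
    simp only [Set.mem_ofPred_eq, Set.mem_union] at hω ⊢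
    by_contra hcon
    simp only [not_or, not_lt, not_le] at hcon
    obtain ⟨⟨g0, g1⟩, g2⟩ := hcon
    rw [sub_sub_cancel] at g0 g1
    obtain ⟨R, hT, hR, -⟩ := h.exists_tStat_eq hN2 v i hv ω
    have hRr : r ^ 2 ≤ R := hR _ (sq_nonneg r) (fun j => by fin_cases j; exacts [g0, g1])
    have hsq : r ≤ √R := (Real.le_sqrt' hr0).2 hRr
    rw [hT, abs_div, abs_of_nonneg (Real.sqrt_nonneg R), le_div_iff₀ (hr0.trans_le hsq)] at hω
    have h1 := abs_add_le (D.stdDiff i ω) ((D.mean 0 i - D.mean 1 i) / D.diffSD i)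
    have h2 : τ * √L * r ≤ τ * √L * √R := by gcongr
    have h3 : τ * √L * r = (τ + θ) / 2 * √L := by rw [← hrτ]; ring
    rw [hdel] at h1
    linarith
  have hch := h.stdDiff_tail (by linarith) ht hK i
    (r := (τ - θ) / 2 * √L) (mul_pos (by linarith) hsL)
  have heq : 1 / ((τ - θ) / 2 * √L) ^ 2 = 4 / (τ - θ) ^ 2 * L⁻¹ := by
    have : τ - θ ≠ 0 := by linarith
    rw [mul_pow, Real.sq_sqrt hL0.le]
    field_simp
    norm_num
  rw [heq] at hch
  have hLρ : 6 * Real.exp (-L) + 4 / (τ - θ) ^ 2 * L⁻¹ < ρ := hLρ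
  calc _ ≤ _ := (measureReal_mono hsub).trans (measureReal_union_le _ _)
    _ ≤ _ := add_le_add (measureReal_union_le _ _) hch
    _ ≤ _ := by linarith [hU D h 0 i, hU D h 1 i]

theorem eventually_signal_lower.{u} {t K c θ τ ρ : ℝ} (ht : 0 < t) (hK : 0 < K) (hc : 0 < c)
    (hτ0 : 0 < τ) (hτ : τ < θ) (hρ : 0 < ρ) :
    ∀ᶠ L : ℝ in atTop, ∀ {m : ℕ} {Ω : Type u} [MeasurableSpace Ω] {P : Measure Ω}
      [IsProbabilityMeasure P] (D : TwoSample m P), D.Regular t K (c * L ^ 5) →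
      ∀ (v : VarianceCase) (i : Fin m), (v = VarianceCase.equal → D.var 0 i = D.var 1 i) →
      D.signalSize i = θ * √L →
      P.real {ω | |D.tStat v i ω| ≤ τ * √L} ≤ ρ := by
  -- Chosen so that τ(1+ε) is the midpoint of τ and θ. The bound √R ≤ 1+ε spends one factor 1+ε on
  -- the relative variance and one on n/(n-1).
  set ε := (θ - τ) / (2 * τ) with hεd
  have hε : 0 < ε := div_pos (by linarith) (by positivity)
  have hετ : τ * (1 + ε) = (θ + τ) / 2 := by rw [hεd]; field_simp; ring
  have hlim : Tendsto (fun L : ℝ => 6 * Real.exp (-L) + 2 * (24 / t ^ 4 * K / (c * ε ^ 2)) * L⁻¹ +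
      4 / (θ - τ) ^ 2 * L⁻¹) atTop (𝓝 0) := by
    simpa using ((tendsto_exp_neg_atTop_mul 6).add
      (tendsto_inv_atTop_zero.const_mul (2 * (24 / t ^ 4 * K / (c * ε ^ 2))))).add
      (tendsto_inv_atTop_zero.const_mul (4 / (θ - τ) ^ 2))
  filter_upwards [eventually_relVar_lower_tail.{u} ht hK hc one_half_pos,
    eventually_ge_atTop (1 : ℝ), eventually_ge_atTop ((1 + ε) / (ε * c)),
    hlim.eventually (Iio_mem_nhds hρ),
    eventually_sample_size_large ht hK hc hε one_pos one_pos] with L hU hL1 hLε hLρ hL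
  obtain ⟨-, hN2, -⟩ := hL
  intro m Ω _ P _ D h v i hv hsig
  have hL0 : 0 < L := by linarith
  have hsL : 0 < √L := Real.sqrt_pos.2 hL0
  have hdel := TwoSample.Regular.abs_standardized_mean_sub D i
  rw [hsig] at hdel
  have hLN : c * L ≤ c * L ^ 5 := by
    gcongr
    exact le_self_pow₀ hL1 (by norm_num)
  have hn : ∀ j, (D.n j : ℝ) ≤ (1 + ε) * (D.n j - 1) := by
    intro j
    rw [div_le_iff₀ (by positivity)] at hLε
    have := h.le_size j
    have : 1 + ε ≤ ε * (D.n j : ℝ) := by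
      calc _ ≤ ε * (c * L) := by linarith
        _ ≤ _ := by gcongr; linarith
    linarith
  have hsub : {ω | |D.tStat v i ω| ≤ τ * √L} ⊆
      ({ω | D.relVar 0 i ω < 1 - 1 / 2} ∪ {ω | D.relVar 1 i ω < 1 - 1 / 2}) ∪
      ({ω | 1 + ε < D.relVar 0 i ω} ∪ {ω | 1 + ε < D.relVar 1 i ω}) ∪
      {ω | (θ - τ) / 2 * √L ≤ |D.stdDiff i ω|} := by
    intro ω hω
    simp only [Set.mem_ofPred_eq, Set.mem_union] at hω ⊢
    by_contra hcon
    simp only [not_or, not_lt, not_le] at hcon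
    obtain ⟨⟨⟨g0, g1⟩, g2, g3⟩, g4⟩ := hcon
    obtain ⟨R, hT, hR, hR2⟩ := h.exists_tStat_eq hN2 v i hv ω
    -- Only positivity of R matters here: at R = 0 the statistic would be 0 by convention.
    have hR0 : 1 - 1 / 2 ≤ R := hR _ (by norm_num) (fun j => by fin_cases j; exacts [g0, g1])
    have hRu : R ≤ (1 + ε) * (1 + ε) := hR2 _ _ (by linarith) (by linarith)
      (fun j => by fin_cases j; exacts [g2, g3]) hn
    have hRpos : 0 < √R := Real.sqrt_pos.2 (by linarith)
    have hsq : √R ≤ 1 + ε := Real.sqrt_le_iff.2 ⟨by linarith, by nlinarith⟩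
    rw [hT, abs_div, abs_of_nonneg (Real.sqrt_nonneg R), div_le_iff₀ hRpos] at hω
    have h1 : |(D.mean 0 i - D.mean 1 i) / D.diffSD i| ≤
        |D.stdDiff i ω + (D.mean 0 i - D.mean 1 i) / D.diffSD i| + |D.stdDiff i ω| := by
      have := abs_sub (D.stdDiff i ω + (D.mean 0 i - D.mean 1 i) / D.diffSD i) (D.stdDiff i ω)
      simpa using this
    have h2 : τ * √L * √R ≤ τ * √L * (1 + ε) := by gcongr
    have h3 : τ * √L * (1 + ε) = (θ + τ) / 2 * √L := by rw [← hετ]; ring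
    rw [hdel] at h1
    linarith
  have hch := h.stdDiff_tail (by linarith) ht hK i
    (r := (θ - τ) / 2 * √L) (mul_pos (by linarith) hsL)
  have heq : 1 / ((θ - τ) / 2 * √L) ^ 2 = 4 / (θ - τ) ^ 2 * L⁻¹ := by
    have : θ - τ ≠ 0 := by linarith
    rw [mul_pow, Real.sq_sqrt hL0.le]
    field_simp
    norm_num
  rw [heq] at hch
  have hV : ∀ j, P.real {ω | 1 + ε < D.relVar j i ω} ≤ 24 / t ^ 4 * K / (c * ε ^ 2) * L⁻¹ := by
    intro j
    refine (h.relVar_upper_tail (by linarith) ht hK j i hε).trans ?_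
    calc _ ≤ 24 / t ^ 4 * K / (c * L * ε ^ 2) := by gcongr
      _ = _ := by field_simp
  have hLρ : 6 * Real.exp (-L) + 2 * (24 / t ^ 4 * K / (c * ε ^ 2)) * L⁻¹ +
      4 / (θ - τ) ^ 2 * L⁻¹ < ρ := hLρ
  calc _ ≤ _ := (measureReal_mono hsub).trans (measureReal_union_le _ _)
    _ ≤ _ := add_le_add (measureReal_union_le _ _) hch
    _ ≤ _ := add_le_add_left (add_le_add (measureReal_union_le _ _) (measureReal_union_le _ _)) _
    _ ≤ _ := by linarith [hU D h 0 i, hU D h 1 i, hV 0, hV 1]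

/-! ### Combinatorics of the Benjamini–Hochberg rule -/

theorem orderStat_monotone {m : ℕ} (p : Fin m → ℝ) : Monotone (orderStat p) :=
  Tuple.monotone_sort p

open Classical in
theorem succ_le_card_le_orderStat {m : ℕ} (p : Fin m → ℝ) (k : Fin m) :
    (k : ℕ) + 1 ≤ (Finset.univ.filter fun i => p i ≤ orderStat p k).card := by
  rw [← Fin.card_Iic k, ← Finset.card_image_of_injective (Finset.Iic k) (Tuple.sort p).injective]
  refine Finset.card_le_card fun i hi => ?_
  obtain ⟨l, hl, rfl⟩ := Finset.mem_image.1 hi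
  simp only [Finset.mem_filter, Finset.mem_univ, true_and]
  exact orderStat_monotone p (Finset.mem_Iic.1 hl)

open Classical in
-- Self-consistency of a cutoff x suffices for rejection. The last rank whose order statistic is at
-- most x equals #{p ≤ x}, hence is admissible, and the largest admissible rank lies at or beyond
-- it.
theorem mem_bhRejections_of_le {m : ℕ} {α x : ℝ} {p : Fin m → ℝ}
    (hx : x ≤ α * (Finset.univ.filter fun i => p i ≤ x).card / m) {i : Fin m} (hi : p i ≤ x) :
    i ∈ bhRejections α p := by
  set S : Finset (Fin m) := Finset.univ.filter fun l => orderStat p l ≤ x with hS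
  have hr : orderStat p ((Tuple.sort p).symm i) = p i := by simp [orderStat]
  have hmem : (Tuple.sort p).symm i ∈ S := by simp [hS, hr, hi]
  have hne : S.Nonempty := ⟨_, hmem⟩
  set k₁ := S.max' hne with hk₁
  have hk₁S : orderStat p k₁ ≤ x := (Finset.mem_filter.1 (S.max'_mem hne)).2
  have hcard : (Finset.univ.filter fun i => p i ≤ x).card = (k₁ : ℕ) + 1 := by
    have h1 : (Finset.univ.filter fun i => p i ≤ x) = S.image (Tuple.sort p) := by
      ext j
      simp only [Finset.mem_filter, Finset.mem_univ, true_and, Finset.mem_image, hS]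
      refine ⟨fun h => ⟨(Tuple.sort p).symm j, by simpa [orderStat] using h, by simp⟩, ?_⟩
      rintro ⟨l, hl, rfl⟩
      exact hl
    have h2 : S = Finset.Iic k₁ := by
      ext l
      rw [Finset.mem_Iic]
      refine ⟨fun h => S.le_max' l h, fun h => ?_⟩
      rw [hS, Finset.mem_filter]
      exact ⟨Finset.mem_univ _, (orderStat_monotone p h).trans hk₁S⟩
    rw [h1, Finset.card_image_of_injective _ (Tuple.sort p).injective, h2, Fin.card_Iic]
  rw [hcard] at hx
  have hk₁B : k₁ ∈ Finset.univ.filter fun l : Fin m => orderStat p l ≤ α * ((l : ℝ) + 1) / m := by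
    rw [Finset.mem_filter]
    refine ⟨Finset.mem_univ _, hk₁S.trans ?_⟩
    exact_mod_cast hx
  set B := Finset.univ.filter fun l : Fin m => orderStat p l ≤ α * ((l : ℝ) + 1) / m with hB
  refine ⟨B.max' ⟨_, hk₁B⟩, ⟨?_, fun l hl => ?_⟩, ?_⟩
  · exact (Finset.mem_filter.1 (B.max'_mem ⟨_, hk₁B⟩)).2
  · exact B.le_max' l (Finset.mem_filter.2 ⟨Finset.mem_univ _, hl⟩)
  · rw [← hr]
    exact orderStat_monotone p ((S.le_max' _ hmem).trans (B.le_max' _ hk₁B))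

open Classical in
-- Replaces the random order statistic by the grid cutoff αk/m, at which the count of p-values can
-- be compared with k directly.
theorem exists_count_of_mem_bhRejections {m : ℕ} {α : ℝ} {p : Fin m → ℝ} {i : Fin m}
    (hi : i ∈ bhRejections α p) :
    ∃ k : ℕ, 1 ≤ k ∧ k ≤ m ∧ p i ≤ α * k / m ∧
      k ≤ (Finset.univ.filter fun l => p l ≤ α * k / m).card := by
  obtain ⟨k, hk, hik⟩ := hi
  have hk1 : orderStat p k ≤ α * ((k : ℝ) + 1) / m := hk.1
  refine ⟨k + 1, by omega, k.2, ?_, (succ_le_card_le_orderStat p k).trans ?_⟩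
  · push_cast; exact hik.trans hk1
  · refine Finset.card_le_card fun l hl => ?_
    simp only [Finset.mem_filter, Finset.mem_univ, true_and] at hl ⊢
    push_cast
    exact hl.trans hk1

/-! ### Counting exceedances; transfer of independence to the t statistics -/

open Classical in
-- Chebyshev's inequality. For each i at most K indices l have nonzero covariance with i, and each
-- such covariance is at most P(A_i) ≤ b.
theorem prob_count_ge_le {Ω ι : Type*} [MeasurableSpace Ω] {P : Measure Ω} [IsProbabilityMeasure P]
    (s : Finset ι) {A : ι → Set Ω} (hA : ∀ i ∈ s, MeasurableSet (A i)) {K b r : ℝ}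
    (hr : 0 < r) (hb : ∀ i ∈ s, P.real (A i) ≤ b)
    (hdep : ∀ i ∈ s, ∃ M ⊆ s, (s.card : ℝ) - K ≤ M.card ∧
      ∀ l ∈ M, P.real (A i ∩ A l) = P.real (A i) * P.real (A l)) :
    P.real {ω | s.card * b + r ≤ (s.filter fun i => ω ∈ A i).card} ≤ K * (s.card * b) / r ^ 2 := by
  set Y : ι → Ω → ℝ := fun i => (A i).indicator fun _ => 1 with hY
  have hmem : ∀ i ∈ s, MemLp (Y i) 2 P := fun i hi =>
    (memLp_const (1 : ℝ)).indicator (hA i hi)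
  have hint : ∀ i ∈ s, ∫ ω, Y i ω ∂P = P.real (A i) := fun i hi =>
    integral_indicator_one (hA i hi)
  have hcov : ∀ i ∈ s, ∀ l ∈ s, covariance (Y i) (Y l) P =
      P.real (A i ∩ A l) - P.real (A i) * P.real (A l) := by
    intro i hi l hl
    rw [covariance_eq_sub (hmem i hi) (hmem l hl), hint i hi, hint l hl]
    have : Y i * Y l = (A i ∩ A l).indicator fun _ => 1 := by
      rw [hY]
      ext ω
      by_cases h1 : ω ∈ A i <;> by_cases h2 : ω ∈ A l <;> simp [h1, h2]
    rw [this]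
    congr 1
    exact integral_indicator_one ((hA i hi).inter (hA l hl))
  have hvar : variance (∑ i ∈ s, Y i) P ≤ K * (s.card * b) := by
    rw [variance_sum' hmem]
    have hin : ∀ i ∈ s, ∑ l ∈ s, covariance (Y i) (Y l) P ≤ K * b := by
      intro i hi
      obtain ⟨M, hM, hcard, hprod⟩ := hdep i hi
      rw [← Finset.sum_sdiff hM, Finset.sum_eq_zero (s := M), add_zero]
      · have hb0 : 0 ≤ b := measureReal_nonneg.trans (hb i hi)
        calc _ ≤ ∑ l ∈ s \ M, b := by
              refine Finset.sum_le_sum fun l hl => ?_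
              rw [hcov i hi l (Finset.mem_sdiff.1 hl).1]
              have h1 : P.real (A i ∩ A l) ≤ P.real (A i) := measureReal_mono Set.inter_subset_left
              have h2 : 0 ≤ P.real (A i) * P.real (A l) := by positivity
              linarith [hb i hi]
          _ = ((s \ M).card : ℝ) * b := by simp
          _ ≤ K * b := by
              gcongr
              rw [Finset.cast_card_sdiff hM]
              linarith
      · intro l hl
        rw [hcov i hi l (hM hl), hprod l hl, sub_self]
    calc _ ≤ ∑ i ∈ s, K * b := Finset.sum_le_sum hin
      _ = _ := by simp; ring
  have hmean : ∫ ω, (∑ i ∈ s, Y i) ω ∂P ≤ s.card * b := by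
    simp only [Finset.sum_apply]
    rw [integral_finsetSum _ fun i hi => (hmem i hi).integrable one_le_two]
    calc _ ≤ ∑ i ∈ s, b := Finset.sum_le_sum fun i hi => (hint i hi).trans_le (hb i hi)
      _ = _ := by simp
  have h := meas_ge_le_variance_div_sq (memLp_finsetSum' s hmem) hr
  have hsub : {ω | s.card * b + r ≤ (s.filter fun i => ω ∈ A i).card} ⊆
      {ω | r ≤ |(∑ i ∈ s, Y i) ω - ∫ ω, (∑ i ∈ s, Y i) ω ∂P|} := by
    intro ω hω
    simp only [Set.mem_ofPred_eq] at hω ⊢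
    have : (∑ i ∈ s, Y i) ω = ((s.filter fun i => ω ∈ A i).card : ℝ) := by
      simp [hY, Finset.sum_apply, Set.indicator_apply]
    rw [this]
    refine le_trans ?_ (le_abs_self _)
    linarith
  refine (measureReal_mono hsub).trans ?_
  rw [measureReal_def]
  refine ENNReal.toReal_le_of_le_ofReal ?_ (h.trans (ENNReal.ofReal_le_ofReal (by gcongr)))
  have : 0 ≤ K * (s.card * b) := (variance_nonneg _ _).trans hvar
  positivity

/-- The joint law is a product over q of products of two marginals; regrouping the coordinates turns
it into the product of the two path laws. -/
theorem indepFun_pi_of_iIndepFun {Ω κ : Type*} [MeasurableSpace Ω] [Fintype κ] {P : Measure Ω}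
    [IsProbabilityMeasure P] {U V : κ → Ω → ℝ} (hU : ∀ q, Measurable (U q))
    (hV : ∀ q, Measurable (V q)) (h : iIndepFun (fun q ω => (U q ω, V q ω)) P)
    (hUV : ∀ q, IndepFun (U q) (V q) P) :
    IndepFun (fun ω q => U q ω) (fun ω q => V q ω) P := by
  have hUi : iIndepFun U P := h.comp (fun _ x => x.1) fun _ => measurable_fst
  have hVi : iIndepFun V P := h.comp (fun _ x => x.2) fun _ => measurable_snd
  have hpu : ∀ q, IsProbabilityMeasure (P.map (U q)) := fun q =>
    Measure.isProbabilityMeasure_map (hU q).aemeasurable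
  have hpv : ∀ q, IsProbabilityMeasure (P.map (V q)) := fun q =>
    Measure.isProbabilityMeasure_map (hV q).aemeasurable
  rw [indepFun_iff_map_prod_eq_prod_map_map (by fun_prop) (by fun_prop),
    (iIndepFun_iff_map_fun_eq_pi_map fun q => (hU q).aemeasurable).1 hUi,
    (iIndepFun_iff_map_fun_eq_pi_map fun q => (hV q).aemeasurable).1 hVi]
  have hmp := measurePreserving_arrowProdEquivProdArrow ℝ ℝ κ (fun q => P.map (U q))
    (fun q => P.map (V q))
  rw [← hmp.map_eq]
  have hj := (iIndepFun_iff_map_fun_eq_pi_map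
    fun q => ((hU q).prodMk (hV q)).aemeasurable).1 h
  have hq : ∀ q, P.map (fun ω => (U q ω, V q ω)) = (P.map (U q)).prod (P.map (V q)) := fun q =>
    (indepFun_iff_map_prod_eq_prod_map_map (hU q).aemeasurable (hV q).aemeasurable).1 (hUV q)
  simp_rw [hq] at hj
  rw [← hj, Measure.map_map (MeasurableEquiv.measurable _) (by fun_prop)]
  rfl

theorem indepFun_map_iff_comp {Ω Ω' : Type*} [MeasurableSpace Ω] [MeasurableSpace Ω']
    {P : Measure Ω} [IsFiniteMeasure P] {Z : Ω → Ω'} (hZ : Measurable Z) {U V : Ω' → ℝ}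
    (hU : Measurable U) (hV : Measurable V) :
    IndepFun U V (P.map Z) ↔ IndepFun (fun ω => U (Z ω)) (fun ω => V (Z ω)) P := by
  rw [indepFun_iff_map_prod_eq_prod_map_map hU.aemeasurable hV.aemeasurable,
    indepFun_iff_map_prod_eq_prod_map_map (by fun_prop) (by fun_prop),
    Measure.map_map (by fun_prop) hZ, Measure.map_map hU hZ, Measure.map_map hV hZ]
  rfl

namespace TwoSample

variable {m : ℕ} {Ω : Type*} [MeasurableSpace Ω] {P : Measure Ω} (D : TwoSample m P)

/-- The `t` statistic as a function of the values of one coordinate. -/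
def tOfData : VarianceCase → ((Σ j : Fin 2, Fin (D.n j)) → ℝ) → ℝ
  | v, x =>
    let mean : Fin 2 → ℝ := fun j => (1 / (D.n j : ℝ)) * ∑ k, x ⟨j, k⟩
    let ss : Fin 2 → ℝ := fun j => ∑ k, (x ⟨j, k⟩ - mean j) ^ 2
    match v with
    | .equal => √((D.n 0 * D.n 1 : ℝ) / ((D.n 0 + D.n 1 : ℝ) *
        ((1 / ((D.n 0 : ℝ) + D.n 1 - 2)) * (ss 0 + ss 1)))) * (mean 0 - mean 1)
    | .unequal => (mean 0 - mean 1) /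
        √((1 / ((D.n 0 : ℝ) - 1)) * ss 0 / D.n 0 + (1 / ((D.n 1 : ℝ) - 1)) * ss 1 / D.n 1)

theorem measurable_tOfData (v : VarianceCase) : Measurable (D.tOfData v) := by
  cases v <;> unfold tOfData <;> fun_prop

theorem tStat_eq_tOfData (v : VarianceCase) (i : Fin m) (ω : Ω) :
    D.tStat v i ω = D.tOfData v fun q => D.X q.1 q.2 ω i := by
  cases v <;> rfl

/-- Independence of coordinates i and l in the populations gives it for each single observation,
then, as observations are independent, for the two complete data columns, of which the statistics
are functions. -/
theorem indepFun_tStat [IsProbabilityMeasure P] (hX : ∀ j k, Measurable (D.X j k))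
    (v : VarianceCase) {i l : Fin m}
    (h : IndepFun (fun x : (Fin m → ℝ) × (Fin m → ℝ) => (x.1 l, x.2 l))
      (fun x => (x.1 i, x.2 i)) ((D.pop 0).prod (D.pop 1))) :
    IndepFun (D.tStat v i) (D.tStat v l) P := by
  have hp := D.isProbabilityMeasure_pop
  have hpop : ∀ j, IndepFun (fun x : Fin m → ℝ => x i) (fun x => x l) (D.pop j) := by
    intro j
    fin_cases j
    · have h1 := h.comp measurable_fst measurable_fst
      have e : (D.pop 0) = ((D.pop 0).prod (D.pop 1)).map Prod.fst := by
        rw [Measure.map_fst_prod]; simp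
      change IndepFun _ _ (D.pop 0)
      rw [e, indepFun_map_iff_comp (by fun_prop) (measurable_pi_apply i) (measurable_pi_apply l)]
      exact h1.symm
    · have h1 := h.comp measurable_snd measurable_snd
      have e : (D.pop 1) = ((D.pop 0).prod (D.pop 1)).map Prod.snd := by
        rw [Measure.map_snd_prod]; simp
      change IndepFun _ _ (D.pop 1)
      rw [e, indepFun_map_iff_comp (by fun_prop) (measurable_pi_apply i) (measurable_pi_apply l)]
      exact h1.symm
  have hmeas : ∀ (q : Σ j : Fin 2, Fin (D.n j)) (i : Fin m), Measurable fun ω => D.X q.1 q.2 ω i :=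
    fun q i => (measurable_pi_apply i).comp (hX q.1 q.2)
  have hpair : ∀ q : Σ j : Fin 2, Fin (D.n j),
      IndepFun (fun ω => D.X q.1 q.2 ω i) (fun ω => D.X q.1 q.2 ω l) P := by
    intro q
    have h1 := hpop q.1
    rwa [← (D.hasLaw q.1 q.2).map_eq, indepFun_map_iff_comp (hX _ _) (measurable_pi_apply i)
      (measurable_pi_apply l)] at h1
  have hfam : iIndepFun (fun (q : Σ j : Fin 2, Fin (D.n j)) ω =>
      (D.X q.1 q.2 ω i, D.X q.1 q.2 ω l)) P :=
    D.indep.comp (fun _ x => (x i, x l)) fun _ => by fun_prop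
  have hind := indepFun_pi_of_iIndepFun (fun q => hmeas q i) (fun q => hmeas q l) hfam hpair
  have := hind.comp (D.measurable_tOfData v) (D.measurable_tOfData v)
  refine this.congr (ae_of_all _ fun ω => ?_) (ae_of_all _ fun ω => ?_)
  · exact (D.tStat_eq_tOfData v i ω).symm
  · exact (D.tStat_eq_tOfData v l ω).symm

end TwoSample

open Classical in
-- Uses first moments only, so the signals may depend on each other arbitrarily.
theorem prob_count_ge_le_markov {Ω ι : Type*} [MeasurableSpace Ω] {P : Measure Ω}
    [IsProbabilityMeasure P] {s : Finset ι} (hs : s.Nonempty) {A : ι → Set Ω}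
    (hA : ∀ i ∈ s, MeasurableSet (A i)) {ε ρ : ℝ} (hε : 0 < ε) (hρ : ∀ i ∈ s, P.real (A i) ≤ ρ) :
    P.real {ω | ε * s.card ≤ (s.filter fun i => ω ∈ A i).card} ≤ ρ / ε := by
  have hcard : 0 < (s.card : ℝ) := by exact_mod_cast hs.card_pos
  set Y : Ω → ℝ := fun ω => ∑ i ∈ s, (A i).indicator (fun _ => (1 : ℝ)) ω with hY
  have hint : ∀ i ∈ s, Integrable ((A i).indicator fun _ => (1 : ℝ)) P := fun i hi =>
    (integrable_const 1).indicator (hA i hi)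
  have hmean : ∫ ω, Y ω ∂P ≤ s.card * ρ := by
    rw [hY, integral_finsetSum _ hint]
    calc _ ≤ ∑ i ∈ s, ρ := Finset.sum_le_sum fun i hi =>
          (integral_indicator_one (hA i hi)).trans_le (hρ i hi)
      _ = _ := by simp
  have h := mul_meas_ge_le_integral_of_nonneg (μ := P) (f := Y)
    (ae_of_all _ fun ω => Finset.sum_nonneg fun i _ => Set.indicator_nonneg (by simp) _)
    (integrable_finsetSum _ hint) (ε * s.card)
  have hset : {ω | ε * (s.card : ℝ) ≤ (s.filter fun i => ω ∈ A i).card} =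
      {ω | ε * s.card ≤ Y ω} := by
    ext ω
    simp [hY, Set.indicator_apply]
  rw [hset, le_div_iff₀ hε]
  have h2 := h.trans hmean
  have : s.card * (P.real {ω | ε * s.card ≤ Y ω} * ε) ≤ s.card * ρ := by linarith
  exact le_of_mul_le_mul_left this hcard

/-- A union bound over the geometric grid u₀(1+δ)^l, where the failure probabilities C/u form a
geometric series with sum free of the number of grid points. Monotonicity in u fills the gaps at the
price of one factor 1+δ. -/
theorem exists_uniform_count_bound {Ω : Type*} [MeasurableSpace Ω] {P : Measure Ω}
    [IsProbabilityMeasure P] {N : ℝ → Ω → ℝ} (hN : ∀ ω, Monotone fun u => N u ω) {a C δ u₀ : ℝ}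
    (ha : 0 < a) (hC : 0 ≤ C) (hδ : 0 < δ) (hu₀ : 0 < u₀)
    (h : ∀ u, u₀ ≤ u → P.real {ω | a * u ≤ N u ω} ≤ C / u) :
    ∃ B : Set Ω, P.real B ≤ C / u₀ * ((1 + δ) / δ) ∧
      ∀ ω ∉ B, ∀ u, u₀ ≤ u → u ≤ 1 → N u ω < a * ((1 + δ) * u) := by
  obtain ⟨J, hJ⟩ := pow_unbounded_of_one_lt (1 / u₀) (show 1 < 1 + δ by linarith)
  set g : ℕ → ℝ := fun l => u₀ * (1 + δ) ^ l with hg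
  have hg0 : ∀ l, u₀ ≤ g l := fun l =>
    le_mul_of_one_le_right hu₀.le (one_le_pow₀ (by linarith))
  refine ⟨⋃ l ∈ Finset.range (J + 1), {ω | a * g l ≤ N (g l) ω}, ?_, fun ω hω u hu hu1 => ?_⟩
  · calc _ ≤ ∑ l ∈ Finset.range (J + 1), P.real {ω | a * g l ≤ N (g l) ω} :=
          measureReal_biUnion_finset_le _ _
      _ ≤ ∑ l ∈ Finset.range (J + 1), C / u₀ * ((1 + δ)⁻¹) ^ l := by
          refine Finset.sum_le_sum fun l _ => (h _ (hg0 l)).trans (le_of_eq ?_)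
          rw [hg, inv_pow]; field_simp
      _ ≤ C / u₀ * ((1 + δ) / δ) := by
          rw [← Finset.mul_sum]
          have hr0 : 0 ≤ (1 + δ)⁻¹ := by positivity
          have hr1 : (1 + δ)⁻¹ < 1 := inv_lt_one_of_one_lt₀ (by linarith)
          have hsum := (summable_geometric_of_lt_one hr0 hr1).sum_le_tsum
            (Finset.range (J + 1)) (fun l _ => by positivity)
          rw [tsum_geometric_of_lt_one hr0 hr1] at hsum
          have e : (1 - (1 + δ)⁻¹)⁻¹ = (1 + δ) / δ := by
            have : 1 - (1 + δ)⁻¹ = δ / (1 + δ) := by field_simp; ring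
            rw [this, inv_div]
          rw [e] at hsum
          gcongr
  · obtain ⟨n, hn1, hn2⟩ := exists_nat_pow_near (show 1 ≤ u / u₀ by rwa [one_le_div hu₀])
      (show 1 < 1 + δ by linarith)
    have hnJ : n < J := by
      by_contra hcon
      have h1 : (1 + δ) ^ J ≤ (1 + δ) ^ n := pow_le_pow_right₀ (by linarith) (by omega)
      have h2 : u / u₀ ≤ 1 / u₀ := by gcongr
      linarith
    have hl : u ≤ g (n + 1) := by
      rw [div_lt_iff₀ hu₀] at hn2
      rw [hg]; linarith
    have hl2 : g (n + 1) ≤ (1 + δ) * u := by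
      rw [le_div_iff₀ hu₀] at hn1
      rw [hg]
      simp only [pow_succ]
      nlinarith
    have hnot : ¬ a * g (n + 1) ≤ N (g (n + 1)) ω := fun hcon => hω (by
      simp only [Set.mem_iUnion]
      exact ⟨n + 1, Finset.mem_range.2 (by omega), hcon⟩)
    calc N u ω ≤ N (g (n + 1)) ω := hN ω hl
      _ < a * g (n + 1) := not_le.1 hnot
      _ ≤ _ := by gcongr

/-! ### The Student tail on the logarithmic scale -/

/-- The corrections t²/(2ν) and t⁴/(4ν) are O(L²/L⁵), negligible against the gap (s-s')L. -/
theorem eventually_studentTail_le {s s' c : ℝ} (hs' : 0 ≤ s') (hs : s' < s) (hc : 0 < c) :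
    ∀ᶠ L : ℝ in atTop, ∀ ν, c * L ^ 5 ≤ ν → studentTail ν √(2 * s * L) ≤ Real.exp (-s' * L) := by
  have hs0 : 0 < s := hs'.trans_lt hs
  have hd : 0 < s - s' := by linarith
  filter_upwards [eventually_ge_atTop (1 : ℝ), eventually_ge_atTop (2 / c),
    eventually_ge_atTop (2 / s), eventually_ge_atTop ((s + s ^ 2) / (c * (s - s')))]
    with L h1 h2 h3 h4 ν hν
  have hL0 : 0 < L := by linarith
  rw [div_le_iff₀ (by positivity)] at h2 h3 h4
  have hp : ∀ k, 1 ≤ L ^ k := fun k => one_le_pow₀ h1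
  have hν1 : c * L ≤ ν := le_trans (by gcongr; exact le_self_pow₀ h1 (by norm_num)) hν
  have hν2 : 2 ≤ ν := by linarith
  set t := √(2 * s * L) with ht
  have ht2 : t ^ 2 = 2 * s * L := Real.sq_sqrt (by positivity)
  have ht0 : 0 < t := Real.sqrt_pos.2 (by positivity)
  have ht1 : 2 / t ≤ 1 := by
    rw [div_le_one ht0]
    exact abs_le_of_sq_le_sq' (by nlinarith) ht0.le |>.2
  refine (studentTail_le hν2 ht0).trans ?_
  have hν0 : 0 < ν := by linarith
  have hexp : -t ^ 2 / 2 + t ^ 2 / (2 * ν) + t ^ 4 / (4 * ν) ≤ -s' * L := by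
    have e1 : t ^ 4 = (2 * s * L) ^ 2 := by rw [← ht2]; ring
    rw [e1, ht2]
    have h5 : s * L / ν + s ^ 2 * L ^ 2 / ν ≤ (s - s') * L := by
      rw [← add_div, div_le_iff₀ hν0]
      calc s * L + s ^ 2 * L ^ 2 ≤ s * L ^ 2 + s ^ 2 * L ^ 2 := by
            gcongr; exact le_self_pow₀ h1 (by norm_num)
        _ = (s + s ^ 2) * L ^ 2 := by ring
        _ ≤ L * (c * (s - s')) * L ^ 2 := by gcongr
        _ = (s - s') * L * (c * L ^ 2) := by ring
        _ ≤ (s - s') * L * (c * L ^ 5) := by gcongr; linarith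
        _ ≤ _ := by gcongr
    have e2 : 2 * s * L / (2 * ν) + (2 * s * L) ^ 2 / (4 * ν) = s * L / ν + s ^ 2 * L ^ 2 / ν := by
      field_simp; ring
    linarith
  calc _ ≤ 1 * Real.exp (-s' * L) := by gcongr
    _ = _ := one_mul _

/-- Comparison with the Gaussian tail loses a constant and a polynomial factor, both absorbed by
exp((s'-s)L). -/
theorem eventually_le_studentTail {s s' c : ℝ} (hs : 0 < s) (hs' : s < s') (hc : 0 < c) :
    ∀ᶠ L : ℝ in atTop, ∀ ν, c * L ^ 5 ≤ ν → Real.exp (-s' * L) ≤ studentTail ν √(2 * s * L) := by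
  obtain ⟨δ, hδ, hST⟩ := exists_gaussTail_le_studentTail one_pos
  have hpi : 0 < √(2 * Real.pi) := by have := Real.pi_pos; positivity
  have hd : 0 < s' - s := by linarith
  -- exponential growth beats the polynomial prefactor
  have hgrow : ∀ᶠ L : ℝ in atTop,
      Real.exp (3 / 2) * √(2 * Real.pi) * (2 + 2 * s * L) ≤ Real.exp ((s' - s) * L) := by
    have h1 : Tendsto (fun L : ℝ => (s' - s) * L) atTop atTop :=
      tendsto_id.const_mul_atTop hd
    have h2 := (Real.tendsto_exp_div_pow_atTop 2).comp h1
    filter_upwards [h2.eventually_ge_atTop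
      (Real.exp (3 / 2) * √(2 * Real.pi) * (2 + 2 * s) / (s' - s) ^ 2),
      eventually_ge_atTop (1 : ℝ)] with L h3 h4
    simp only [Function.comp] at h3
    rw [div_le_div_iff₀ (by positivity) (by positivity)] at h3
    have h5 : Real.exp (3 / 2) * √(2 * Real.pi) * (2 + 2 * s) * L ^ 2 ≤ Real.exp ((s' - s) * L) := by
      refine le_of_mul_le_mul_right ?_ (show 0 < (s' - s) ^ 2 by positivity)
      calc _ = Real.exp (3 / 2) * √(2 * Real.pi) * (2 + 2 * s) * ((s' - s) * L) ^ 2 := by ring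
        _ ≤ _ := h3
    refine le_trans ?_ h5
    rw [mul_assoc (Real.exp (3 / 2) * √(2 * Real.pi))]
    gcongr
    have : 1 ≤ L ^ 2 := one_le_pow₀ h4
    have : L ≤ L ^ 2 := le_self_pow₀ h4 (by norm_num)
    nlinarith
  filter_upwards [eventually_ge_atTop (1 : ℝ), eventually_ge_atTop (2 / c), hgrow,
    eventually_ge_atTop ((2 + 4 * s) / (δ * c))] with L h1 h2 h3 h4 ν hν
  have hL0 : 0 < L := by linarith
  rw [div_le_iff₀ (by positivity)] at h2 h4
  have hν1 : c * L ≤ ν := le_trans (by gcongr; exact le_self_pow₀ h1 (by norm_num)) hν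
  have hν2 : 2 ≤ ν := by linarith
  set t := √(2 * s * L) with ht
  have ht2 : t ^ 2 = 2 * s * L := Real.sq_sqrt (by positivity)
  have ht0 : 0 ≤ t := Real.sqrt_nonneg _
  have hcond : (1 + t) ^ 2 ≤ δ * ν := by
    calc (1 + t) ^ 2 ≤ 2 + 2 * t ^ 2 := by nlinarith [sq_nonneg (t - 1)]
      _ = 2 + 4 * s * L := by rw [ht2]; ring
      _ ≤ (2 + 4 * s) * L := by nlinarith
      _ ≤ L * (δ * c) * L := by gcongr
      _ = δ * (c * L ^ 2) := by ring
      _ ≤ δ * (c * L ^ 5) := by gcongr; linarith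
      _ ≤ _ := by gcongr
  have hq := hST ν t hν2 ht0 hcond
  have hg := le_gaussTail ht0
  have ht1 : 1 + t ≤ 2 + 2 * s * L := by rw [← ht2]; nlinarith [sq_nonneg (t - 1)]
  have hmain : Real.exp (-s' * L) ≤ gaussTail t / √(2 * Real.pi) := by
    rw [le_div_iff₀ hpi]
    refine le_trans ?_ hg
    rw [ht2, mul_div_assoc', le_div_iff₀ (by positivity)]
    have e1 : Real.exp (-3 / 2) * Real.exp (-(2 * s * L) / 2) =
        Real.exp (-3 / 2) * Real.exp ((s' - s) * L) * Real.exp (-s' * L) := by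
      rw [show -(2 * s * L) / 2 = (s' - s) * L + -s' * L by ring, Real.exp_add, mul_assoc]
    rw [e1]
    have e2 : √(2 * Real.pi) * (1 + t) ≤ Real.exp (-3 / 2) * Real.exp ((s' - s) * L) := by
      calc √(2 * Real.pi) * (1 + t) ≤ √(2 * Real.pi) * (2 + 2 * s * L) := by gcongr
        _ = Real.exp (-3 / 2) * (Real.exp (3 / 2) * √(2 * Real.pi) * (2 + 2 * s * L)) := by
            rw [show (-3 / 2 : ℝ) = -(3 / 2) by ring, Real.exp_neg]; field_simp
        _ ≤ _ := by gcongr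
    nlinarith [Real.exp_pos (-s' * L)]
  linarith

theorem tendsto_measure_zero_of_eventually_le {Ω : ℕ → Type*} [∀ m, MeasurableSpace (Ω m)]
    {P : ∀ m, Measure (Ω m)} [∀ m, IsProbabilityMeasure (P m)] {S : ∀ m, Set (Ω m)}
    (h : ∀ ρ : ℝ, 0 < ρ → ∀ᶠ m in atTop, (P m).real (S m) ≤ ρ) :
    Tendsto (fun m => P m (S m)) atTop (𝓝 0) := by
  rw [ENNReal.tendsto_nhds_zero]
  intro e he
  rcases eq_or_ne e ⊤ with rfl | hne
  · exact Eventually.of_forall fun _ => le_top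
  filter_upwards [h e.toReal (ENNReal.toReal_pos he.ne' hne)] with m hm
  exact (ENNReal.toReal_le_toReal (measure_ne_top _ _) hne).1 hm

/-! ### Deterministic criteria for the power, and the number of small null p-values -/

namespace TwoSample

variable {m : ℕ} {Ω : Type*} [MeasurableSpace Ω] {P : Measure Ω} {D : TwoSample m P}

theorem pValue_eq_studentTail (v : VarianceCase) (ω : Ω) (i : Fin m) :
    D.pValue v ω i = studentTail ((D.n 0 : ℝ) + D.n 1 - 2) |D.tStat v i ω| := rfl

theorem powerBH_nonneg (v : VarianceCase) (α : ℝ) (ω : Ω) : 0 ≤ D.powerBH v α ω := by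
  unfold powerBH; positivity

open Classical in
theorem powerBH_le_one (v : VarianceCase) (α : ℝ) (ω : Ω) : D.powerBH v α ω ≤ 1 := by
  unfold powerBH
  exact div_le_one_of_le₀ (by exact_mod_cast Finset.card_filter_le _ _) (by positivity)

open Classical in
-- More than (1-ε) of the signals have p ≤ x, and by `hx` these alone make the cutoff x
-- self-consistent.
theorem abs_powerBH_sub_one_lt {v : VarianceCase} {α x ε : ℝ} {ω : Ω} (hα : 0 ≤ α)
    (hx : x ≤ α * ((1 - ε) * D.signals.card) / m)
    (hbad : ((D.signals.filter fun i => x < D.pValue v ω i).card : ℝ) < ε * D.signals.card) :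
    |D.powerBH v α ω - 1| < ε := by
  have hH : 0 < (D.signals.card : ℝ) := by
    rcases Nat.eq_zero_or_pos D.signals.card with h | h
    · rw [h] at hbad
      simp only [Nat.cast_zero, mul_zero] at hbad
      exact absurd hbad (not_lt.2 (by positivity))
    · exact_mod_cast h
  set G := D.signals.filter fun i => ¬ x < D.pValue v ω i with hG
  have hsplit : ((D.signals.filter fun i => x < D.pValue v ω i).card : ℝ) + G.card =
      D.signals.card := by
    exact_mod_cast Finset.card_filter_add_card_filter_not (s := D.signals)
      (fun i => x < D.pValue v ω i)
  have hGN : (G.card : ℝ) ≤ (Finset.univ.filter fun i => D.pValue v ω i ≤ x).card := by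
    refine Nat.cast_le.2 (Finset.card_le_card fun i hi => ?_)
    rw [hG, Finset.mem_filter] at hi
    simpa using hi.2
  have hsub : G ⊆ D.signals.filter fun i => i ∈ bhRejections α (D.pValue v ω) := by
    intro i hi
    rw [hG, Finset.mem_filter] at hi
    refine Finset.mem_filter.2 ⟨hi.1, mem_bhRejections_of_le (x := x) ?_ (not_lt.1 hi.2)⟩
    refine hx.trans ?_
    gcongr
    linarith
  have hle : (G.card : ℝ) / D.signals.card ≤ D.powerBH v α ω := by
    unfold powerBH
    gcongr
  have h1 : 1 - ε < (G.card : ℝ) / D.signals.card := by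
    rw [lt_div_iff₀ hH]; linarith
  have h2 := powerBH_le_one (D := D) v α ω
  rw [abs_lt]
  constructor <;> [linarith; skip]
  have hε : 0 < ε := by
    have : (0 : ℝ) ≤ (D.signals.filter fun i => x < D.pValue v ω i).card := by positivity
    exact pos_of_mul_pos_left (this.trans_lt hbad) hH.le
  linarith

open Classical in
-- A rejection with p ≥ u₀ yields a cutoff u = αk/m ≥ u₀ with at least k p-values below it. Nulls
-- account for fewer than (1+2δ)(1+δ)αk of them and signals for at most δmu₀ ≤ δk, so `hδα` gives k
-- < k.
theorem powerBH_lt {v : VarianceCase} {α u₀ ε δ : ℝ} {ω : Ω} (hα₀ : 0 < α) (hα₁ : α < 1)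
    (hδ : 0 < δ) (hδα : (1 + 2 * δ) * (1 + δ) * α + δ ≤ 1)
    (hbad : ((D.signals.filter fun i => D.pValue v ω i < u₀).card : ℝ) < ε * D.signals.card)
    (hnull : ∀ u, u₀ ≤ u → u ≤ 1 → ((D.nulls.filter fun i => D.pValue v ω i ≤ u).card : ℝ) <
      (1 + 2 * δ) * m * ((1 + δ) * u))
    (hsig : (D.signals.card : ℝ) ≤ δ * (m * u₀)) :
    D.powerBH v α ω < ε := by
  by_contra hcon
  rw [not_lt] at hcon
  have hH : 0 < (D.signals.card : ℝ) := by
    rcases Nat.eq_zero_or_pos D.signals.card with h | h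
    · rw [h] at hbad
      simp only [Nat.cast_zero, mul_zero] at hbad
      exact absurd hbad (not_lt.2 (by positivity))
    · exact_mod_cast h
  unfold powerBH at hcon
  rw [le_div_iff₀ hH] at hcon
  -- Signals with p < u₀ are too few to give power ε on their own.
  have hex : ∃ i, i ∈ bhRejections α (D.pValue v ω) ∧ u₀ ≤ D.pValue v ω i := by
    by_contra hno
    push Not at hno
    have : (D.signals.filter fun i => i ∈ bhRejections α (D.pValue v ω)) ⊆
        D.signals.filter fun i => D.pValue v ω i < u₀ := fun i hi => by
      rw [Finset.mem_filter] at hi ⊢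
      exact ⟨hi.1, hno i hi.2⟩
    have h1 : ((D.signals.filter fun i => i ∈ bhRejections α (D.pValue v ω)).card : ℝ) ≤
        (D.signals.filter fun i => D.pValue v ω i < u₀).card :=
      Nat.cast_le.2 (Finset.card_le_card this)
    linarith
  obtain ⟨i, hi, hiu⟩ := hex
  obtain ⟨k, hk1, hkm, hik, hcount⟩ := exists_count_of_mem_bhRejections hi
  have hk0 : 0 < (k : ℝ) := by exact_mod_cast hk1
  have hkm' : (k : ℝ) ≤ m := by exact_mod_cast hkm
  have hm0 : 0 < (m : ℝ) := hk0.trans_le hkm'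
  set u := α * k / m with hu
  have hmu : m * u = α * k := by rw [hu]; field_simp
  have hu1 : u ≤ 1 := by
    rw [hu, div_le_one hm0]; nlinarith
  have hu0 : u₀ ≤ u := hiu.trans hik
  have hn := hnull u hu0 hu1
  have hsplit : (Finset.univ.filter fun l => D.pValue v ω l ≤ u) ⊆
      (D.nulls.filter fun l => D.pValue v ω l ≤ u) ∪ D.signals := by
    intro l hl
    simp only [Finset.mem_filter, Finset.mem_univ, true_and, Finset.mem_union, nulls,
      signals] at hl ⊢
    tauto
  have hc : (k : ℝ) ≤ (D.nulls.filter fun l => D.pValue v ω l ≤ u).card + D.signals.card := by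
    exact_mod_cast hcount.trans ((Finset.card_le_card hsplit).trans (Finset.card_union_le _ _))
  have h1 : δ * (m * u₀) ≤ δ * (m * u) := by gcongr
  have h2 : δ * (α * k) ≤ δ * k := by
    gcongr
    nlinarith
  have h3 : (1 + 2 * δ) * m * ((1 + δ) * u) = (1 + 2 * δ) * (1 + δ) * α * k := by
    rw [show (1 + 2 * δ) * m * ((1 + δ) * u) = (1 + 2 * δ) * (1 + δ) * (m * u) by ring, hmu]; ring
  have h4 : ((1 + 2 * δ) * (1 + δ) * α + δ) * k ≤ 1 * k := by gcongr
  rw [hmu] at h1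
  linarith

open Classical in
theorem prob_null_count_ge_le [IsProbabilityMeasure P] {t K N L : ℝ} (h : D.Regular t K N)
    (hN : 2 ≤ N) {v : VarianceCase} {Kd δ u₀ : ℝ} (hδ : 0 < δ) (hKd : 0 < Kd) (hm : 0 < m)
    (hu₀ : 0 < u₀)
    (hdep : ∀ i ∈ D.nulls, ∃ M ⊆ D.nulls, (D.nulls.card : ℝ) - Kd ≤ M.card ∧
      IndepFun (fun (x : (Fin m → ℝ) × (Fin m → ℝ)) (l : M) => (x.1 l, x.2 l))
        (fun x : (Fin m → ℝ) × (Fin m → ℝ) => (x.1 i, x.2 i)) ((D.pop 0).prod (D.pop 1)))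
    (htail : ∀ i ∈ D.nulls, ∀ x, 0 ≤ x → x ≤ √(2 * L) → P.real {ω | x ≤ |D.tStat v i ω|} ≤
      (1 + δ / 2) * studentTail ((D.n 0 : ℝ) + D.n 1 - 2) x + 6 * Real.exp (-L))
    (hsmall : 6 * Real.exp (-L) ≤ δ / 2 * u₀)
    (hq : studentTail ((D.n 0 : ℝ) + D.n 1 - 2) √(2 * L) ≤ u₀) (u : ℝ) (hu : u₀ ≤ u) :
    P.real {ω | (1 + 2 * δ) * m * u ≤ (D.nulls.filter fun i => D.pValue v ω i ≤ u).card} ≤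
      Kd * (1 + δ) / (δ ^ 2 * m) / u := by
  have hm' : 0 < (m : ℝ) := by exact_mod_cast hm
  have hu0 : 0 < u := hu₀.trans_le hu
  have hcard : (D.nulls.card : ℝ) ≤ m := by
    exact_mod_cast (Finset.card_le_univ D.nulls).trans_eq (Fintype.card_fin m)
  rcases le_or_gt 1 u with hu1 | hu1
  · have : {ω | (1 + 2 * δ) * m * u ≤ (D.nulls.filter fun i => D.pValue v ω i ≤ u).card} = ∅ := by
      rw [Set.eq_empty_iff_forall_notMem]
      intro ω hω
      have h1 : (1 + 2 * δ) * m * u ≤ (D.nulls.filter fun i => D.pValue v ω i ≤ u).card := hω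
      have h2 : ((D.nulls.filter fun i => D.pValue v ω i ≤ u).card : ℝ) ≤ D.nulls.card :=
        Nat.cast_le.2 (Finset.card_filter_le _ _)
      have h3 : (1 + 2 * δ) * m ≤ (1 + 2 * δ) * m * u := le_mul_of_one_le_right (by positivity) hu1
      nlinarith
    rw [this, measureReal_empty]
    positivity
  have hν : 0 < (D.n 0 : ℝ) + D.n 1 - 2 := by linarith [h.le_size 0, h.le_size 1]
  -- The Student tail decreases continuously from 1 at 0 to at most u₀ at √(2L), so u is attained
  -- where `htail` applies.
  obtain ⟨x, ⟨hx0, hxL⟩, hxu⟩ := intermediate_value_Icc' (Real.sqrt_nonneg (2 * L))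
    (continuous_studentTail hν).continuousOn
    (show u ∈ Set.Icc _ _ from ⟨hq.trans hu, by rw [studentTail_zero hν]; exact hu1.le⟩)
  have hiff : ∀ ω i, D.pValue v ω i ≤ u ↔ ω ∈ {ω | x ≤ |D.tStat v i ω|} := by
    intro ω i
    rw [pValue_eq_studentTail, ← hxu, (studentTail_strictAnti hν).le_iff_ge]
    rfl
  simp_rw [hiff]
  have hA : ∀ i, MeasurableSet {ω | x ≤ |D.tStat v i ω|} := fun i =>
    measurableSet_le measurable_const (h.measurable_tStat v i).abs
  -- The additive error 6e^(-L) is at most δu/2; the other δ in the factor 1+2δ is room for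
  -- Chebyshev.
  have hb : ∀ i ∈ D.nulls, P.real {ω | x ≤ |D.tStat v i ω|} ≤ (1 + δ) * u := by
    intro i hi
    refine (htail i hi x hx0 hxL).trans ?_
    rw [hxu]
    nlinarith
  have hcnt := prob_count_ge_le D.nulls (A := fun i => {ω | x ≤ |D.tStat v i ω|})
    (fun i _ => hA i) (r := δ * m * u) (by positivity) hb (K := Kd) (by
      intro i hi
      obtain ⟨M, hM, hMc, hind⟩ := hdep i hi
      refine ⟨M, hM, hMc, fun l hl => ?_⟩
      have hφ : Measurable fun f : M → ℝ × ℝ => f ⟨l, hl⟩ := measurable_pi_apply _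
      have h1 := hind.comp hφ measurable_id
      have h2 := D.indepFun_tStat h.measurable v (i := i) (l := l) h1
      have h3 := h2.measure_inter_preimage_eq_mul {y | x ≤ |y|} {y | x ≤ |y|}
        (measurableSet_le measurable_const measurable_id.abs)
        (measurableSet_le measurable_const measurable_id.abs)
      simp only [measureReal_def]
      rw [← ENNReal.toReal_mul]
      exact congrArg ENNReal.toReal h3)
  refine le_trans (measureReal_mono fun ω hω => ?_) (hcnt.trans ?_)
  · simp only [Set.mem_ofPred_eq] at hω ⊢
    refine le_trans ?_ hω
    calc _ ≤ m * ((1 + δ) * u) + δ * m * u := by gcongr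
      _ = _ := by ring
  · calc _ ≤ Kd * (m * ((1 + δ) * u)) / (δ * m * u) ^ 2 := by gcongr
      _ = _ := by field_simp

end TwoSample

/-! ### The two regimes as the dimension grows -/

section Asymptotics

variable {Ω : ℕ → Type*} [∀ m, MeasurableSpace (Ω m)] {P : ∀ m, Measure (Ω m)}

theorem tendsto_log_natCast_atTop : Tendsto (fun m : ℕ => Real.log m) atTop atTop :=
  Real.tendsto_log_atTop.comp tendsto_natCast_atTop_atTop

theorem MomentCondition.exists_regular {D : ∀ m, TwoSample m (P m)} (h : MomentCondition D)
    (hX : ∀ m j k, Measurable ((D m).X j k)) :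
    ∃ t K c : ℝ, 0 < t ∧ 0 < K ∧ 0 < c ∧
      ∀ᶠ m in atTop, (D m).Regular t K (c * Real.log m ^ 5) := by
  obtain ⟨K, t, c₁, c₂, ζ, c, hK, ht, -, -, hζ, hc, hev⟩ := h
  refine ⟨t, K, c, ht, hK, hc, ?_⟩
  filter_upwards [hev, tendsto_log_natCast_atTop.eventually_ge_atTop 1] with m hm hL
  obtain ⟨h1, -, -, h4⟩ := hm
  refine ⟨hX m, fun j i => (h1 j i).1, fun j i => (h1 j i).2, fun j => ?_⟩
  have h5 : c * Real.log m ^ 5 ≤ c * Real.log m ^ ζ := by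
    gcongr
    rw [← Real.rpow_natCast]
    exact Real.rpow_le_rpow_of_exponent_le hL (by norm_num; linarith)
  refine h5.trans (h4.trans ?_)
  have : min ((D m).n 0) ((D m).n 1) ≤ (D m).n j := by
    fin_cases j
    · exact min_le_left _ _
    · exact min_le_right _ _
  exact_mod_cast this

theorem eventually_card_signals {D : ∀ m, TwoSample m (P m)} {β : ℝ}
    (h : Tendsto (fun m : ℕ => ((D m).signals.card : ℝ) / (m : ℝ) ^ β) atTop (𝓝 1)) :
    ∀ᶠ m : ℕ in atTop, 1 / 2 * Real.exp (β * Real.log m) ≤ (D m).signals.card ∧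
      ((D m).signals.card : ℝ) ≤ 2 * Real.exp (β * Real.log m) := by
  filter_upwards [h.eventually (Icc_mem_nhds (by norm_num : (1 / 2 : ℝ) < 1) one_lt_two),
    eventually_gt_atTop 0] with m hm hm0
  have hm0' : 0 < (m : ℝ) := by exact_mod_cast hm0
  have he : (m : ℝ) ^ β = Real.exp (β * Real.log m) := by
    rw [Real.rpow_def_of_pos hm0', mul_comm]
  rw [he] at hm
  have := Real.exp_pos (β * Real.log m)
  exact ⟨(le_div_iff₀ this).1 hm.1, (div_le_iff₀ this).1 hm.2⟩

theorem tendsto_const_mul_exp_neg_log {a C : ℝ} (ha : 0 < a) :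
    Tendsto (fun m : ℕ => C * Real.exp (-(a * Real.log m))) atTop (𝓝 0) := by
  have h1 : Tendsto (fun m : ℕ => a * Real.log m) atTop atTop :=
    tendsto_log_natCast_atTop.const_mul_atTop ha
  simpa using (Real.tendsto_exp_neg_atTop_nhds_zero.comp h1).const_mul C

variable [∀ m, IsProbabilityMeasure (P m)]

theorem powerBH_tendsto_one {D : ∀ m, TwoSample m (P m)}
    (hX : ∀ m j k, Measurable ((D m).X j k)) {v : VarianceCase}
    (hv : v = VarianceCase.equal → ∀ᶠ m in atTop, ∀ i, (D m).var 0 i = (D m).var 1 i)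
    {α β θ : ℝ} (hα₀ : 0 < α) (hβ₁ : β < 1) (hC2 : MomentCondition D)
    (hsize : ∀ᶠ m in atTop, ∀ i ∈ (D m).signals, (D m).signalSize i = θ * √(Real.log m))
    (hcount : Tendsto (fun m : ℕ => ((D m).signals.card : ℝ) / (m : ℝ) ^ β) atTop (𝓝 1))
    (hθ : √(2 * (1 - β)) < θ) : TendstoInProbability P (fun m => (D m).powerBH v α) 1 := by
  classical
  intro ε₀ hε₀
  obtain ⟨t, K, c, ht, hK, hc, hreg⟩ := hC2.exists_regular hX
  set ε := min ε₀ (1 / 2) with hε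
  have hε0 : 0 < ε := by positivity
  have hε1 : ε ≤ 1 / 2 := min_le_right _ _
  obtain ⟨τ, hτ1, hτ2⟩ := exists_between hθ
  have hτ0 : 0 < τ := (Real.sqrt_nonneg _).trans_lt hτ1
  have hs : 1 - β < τ ^ 2 / 2 := by
    have := (Real.sqrt_lt' hτ0).1 hτ1
    linarith
  -- The cutoff m^(-s') lies above the typical signal p-value, as s' < τ²/2, and below m^(β-1), as
  -- s' > 1-β.
  obtain ⟨s', hs'1, hs'2⟩ := exists_between hs
  refine tendsto_measure_zero_of_eventually_le fun ρ hρ => ?_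
  have hvev : ∀ᶠ m in atTop, v = VarianceCase.equal → ∀ i, (D m).var 0 i = (D m).var 1 i := by
    by_cases h : v = VarianceCase.equal
    · filter_upwards [hv h] with m hm _ using hm
    · exact Eventually.of_forall fun m hm => absurd hm h
  filter_upwards [hreg, hvev, hsize, eventually_card_signals hcount,
    tendsto_log_natCast_atTop.eventually
      -- The level ρε becomes ρ after Markov's inequality divides by ε.
      (eventually_signal_lower ht hK hc hτ0 hτ2 (mul_pos hρ hε0)),
    tendsto_log_natCast_atTop.eventually
      (eventually_studentTail_le (by linarith : 0 ≤ s') hs'2 (half_pos hc)),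
    tendsto_log_natCast_atTop.eventually
      (eventually_sample_size_large ht hK hc one_pos one_pos one_pos),
    (tendsto_const_mul_exp_neg_log (C := 1) (show 0 < s' - (1 - β) by linarith)).eventually
      (Iio_mem_nhds (show 0 < α / 4 by positivity)), eventually_gt_atTop 0]
    with m hR hvm hsz hcd hsl hst hss hlim hm0
  obtain ⟨-, hN2, -⟩ := hss
  have hm0' : 0 < (m : ℝ) := by exact_mod_cast hm0
  have hν : c / 2 * Real.log m ^ 5 ≤ ((D m).n 0 : ℝ) + (D m).n 1 - 2 := by
    linarith [hR.le_size 0, hR.le_size 1]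
  have hν0 : 0 < ((D m).n 0 : ℝ) + (D m).n 1 - 2 := by linarith [hR.le_size 0, hR.le_size 1]
  have hq := hst _ hν
  have hτL : √(2 * (τ ^ 2 / 2) * Real.log m) = τ * √(Real.log m) := by
    rw [show 2 * (τ ^ 2 / 2) * Real.log m = τ ^ 2 * Real.log m by ring,
      Real.sqrt_mul (sq_nonneg τ), Real.sqrt_sq hτ0.le]
  rw [hτL] at hq
  set x := Real.exp (-s' * Real.log m) with hx
  have hcd0 : 0 < ((D m).signals.card : ℝ) := lt_of_lt_of_le (by positivity) hcd.1
  have hne : (D m).signals.Nonempty := Finset.card_pos.1 (by exact_mod_cast hcd0)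
  have hxle : x ≤ α * ((1 - ε) * (D m).signals.card) / m := by
    rw [le_div_iff₀ hm0']
    have e2 : x * m = 1 * Real.exp (-((s' - (1 - β)) * Real.log m)) *
        Real.exp (β * Real.log m) := by
      calc x * m = x * Real.exp (Real.log m) := by rw [Real.exp_log hm0']
        _ = _ := by
          rw [hx, one_mul, ← Real.exp_add, ← Real.exp_add]
          ring_nf
    have hlim' : 1 * Real.exp (-((s' - (1 - β)) * Real.log m)) < α / 4 := hlim
    rw [e2]
    calc _ ≤ α / 4 * Real.exp (β * Real.log m) := by gcongr
      _ = α * (1 / 2 * (1 / 2 * Real.exp (β * Real.log m))) := by ring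
      _ ≤ _ := by
          gcongr α * ?_
          exact mul_le_mul (by linarith) hcd.1 (by positivity) (by linarith)
  have hmk := prob_count_ge_le_markov (P := P m) hne
    (A := fun i => {ω | |(D m).tStat v i ω| ≤ τ * √(Real.log m)})
    (fun i _ => measurableSet_le (hR.measurable_tStat v i).abs measurable_const) hε0
    (fun i hi => hsl (D m) hR v i (fun h => hvm h i) (hsz i hi))
  rw [mul_div_cancel_right₀ _ hε0.ne'] at hmk
  refine le_trans (measureReal_mono fun ω hω => ?_) hmk
  by_contra hcon
  simp only [Set.mem_ofPred_eq, not_le] at hcon hω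
  have hlt : |(D m).powerBH v α ω - 1| < ε := by
    refine TwoSample.abs_powerBH_sub_one_lt hα₀.le hxle (lt_of_le_of_lt ?_ hcon)
    refine Nat.cast_le.2 (Finset.card_le_card fun i hi => ?_)
    rw [Finset.mem_filter] at hi ⊢
    refine ⟨hi.1, ?_⟩
    by_contra hgt
    rw [not_le] at hgt
    have h1 := studentTail_strictAnti hν0 hgt
    have h2 := hi.2
    rw [TwoSample.pValue_eq_studentTail] at h2
    linarith
  exact absurd (hω.trans_lt hlt) (not_lt.2 (min_le_left _ _))

theorem powerBH_tendsto_zero {D : ∀ m, TwoSample m (P m)}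
    (hX : ∀ m j k, Measurable ((D m).X j k)) {v : VarianceCase}
    (hv : v = VarianceCase.equal → ∀ᶠ m in atTop, ∀ i, (D m).var 0 i = (D m).var 1 i)
    {α β θ : ℝ} (hα₀ : 0 < α) (hα₁ : α < 1) (hβ₀ : 0 < β) (hθ0 : 0 < θ)
    (hC2 : MomentCondition D) (hC3 : WeakDependence D)
    (hsize : ∀ᶠ m in atTop, ∀ i ∈ (D m).signals, (D m).signalSize i = θ * √(Real.log m))
    (hcount : Tendsto (fun m : ℕ => ((D m).signals.card : ℝ) / (m : ℝ) ^ β) atTop (𝓝 1))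
    (hθ : θ < √(2 * (1 - β))) : TendstoInProbability P (fun m => (D m).powerBH v α) 0 := by
  classical
  intro ε hε
  obtain ⟨t, K, c, ht, hK, hc, hreg⟩ := hC2.exists_regular hX
  obtain ⟨Kd, hKd, hdep⟩ := hC3
  obtain ⟨τ, hτ1, hτ2⟩ := exists_between hθ
  have hτ0 : 0 < τ := hθ0.trans hτ1
  have hs : τ ^ 2 / 2 < 1 - β := by
    have := (Real.lt_sqrt hτ0.le).1 hτ2
    linarith
  -- With u₀ = m^(-s'), s' > τ²/2 puts most signals above u₀, s' < 1-β makes the signals few against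
  -- mu₀, and s' < 1 keeps u₀ in the range of the null tail bound.
  obtain ⟨s', hs'1, hs'2⟩ := exists_between hs
  have hs'0 : 0 < s' := lt_trans (by positivity) hs'1
  -- slack for the false discoveries
  obtain ⟨δ, hδ, hδα⟩ : ∃ δ > 0, (1 + 2 * δ) * (1 + δ) * α + δ ≤ 1 := by
    have h : Tendsto (fun δ : ℝ => (1 + 2 * δ) * (1 + δ) * α + δ) (𝓝[>] 0)
        (𝓝 ((1 + 2 * 0) * (1 + 0) * α + 0)) := by
      refine tendsto_nhdsWithin_of_tendsto_nhds (ContinuousAt.tendsto ?_)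
      fun_prop
    have h1 := h.eventually (Iio_mem_nhds (show _ < 1 by simpa using hα₁))
    obtain ⟨δ, h3, h4⟩ := (h1.and self_mem_nhdsWithin).exists
    exact ⟨δ, h4, le_of_lt h3⟩
  refine tendsto_measure_zero_of_eventually_le fun ρ hρ => ?_
  have hvev : ∀ᶠ m in atTop, v = VarianceCase.equal → ∀ i, (D m).var 0 i = (D m).var 1 i := by
    by_cases h : v = VarianceCase.equal
    · filter_upwards [hv h] with m hm _ using hm
    · exact Eventually.of_forall fun m hm => absurd hm h
  filter_upwards [hreg, hvev, hsize, hdep, eventually_card_signals hcount,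
    tendsto_log_natCast_atTop.eventually
      (eventually_signal_upper ht hK hc hθ0 hτ1 (mul_pos (half_pos hρ) hε)),
    tendsto_log_natCast_atTop.eventually
      (eventually_prob_tStat_ge_le ht hK hc (half_pos hδ)),
    tendsto_log_natCast_atTop.eventually
      (eventually_le_studentTail (by positivity : 0 < τ ^ 2 / 2) hs'1 (half_pos hc)),
    tendsto_log_natCast_atTop.eventually
      (eventually_studentTail_le hs'0.le (by linarith : s' < 1) (half_pos hc)),
    tendsto_log_natCast_atTop.eventually
      (eventually_sample_size_large ht hK hc one_pos one_pos one_pos),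
    (tendsto_const_mul_exp_neg_log (C := 6) (show 0 < 1 - s' by linarith)).eventually
      (Iio_mem_nhds (half_pos hδ)),
    (tendsto_const_mul_exp_neg_log (C := 2) (show 0 < 1 - s' - β by linarith)).eventually
      (Iio_mem_nhds hδ),
    -- The failure probability of the uniform null bound; it vanishes because mu₀ = m^(1-s') tends
    -- to infinity.
    (tendsto_const_mul_exp_neg_log (C := Kd * (1 + δ) / δ ^ 2 * ((1 + δ) / δ))
      (show 0 < 1 - s' by linarith)).eventually (Iio_mem_nhds (half_pos hρ)),
    eventually_gt_atTop 0]
    with m hR hvm hsz hdm hcd hsu htail hst hst1 hss hlim1 hlim2 hlim3 hm0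
  obtain ⟨-, hN2, -⟩ := hss
  have hm0' : 0 < (m : ℝ) := by exact_mod_cast hm0
  have hν : c / 2 * Real.log m ^ 5 ≤ ((D m).n 0 : ℝ) + (D m).n 1 - 2 := by
    linarith [hR.le_size 0, hR.le_size 1]
  have hν0 : 0 < ((D m).n 0 : ℝ) + (D m).n 1 - 2 := by linarith [hR.le_size 0, hR.le_size 1]
  have hq := hst _ hν
  have hq1 := hst1 _ hν
  have hτL : √(2 * (τ ^ 2 / 2) * Real.log m) = τ * √(Real.log m) := by
    rw [show 2 * (τ ^ 2 / 2) * Real.log m = τ ^ 2 * Real.log m by ring,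
      Real.sqrt_mul (sq_nonneg τ), Real.sqrt_sq hτ0.le]
  rw [hτL] at hq
  rw [mul_one] at hq1
  set u₀ := Real.exp (-s' * Real.log m) with hu₀
  have hu₀0 : 0 < u₀ := Real.exp_pos _
  have hm_exp : (m : ℝ) = Real.exp (Real.log m) := (Real.exp_log hm0').symm
  have hmu₀ : m * u₀ = Real.exp ((1 - s') * Real.log m) := by
    nth_rw 1 [hm_exp]
    rw [hu₀, ← Real.exp_add]
    ring_nf
  -- the true nulls
  have hsmall : 6 * Real.exp (-Real.log m) ≤ δ / 2 * u₀ := by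
    have e : 6 * Real.exp (-Real.log m) = 6 * Real.exp (-((1 - s') * Real.log m)) * u₀ := by
      rw [hu₀, mul_assoc, ← Real.exp_add]; ring_nf
    rw [e]
    gcongr
  have hcnt := TwoSample.prob_null_count_ge_le hR hN2 (v := v) hδ hKd hm0 hu₀0 hdm
    (fun i hi x hx hxL => htail (D m) hR v i (fun h => hvm h i)
      (Finset.mem_filter.1 hi).2 x hx hxL) hsmall hq1
  obtain ⟨B, hB, hBc⟩ := exists_uniform_count_bound (P := P m)
    (N := fun u ω => ((((D m).nulls.filter fun i => (D m).pValue v ω i ≤ u).card : ℕ) : ℝ))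
    (fun ω u u' huu' => Nat.cast_le.2 (Finset.card_le_card fun i hi => by
      rw [Finset.mem_filter] at hi ⊢
      exact ⟨hi.1, hi.2.trans huu'⟩))
    (a := (1 + 2 * δ) * m) (C := Kd * (1 + δ) / (δ ^ 2 * m)) (by positivity) (by positivity)
    hδ hu₀0 hcnt
  have hBρ : (P m).real B ≤ ρ / 2 := by
    refine hB.trans (le_trans (le_of_eq ?_) (le_of_lt hlim3))
    have : Real.exp (-((1 - s') * Real.log m)) = 1 / (m * u₀) := by
      rw [hmu₀, Real.exp_neg, one_div]
    rw [this]
    field_simp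
  -- the signals
  have hcd0 : 0 < ((D m).signals.card : ℝ) := lt_of_lt_of_le (by positivity) hcd.1
  have hne : (D m).signals.Nonempty := Finset.card_pos.1 (by exact_mod_cast hcd0)
  have hmk := prob_count_ge_le_markov (P := P m) hne
    (A := fun i => {ω | τ * √(Real.log m) ≤ |(D m).tStat v i ω|})
    (fun i _ => measurableSet_le measurable_const (hR.measurable_tStat v i).abs) hε
    (fun i hi => hsu (D m) hR v i (fun h => hvm h i) (hsz i hi))
  rw [mul_div_cancel_right₀ _ hε.ne'] at hmk
  have hsig : ((D m).signals.card : ℝ) ≤ δ * (m * u₀) := by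
    have e : 2 * Real.exp (β * Real.log m) =
        2 * Real.exp (-((1 - s' - β) * Real.log m)) * (m * u₀) := by
      rw [hmu₀, mul_assoc, ← Real.exp_add]; ring_nf
    refine hcd.2.trans (e.trans_le ?_)
    gcongr
  refine le_trans (measureReal_mono (s₂ := B ∪ {ω | ε * ((D m).signals.card : ℝ) ≤
    ((D m).signals.filter fun i =>
      ω ∈ {ω | τ * √(Real.log m) ≤ |(D m).tStat v i ω|}).card}) fun ω hω => ?_)
    ((measureReal_union_le _ _).trans ((add_le_add hBρ hmk).trans_eq (add_halves ρ)))
  by_contra hcon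
  simp only [Set.mem_union, Set.mem_ofPred_eq, not_or, not_le] at hcon hω
  have hlt : (D m).powerBH v α ω < ε := by
    refine TwoSample.powerBH_lt hα₀ hα₁ hδ hδα (lt_of_le_of_lt ?_ hcon.2) (hBc ω hcon.1) hsig
    refine Nat.cast_le.2 (Finset.card_le_card fun i hi => ?_)
    rw [Finset.mem_filter] at hi ⊢
    refine ⟨hi.1, ?_⟩
    by_contra hgt
    have hgt' : |(D m).tStat v i ω| < τ * √(Real.log m) := not_le.1 hgt
    have h1 := studentTail_strictAnti hν0 hgt'
    have h2 := hi.2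
    rw [TwoSample.pValue_eq_studentTail] at h2
    linarith
  rw [sub_zero, abs_of_nonneg (TwoSample.powerBH_nonneg _ _ _)] at hω
  linarith

end Asymptotics

/-! ### Reduction to measurable observations -/

namespace TwoSample

variable {m : ℕ} {Ω : Type*} [MeasurableSpace Ω] {P : Measure Ω} (D : TwoSample m P)

/-- The same two samples with the observations replaced by measurable versions. -/
def measurableVersion : TwoSample m P where
  n := D.n
  pop := D.pop
  isProbabilityMeasure_pop := D.isProbabilityMeasure_pop
  memLp_two := D.memLp_two
  X j k := (D.hasLaw j k).aemeasurable.mk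
  hasLaw j k := (D.hasLaw j k).congr (D.hasLaw j k).aemeasurable.ae_eq_mk.symm
  indep := D.indep.congr fun q => (D.hasLaw q.1 q.2).aemeasurable.ae_eq_mk

theorem measurable_measurableVersion (j : Fin 2) (k : Fin (D.n j)) :
    Measurable (D.measurableVersion.X j k) := (D.hasLaw j k).aemeasurable.measurable_mk

/-- `HasLaw` yields only a.e. measurability. There are finitely many observations, so almost surely
all agree with their versions, and the power is a function of them. -/
theorem powerBH_measurableVersion (v : VarianceCase) (α : ℝ) :
    D.measurableVersion.powerBH v α =ᵐ[P] D.powerBH v α := by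
  have h : ∀ᵐ ω ∂P, ∀ q : Σ j : Fin 2, Fin (D.n j),
      D.X q.1 q.2 ω = D.measurableVersion.X q.1 q.2 ω :=
    ae_all_iff.2 fun q => (D.hasLaw q.1 q.2).aemeasurable.ae_eq_mk
  filter_upwards [h] with ω hω
  have ht : ∀ i, D.measurableVersion.tStat v i ω = D.tStat v i ω := by
    intro i
    rw [tStat_eq_tOfData, tStat_eq_tOfData]
    have : (fun q : Σ j : Fin 2, Fin (D.n j) => D.X q.1 q.2 ω i) =
        fun q => D.measurableVersion.X q.1 q.2 ω i := funext fun q => by rw [hω q]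
    rw [this]
    rfl
  have hp : D.measurableVersion.pValue v ω = D.pValue v ω := by
    funext i
    unfold pValue
    rw [ht i]
    rfl
  unfold powerBH
  rw [hp]
  rfl

end TwoSample

theorem TendstoInProbability.congr_ae {Ω : ℕ → Type*} [∀ m, MeasurableSpace (Ω m)]
    {P : ∀ m, Measure (Ω m)} {Y Y' : ∀ m, Ω m → ℝ} {a : ℝ} (h : TendstoInProbability P Y a)
    (hY : ∀ m, Y m =ᵐ[P m] Y' m) : TendstoInProbability P Y' a := by
  intro ε hε
  refine (h ε hε).congr fun m => measure_congr ?_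
  filter_upwards [hY m] with ω hω
  exact propext (by change ε ≤ |Y m ω - a| ↔ ε ≤ |Y' m ω - a|; rw [hω])

end

theorem theorem3p3 {Ω : ℕ → Type*} [∀ m, MeasurableSpace (Ω m)]
    (P : ∀ m, Measure (Ω m)) [∀ m, IsProbabilityMeasure (P m)]
    (D : ∀ m, TwoSample m (P m))
    (v : VarianceCase)
    (hv : v = VarianceCase.equal → ∀ᶠ m in atTop, ∀ i, (D m).var 0 i = (D m).var 1 i)
    (α : ℝ) (hα₀ : 0 < α) (hα₁ : α < 1)
    (β : ℝ) (hβ₀ : 0 < β) (hβ₁ : β < 1)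
    (θ : ℝ) (hθ : 0 < θ)
    (hC2 : MomentCondition D) (hC3 : WeakDependence D)
    (hsize : ∀ᶠ m in atTop, ∀ i ∈ (D m).signals, (D m).signalSize i = θ * √(Real.log m))
    (hcount : Tendsto (fun m : ℕ => ((D m).signals.card : ℝ) / (m : ℝ) ^ β) atTop (𝓝 1)) :
    (θ < √(2 * (1 - β)) →
      TendstoInProbability P (fun m => (D m).powerBH v α) 0) ∧
    (√(2 * (1 - β)) < θ →
      TendstoInProbability P (fun m => (D m).powerBH v α) 1) := by
  have hX : ∀ m j k, Measurable ((D m).measurableVersion.X j k) :=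
    fun m => (D m).measurable_measurableVersion
  have hae := fun m => (D m).powerBH_measurableVersion v α
  -- Sizes and population laws are unchanged by `measurableVersion`, so all hypotheses transfer
  -- definitionally.
  exact ⟨fun h => (powerBH_tendsto_zero (D := fun m => (D m).measurableVersion) hX hv hα₀ hα₁ hβ₀
      hθ hC2 hC3 hsize hcount h).congr_ae hae,
    fun h => (powerBH_tendsto_one (D := fun m => (D m).measurableVersion) hX hv hα₀ hβ₁ hC2
      hsize hcount h).congr_ae hae⟩
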